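/- Let $V\ne 0$ be a finite-dimensional vector space over a finite field $K$ of characteristic $p$, let $\eta$ be an automorphism of $K$ with $\eta^2=1$, and let $f\colon V\times V\to K$ be linear in the first and $\eta$-linear in the second variable, such that one of the following holds: (1) $\eta=1$, $p\neq 2$ and $f$ is nondegenerate and alternating; (2) $\eta=1$, $V=W_0^*\oplus W_0$ and $f((\alpha,x),(\beta,y))=\beta(x)$; (3) $\eta\ne1$ and $f$ is nondegenerate and $\eta$-Hermitian. Put $\hat f(x,y)=T(\lambda f(x,y))$, where $T\colon K\to\mathbf F_p$ is the trace, $\lambda=1$ in cases (1), (2), and $\lambda^\eta\ne\lambda$ in case (3). Let $E(\hat f)=V\times\mathbf F_p$ with product $(x_1,z_1)(x_2,z_2)=(x_1+x_2,\,z_1+z_2+\hat f(x_1,x_2))$, let $G(\hat f)$ be the group of $K$-linear automorphisms of $V$ preserving $\hat f$, acting on $E(\hat f)$ by $(x,z)\mapsto(gx,z)$, and let $G(\hat f)\ltimes E(\hat f)$ be the split extension. A finite $p$-group is extraspecial if its derived group, centre and Frattini subgroup all have order $p$. Write $D$, $Q$ for the dihedral and quaternion groups of order $8$, $E$ for the nonabelian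 group of order $27$ and exponent $3$, and $P^n$ for the central product of $n$ copies of $P$ (with amalgamated centres). Then the following hold. (a) $\hat f-\hat f^{\,t}$ is nondegenerate, $|V|=p^{2n}$ for some $n$, $E(\hat f)$ is extraspecial of order $p^{2n+1}$, and $G(\hat f)=G(f)$, the group of $K$-linear automorphisms preserving $f$. (b) If $K'$ is a finite field containing a primitive $p$-th root of $1$, then $E(\hat f)$ has a faithful absolutely irreducible representation over $K'$. If $\tilde\rho\colon E(\hat f)\to\mathrm{GL}(W)$ is any finite-dimensional faithful absolutely irreducible representation over a field $K'$ of characteristic $p'\ne p$, then $\tilde\rho$ extends to a faithful representation $\bar\rho\colon G(\hat f)\ltimes E(\hat f)\to \mathrm{GL}(W)$ that preserves every sesquilinear form (with respect to any endomorphism of $K'$) preserved by $\tilde\rho$. (c) Let $K'$ in (b) be finite, of characteristic a prime $p'\ne p$. Say that doubling is needed if $E(\hat f)\cong D^n$ for some $n$, or if $p$ and $\mathrm{ord}_p(p')$ are both odd. If $p=2$ and doubling is not needed, then $\tilde\rho$ preserves a nondegenerate alternating form $f'$ on $V'=W$. If $p$ is odd and $\eta'$ is an automorphism of $K'$ of order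 $2$ inverting the $p$-th roots of $1$, then $\tilde\rho$ preserves a nondegenerate $\eta'$-Hermitian form $f'$ on $V'=W$; such an $\eta'$ exists if $\mathrm{ord}_p(p')$ is even and $|K'|=(p')^{\mathrm{ord}_p(p')}$. (d) Let $f'$ be a form on a space $V'$ over a finite field $K'$ of characteristic $p'\neq p$, again of one of the types (1)–(3), and $\widehat{f'}$ an associated form as above. If $V'=W^*\oplus W$ with $f'$ as in (2), and $\tilde\rho$ is a faithful absolutely irreducible representation of $E(\hat f)$ on $W$, then for some extension $\bar\rho$ of $\tilde\rho$ to $G(\hat f)\ltimes E(\hat f)$ the representation $\bar\rho^*\oplus\bar\rho$ is an embedding $G(\hat f)\ltimes E(\hat f)\hookrightarrow G(\widehat{f'})$. If $\tilde\rho$ is a faithful absolutely irreducible representation of $E(\hat f)$ on $V'$ that preserves $f'$, then it extends to an embedding $G(\hat f)\ltimes E(\hat f)\hookrightarrow G(\widehat{f'})$. Call an embedding $\Phi\colon G(\hat f)\ltimes E(\hat f)\hookrightarrow G(\widehat{f'})$ with $p'\ne p$ a Weil step if, when doubling is needed, $V'=W^*\oplus W$ with $f'$ as in (2) and $\Phi=\bar\rho^*\oplus\bar\rho$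 for a representation $\bar\rho$ on $W$ whose restriction to $E(\hat f)$ is faithful and absolutely irreducible; and, when doubling is not needed, the restriction of $\Phi$ to $E(\hat f)$ is faithful and absolutely irreducible on $V'$, and $f'$ is of type (1) if $p=2$ and of type (3) if $p$ is odd. (e) The process can be continued indefinitely: write now $f_1$ for $\hat f$; for every sequence of primes $p_1=p,p_2,p_3,\dots$ with $p_{i+1}\ne p_i$ there are forms $f_1,f_2,f_3,\dots$, where $f_i$ is the $\mathbf F_{p_i}$-valued form associated as above with a form of one of the types (1)–(3) in characteristic $p_i$, and Weil steps $G(f_i)\ltimes E(f_i)\hookrightarrow G(f_{i+1})$ for all $i$. (f) For any such forms $f_1,\dots,f_n$, with Weil steps $G(f_i)\ltimes E(f_i)\hookrightarrow G(f_{i+1})$ $(1\le i<n)$, form the iterated split extension $$\Gamma_n=G(f_1)\ltimes E(f_1)\ltimes E(f_2)\ltimes\cdots\ltimes E(f_n),\qquad\Gamma_0=G(f_1),\quad \Gamma_{i}=\Gamma_{i-1}\ltimes E(f_{i}),\tag{$*$}$$ where $\Gamma_{i}$ acts on $E(f_{i+1})$ through $\Gamma_i\to G(f_i)\ltimes E(f_i)\hookrightarrow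 G(f_{i+1})$. Let $N_i=E(f_{i+1})\ltimes\cdots\ltimes E(f_n)$ be the kernel of $\Gamma_n\to\Gamma_i$ $(0\le i\le n)$. Then $\Gamma_n/N_0\cong G(f_1)$, and $N_0>N_1>\cdots>N_n=1$ are normal subgroups of $\Gamma_n$ such that $N_i/N_{i+1}\cong E(f_{i+1})$ is extraspecial and $N_{i+1}$ is contained in the derived group of $N_i$, for $0\le i<n$; thus $N_0$ is an extraspecial tower. Moreover $N_0$ is contained in the derived group of $\Gamma_n$ unless the first field $K$ has two elements and $|V|=4$. If there is a further Weil step $G(f_n)\ltimes E(f_n)\hookrightarrow G(f_{n+1})$, then the resulting map $\Gamma_n\to G(f_{n+1})$ is injective. (g) Let $n_1=1$, $n_{i+1}=3^{n_i}$ for odd $i$ and $n_{i+1}=2^{n_i-1}$ for even $i$, so that $(n_i)$ begins $1,3,4,81,2^{80}$. If $f_1$ is a nondegenerate alternating form on a two-dimensional space over $\mathbf F_3$, then $G(f_1)\cong\mathrm{Sp}_2(\mathbf F_3)$, and there is an infinite sequence of Weil steps starting from $f_1$ in which, for odd $i$, the $i$-th form is alternating on a $2n_i$-dimensional space over $\mathbf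 F_3$ and $E(f_i)\cong E^{n_i}$, and, for even $i$, the $i$-th form is Hermitian on an $n_i$-dimensional space over $\mathbf F_4$ and $E(f_i)\cong Q^{n_i}$. This gives the iterated split extension $\mathrm{Sp}_2(\mathbf F_3)\ltimes E\ltimes Q^3\ltimes E^4\ltimes Q^{81}\ltimes E^{2^{80}}\ltimes\cdots$. -/

import Mathlib

universe u v w

open scoped TensorProduct

noncomputable section

namespace WeilTower

/-! ### The group `E(b)` of a biadditive map -/

/-- The set `V × A` underlying the group `E(b)`. -/
@[ext] structure EGroup {V : Type u} {A : Type v} [AddCommGroup V] [AddCommGroup A]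
    (b : V →+ V →+ A) where
  x : V
  z : A

namespace EGroup

variable {V : Type u} {A : Type v} [AddCommGroup V] [AddCommGroup A] {b : V →+ V →+ A}

instance : Mul (EGroup b) := ⟨fun s t => ⟨s.x + t.x, s.z + t.z + b s.x t.x⟩⟩
instance : One (EGroup b) := ⟨⟨0, 0⟩⟩
instance : Inv (EGroup b) := ⟨fun s => ⟨-s.x, -s.z + b s.x s.x⟩⟩

@[simp] theorem mul_x (s t : EGroup b) : (s * t).x = s.x + t.x := rfl
@[simp] theorem mul_z (s t : EGroup b) : (s * t).z = s.z + t.z + b s.x t.x := rfl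
@[simp] theorem one_x : (1 : EGroup b).x = 0 := rfl
@[simp] theorem one_z : (1 : EGroup b).z = 0 := rfl
@[simp] theorem inv_x (s : EGroup b) : s⁻¹.x = -s.x := rfl
@[simp] theorem inv_z (s : EGroup b) : s⁻¹.z = -s.z + b s.x s.x := rfl

/-- `(x₁, z₁)(x₂, z₂) = (x₁ + x₂, z₁ + z₂ + b(x₁, x₂))`. -/
instance : Group (EGroup b) :=
  Group.ofLeftAxioms
    (by intro s t r; ext <;> simp <;> abel)
    (by intro s; ext <;> simp)
    (by intro s; ext <;> simp)

end EGroup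

/-! ### Extraspecial groups, central products, extraspecial towers -/

/-- A finite group of `p`-power order whose derived group, centre and Frattini subgroup all
have order `p`. -/
structure IsExtraspecial (p : ℕ) (P : Type u) [Group P] : Prop where
  finite : Finite P
  card_eq : ∃ k : ℕ, Nat.card P = p ^ k
  card_commutator : Nat.card (commutator P) = p
  card_center : Nat.card (Subgroup.center P) = p
  card_frattini : Nat.card (frattini P) = p

/-- `P` is the (internal) central product of the subgroups `H 0, …, H (n - 1)`, with their
centres amalgamated: they centralize each other, generate `P`, and all have centre `Z(P)`. -/
structure IsCentralProduct {P : Type u} [Group P] {n : ℕ} (H : Fin n → Subgroup P) : Prop where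
  commute : ∀ i j, i ≠ j → ∀ a ∈ H i, ∀ b ∈ H j, a * b = b * a
  generate : ⨆ i, H i = ⊤
  center : ∀ i, (Subgroup.center (H i)).map (H i).subtype = Subgroup.center P

/-- `P ≅ Dⁿ`, with `D` dihedral of order 8. -/
def IsDPower (n : ℕ) (P : Type u) [Group P] : Prop :=
  ∃ H : Fin n → Subgroup P, IsCentralProduct H ∧ ∀ i, Nonempty (H i ≃* DihedralGroup 4)

/-- `P ≅ Qⁿ`, with `Q` the quaternion group of order 8. -/
def IsQPower (n : ℕ) (P : Type u) [Group P] : Prop :=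
  ∃ H : Fin n → Subgroup P, IsCentralProduct H ∧ ∀ i, Nonempty (H i ≃* QuaternionGroup 2)

/-- `P ≅ Eⁿ`, with `E` the nonabelian group of order `p³` and exponent `p` (`p` odd). -/
def IsEPower (p n : ℕ) (P : Type u) [Group P] : Prop :=
  ∃ H : Fin n → Subgroup P, IsCentralProduct H ∧
    ∀ i, Nat.card (H i) = p ^ 3 ∧ Monoid.exponent (H i) = p ∧ ¬ ∀ a b : H i, a * b = b * a

/-- A series `N 0 > N 1 > ⋯ > N n` of normal subgroups of `Γ` such that each `N i / N (i+1)` is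
extraspecial and each `N (i+1)` is contained in the derived group of `N i`. -/
structure IsExtraspecialSeries {Γ : Type u} [Group Γ] (n : ℕ) (N : ℕ → Subgroup Γ) : Prop where
  normal : ∀ i ≤ n, (N i).Normal
  lt : ∀ i < n, N (i + 1) < N i
  extraspecial : ∀ i < n, ∃ _ : ((N (i + 1)).subgroupOf (N i)).Normal,
    ∃ p : ℕ, p.Prime ∧ IsExtraspecial p (N i ⧸ (N (i + 1)).subgroupOf (N i))
  le_derived : ∀ i < n, N (i + 1) ≤ ⁅N i, N i⁆

/-- `T` is an extraspecial tower of length `n`: it has a series `T = N 0 > N 1 > ⋯ > N n = 1`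
as above. -/
def IsExtraspecialTower (n : ℕ) (T : Type u) [Group T] : Prop :=
  ∃ N : ℕ → Subgroup T, N 0 = ⊤ ∧ N n = ⊥ ∧ IsExtraspecialSeries n N

/-! ### Representations -/

/-- Extension of scalars of a representation. -/
def scalarExt {k : Type u} {Γ : Type v} {W : Type w} [Field k] [Group Γ] [AddCommGroup W]
    [Module k W] (L : Type u) [Field L] [Algebra k L] (ρ : Representation k Γ W) :
    Representation L Γ (L ⊗[k] W) :=
  (Module.End.baseChangeHom k L W : Module.End k W →* Module.End L (L ⊗[k] W)).comp ρ

/-- A faithful absolutely irreducible representation. -/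
def IsFaithfulAbsIrr {k : Type u} {Γ : Type v} {W : Type w} [Field k] [Group Γ] [AddCommGroup W]
    [Module k W] (ρ : Representation k Γ W) : Prop :=
  Function.Injective ρ ∧ (scalarExt (AlgebraicClosure k) ρ).IsIrreducible

/-- The representation `ρ` preserves the sesquilinear form `B`. -/
def Preserves {k : Type u} {Γ : Type v} {W : Type w} [Field k] [Group Γ] [AddCommGroup W]
    [Module k W] {θ : k →+* k} (ρ : Representation k Γ W) (B : W →ₗ[k] W →ₛₗ[θ] k) : Prop :=
  ∀ (a : Γ) (x y : W), B (ρ a x) (ρ a y) = B x y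

/-! ### The forms, and the groups attached to them -/

/-- A nonzero finite-dimensional space `V` over a finite field `K` of characteristic `p`, with a
form `f` on `V` that is linear in the first and `η`-linear in the second variable (an
endomorphism `η` of a finite field is an automorphism), and a scalar `lam` (the `λ` of `f̂_λ`). -/
structure FormSpace where
  p : ℕ
  K : Type u
  V : Type u
  [prime : Fact p.Prime]
  [field : Field K]
  [finite : Finite K]
  [algebra : Algebra (ZMod p) K]
  [addCommGroup : AddCommGroup V]
  [module : Module K V]
  [finiteDimensional : FiniteDimensional K V]
  [nontrivial : Nontrivial V]
  η : K →+* K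
  f : V →ₗ[K] V →ₛₗ[η] K
  lam : K

namespace FormSpace

attribute [instance] prime field finite algebra addCommGroup module finiteDimensional nontrivial

/-- Type (1): a nondegenerate alternating bilinear form in odd characteristic; `λ = 1`. -/
def IsAlternating (D : FormSpace.{u}) : Prop :=
  D.η = RingHom.id D.K ∧ D.p ≠ 2 ∧ D.f.IsAlt ∧ D.f.Nondegenerate ∧ D.lam = 1

/-- `V` is identified by `e` with `W* ⊕ W`, and `f((α, x), (β, y)) = β(x)`; `λ = 1`. -/
def IsSplitVia (D : FormSpace.{u}) {W : Type u} [AddCommGroup W] [Module D.K W]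
    (e : D.V ≃ₗ[D.K] Module.Dual D.K W × W) : Prop :=
  D.η = RingHom.id D.K ∧ (∀ u v : D.V, D.f u v = (e v).1 (e u).2) ∧ D.lam = 1

/-- Type (2): `V = W* ⊕ W` with `f((α, x), (β, y)) = β(x)`. -/
def IsSplit (D : FormSpace.{u}) : Prop :=
  ∃ (W : Type u) (_ : AddCommGroup W) (_ : Module D.K W)
    (e : D.V ≃ₗ[D.K] Module.Dual D.K W × W), D.IsSplitVia e

/-- Type (3): a nondegenerate `η`-Hermitian form, `η` of order 2; `λ` is not fixed by `η`. -/
def IsHermitian (D : FormSpace.{u}) : Prop :=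
  D.η ≠ RingHom.id D.K ∧ (∀ a, D.η (D.η a) = a) ∧ (∀ x y, D.f y x = D.η (D.f x y)) ∧
    D.f.Nondegenerate ∧ D.η D.lam ≠ D.lam

/-- The form is of one of the three admissible types. -/
def IsAdmissible (D : FormSpace.{u}) : Prop :=
  D.IsAlternating ∨ D.IsSplit ∨ D.IsHermitian

variable (D : FormSpace.{u})

/-- `f̂(x, y) = T(λ f(x, y))`, with `T : K → 𝔽_p` the trace. -/
def hat : D.V →+ D.V →+ ZMod D.p :=
  AddMonoidHom.mk' (fun x => AddMonoidHom.mk'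
      (fun y => Algebra.trace (ZMod D.p) D.K (D.lam * D.f x y))
      (by intro y y'; simp [mul_add]))
    (by intro x x'; ext y; simp [mul_add])

/-- The group `E(f̂)`. -/
abbrev E : Type u := EGroup D.hat

/-- `G(f̂)`: all `K`-linear automorphisms of `V` that preserve `f̂`. -/
def G : Subgroup (D.V ≃ₗ[D.K] D.V) where
  carrier := {g | ∀ x y, D.hat (g x) (g y) = D.hat x y}
  mul_mem' := by intro g h hg hh x y; simp [hg _ _, hh _ _]
  one_mem' := by intro x y; rfl
  inv_mem' := by
    intro g hg x y
    have h := hg (g⁻¹ x) (g⁻¹ y)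
    rw [← LinearEquiv.mul_apply, ← LinearEquiv.mul_apply, mul_inv_cancel] at h
    exact h.symm

/-- The action of `G(f̂)` on `E(f̂)`: `g` maps `(x, z)` to `(g x, z)`. -/
def act : D.G →* MulAut D.E where
  toFun g :=
    { toFun := fun s => ⟨g.1 s.x, s.z⟩
      invFun := fun s => ⟨g.1.symm s.x, s.z⟩
      left_inv := by intro s; ext <;> simp
      right_inv := by intro s; ext <;> simp
      map_mul' := by
        intro s t
        ext
        · simp
        · simp [g.2 _ _] }
  map_one' := by ext s <;> rfl
  map_mul' := by intro g h; ext s <;> rfl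

/-- The split extension `G(f̂) ⋉ E(f̂)`. -/
abbrev GE : Type u := D.E ⋊[D.act] D.G

/-- The natural representation of `G(f̂)` on `V`. -/
def natRep : Representation D.K D.G D.V :=
  LinearEquiv.automorphismGroup.toLinearMapMonoidHom.comp D.G.subtype

end FormSpace

open FormSpace

/-! ### One step of the construction -/

/-- The condition under which the irreducible representation has to be replaced by its sum with
its contragredient: `E(f̂) ≅ Dⁿ`, or `p` and `ord_p(p')` are both odd. -/
def NeedsDouble (D : FormSpace.{u}) (p' : ℕ) : Prop :=
  (∃ n, IsDPower n D.E) ∨ (D.p ≠ 2 ∧ Odd (orderOf (p' : ZMod D.p)))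

/-- Via the isomorphism `e`, `Φ` is the sum `σ* ⊕ σ` acting on `W* ⊕ W`. -/
def IsDoubleOf {D D' : FormSpace.{u}} (Φ : D.GE →* D'.G) {W : Type u} [AddCommGroup W]
    [Module D'.K W] (σ : Representation D'.K D.GE W)
    (e : D'.V ≃ₗ[D'.K] Module.Dual D'.K W × W) : Prop :=
  ∀ (a : D.GE) (v : D'.V), e ((Φ a).1 v) = (σ.dual a (e v).1, σ a (e v).2)

/-- `Φ : G(f̂) ⋉ E(f̂) → G(f̂')` is an embedding, and arises from a faithful absolutely irreducible
representation of `E(f̂)` over `K'` in the way prescribed by the construction: it is the sum of an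
extension of that representation to `G(f̂) ⋉ E(f̂)` and the contragredient of the extension if
this is needed, and otherwise such an extension on a space with an alternating form (`p = 2`) or
a Hermitian form (`p` odd). -/
def IsWeilStep (D D' : FormSpace.{u}) (Φ : D.GE →* D'.G) : Prop :=
  D'.p ≠ D.p ∧ Function.Injective Φ ∧
  ((NeedsDouble D D'.p ∧
      ∃ (W : Type u) (_ : AddCommGroup W) (_ : Module D'.K W) (σ : Representation D'.K D.GE W)
        (e : D'.V ≃ₗ[D'.K] Module.Dual D'.K W × W),
        IsFaithfulAbsIrr (σ.comp (SemidirectProduct.inl : D.E →* D.GE)) ∧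
        D'.IsSplitVia e ∧ IsDoubleOf Φ σ e) ∨
   (¬ NeedsDouble D D'.p ∧
      IsFaithfulAbsIrr ((D'.natRep.comp Φ).comp (SemidirectProduct.inl : D.E →* D.GE)) ∧
      (D.p = 2 → D'.IsAlternating) ∧ (D.p ≠ 2 → D'.IsHermitian)))

/-! ### The iterated split extension -/

/-- A group together with a homomorphism to `G(f̂)`. -/
structure GroupOver (D : FormSpace.{u}) where
  Γ : Type u
  [group : Group Γ]
  hom : Γ →* D.G

attribute [instance] GroupOver.group

/-- `Γ ⋉ E(f̂)`, for `Γ` acting on `E(f̂)` through `G(f̂)`. -/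
abbrev GroupOver.Ext {D : FormSpace.{u}} (S : GroupOver D) : Type u :=
  D.E ⋊[D.act.comp S.hom] S.Γ

/-- The natural map `Γ ⋉ E(f̂) → G(f̂) ⋉ E(f̂)`. -/
def GroupOver.extHom {D : FormSpace.{u}} (S : GroupOver D) : S.Ext →* D.GE :=
  SemidirectProduct.map (MonoidHom.id D.E) S.hom (by intro g; rfl)

variable (D : ℕ → FormSpace.{u}) (Φ : ∀ i, (D i).GE →* (D (i + 1)).G)

/-- The iterated split extension `Γ_n = G(f̂_0) ⋉ E(f̂_0) ⋉ E(f̂_1) ⋉ ⋯ ⋉ E(f̂_{n-1})` with its map to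
`G(f̂_n)`; here `Γ_0 = G(f̂_0)` and `Γ_{n+1} = Γ_n ⋉ E(f̂_n) → G(f̂_n) ⋉ E(f̂_n) → G(f̂_{n+1})`. -/
def iter : (n : ℕ) → GroupOver (D n)
  | 0 => ⟨(D 0).G, MonoidHom.id _⟩
  | n + 1 => ⟨(iter n).Ext, (Φ n).comp (iter n).extHom⟩

/-- The projection of `Γ_n` onto `G(f̂_0)`. -/
def toBase : (n : ℕ) → (iter D Φ n).Γ →* (D 0).G
  | 0 => MonoidHom.id _
  | n + 1 => (toBase n).comp
      (SemidirectProduct.rightHom : (iter D Φ n).Ext →* (iter D Φ n).Γ)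

/-- The normal subgroup `N_i = E(f̂_i) ⋉ ⋯ ⋉ E(f̂_{n-1})` of `Γ_n`, that is, the kernel of the
projection `Γ_n → Γ_i` (and the trivial subgroup for `i ≥ n`). -/
def series : (n : ℕ) → ℕ → Subgroup (iter D Φ n).Γ
  | 0, _ => ⊥
  | n + 1, i => if i ≤ n then
      (series n i).comap (SemidirectProduct.rightHom : (iter D Φ n).Ext →* (iter D Φ n).Γ)
      else ⊥

/-- The exponents `1, 3, 4, 81, 2^80, …` of the example:
`n_{i+1} = 3 ^ n_i` for even `i` and `n_{i+1} = 2 ^ n_i / 2` for odd `i`. -/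
def exponents : ℕ → ℕ
  | 0 => 1
  | i + 1 => if Even i then 3 ^ exponents i else 2 ^ (exponents i - 1)

end WeilTower

end

open scoped TensorProduct

noncomputable section

namespace WeilTower

open FormSpace
open scoped commutatorElement

/-! ### The extraspecial group of a biadditive form -/

/-! The commutator of two elements of `E(b)` depends only on their `V`-components and equals `comm
b` of these. For each of the three types `comm f̂` is nondegenerate, because the trace form is; this
makes `E(f̂)` extraspecial.

Representations. In a faithful absolutely irreducible representation the centre acts by a nontrivial
character `ψ`, and the operators `e x` of the elements `(x, 0)` satisfy `e x * e y = ψ (b x y) • e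
(x + y)`. Averaging over conjugation by all `e x` kills `e y` for `y ≠ 0` (orthogonality of
characters). Hence the `e x` are linearly independent, every operator is a combination of the `e x`
with coefficients in the commutant, and by Schur's lemma the `e x` form a basis of `End W`.
Everything afterwards uses only this (`IsWeil`).

Extension. For `g` preserving `b`, the sum `X g = ∑ e (g x) * (e x)⁻¹` intertwines `e` with `e ∘ g`.
It is invertible, since `X g⁻¹ * X g` is the scalar `|V| * |fix g|`, and `X g * X h = γ(g, h) • X (g
h)`, where `γ` is a quadratic Gauss sum divided by `|fix (g h)|`. The representation extends to
`G(f̂) ⋉ E(f̂)` once `γ` is exhibited as a coboundary, and the extension preserves the forms of `ρ`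
if the rescaling has the correct norm. There are three arguments. For `p` odd, the fourth power of
`γ` is known because the square of a Gauss sum is unchanged when the form is negated, and its power
with exponent `dim W` is known from determinants; the two exponents are coprime. For split forms,
the vectors fixed by the isotropic subgroup `W*` form a line, which every `X g` preserves; its
eigenvalue there trivializes `γ`. For Hermitian forms with `p = 2`, the Gauss sum is a rational
integer of known square. Its sign follows from a congruence modulo an odd prime dividing `q + 1`,
obtained by letting scalars of norm one act. The result is a power of `-q` with an exponent that is
visibly a coboundary.

Invariant forms. If `θ` inverts the values of `ψ`, summing a rank-one form over `V` gives a nonzero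
invariant form. For `p` odd it can be made Hermitian. For `p = 2` it can be made alternating unless
it is symmetric, and a symmetric one forces the quadratic form `b x x` to have more zeros than ones.
Then there is a self-orthogonal totally singular subgroup, so that `E(b)` is a central product of
dihedral groups.

Towers. The commutator of `g` with `(y, 0)` has `V`-component `g y - y`. In a Weil step a central
element of `E(f_i)` acts on the next space without nonzero fixed vectors, so each layer consists of
commutators with the layer before it. Only the lowest layer depends on `G(f_1)`, which is where the
exceptional case arises.

In the example the Hermitian spaces over the field of four elements have odd dimension `m`; there
the sum of signs of `f̂ x x` is `(-2) ^ m < 0`, which rules out `D^n`. -/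

section Comm

variable {V : Type*} [AddCommGroup V] {A : Type*} [AddCommGroup A]

/-- The alternating form `b(x, y) - b(y, x)`, which describes the commutators in `E(b)`. -/
def comm (b : V →+ V →+ A) : V →+ V →+ A := b - b.flip

@[simp] theorem comm_apply (b : V →+ V →+ A) (x y : V) : comm b x y = b x y - b y x := rfl

theorem comm_self (b : V →+ V →+ A) (x : V) : comm b x x = 0 := by simp

theorem comm_swap (b : V →+ V →+ A) (x y : V) : comm b y x = -comm b x y := by simp

/-- The form `b(x, y) - b(y, x)` is nondegenerate. -/
def IsNondeg (b : V →+ V →+ A) : Prop := ∀ x, (∀ y, comm b x y = 0) → x = 0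

end Comm

namespace EGroup

section

variable {V : Type*} {A : Type*} [AddCommGroup V] [AddCommGroup A] {b : V →+ V →+ A}

theorem commutatorElement_eq (s t : EGroup b) : ⁅s, t⁆ = ⟨0, comm b s.x t.x⟩ := by
  rw [commutatorElement_def]
  ext
  · simp
  · simp
    abel

theorem commute_iff (s t : EGroup b) : s * t = t * s ↔ comm b s.x t.x = 0 := by
  rw [EGroup.ext_iff]
  simp only [mul_x, mul_z, comm_apply, sub_eq_zero, add_comm t.x s.x, add_comm t.z s.z, true_and,
    add_left_cancel_iff]

/-- The projection of `E(b)` onto `V`. -/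
def proj (b : V →+ V →+ A) : EGroup b →* Multiplicative V where
  toFun s := Multiplicative.ofAdd s.x
  map_one' := rfl
  map_mul' _ _ := rfl

/-- The subgroup `0 × A` of `E(b)`. -/
def base (b : V →+ V →+ A) : Subgroup (EGroup b) := (proj b).ker

@[simp] theorem mem_base {s : EGroup b} : s ∈ base b ↔ s.x = 0 := Iff.rfl

/-- The bijection of `V × A` with `E(b)`. -/
def equivProd (b : V →+ V →+ A) : EGroup b ≃ V × A where
  toFun s := (s.x, s.z)
  invFun s := ⟨s.1, s.2⟩
  left_inv _ := rfl
  right_inv _ := rfl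

/-- The bijection of the subgroup `0 × A` with `A`. -/
def equivBase (b : V →+ V →+ A) : base b ≃ A where
  toFun s := s.1.z
  invFun a := ⟨⟨0, a⟩, rfl⟩
  left_inv s := by
    ext
    · exact s.2.symm
    · rfl
  right_inv _ := rfl

instance [Finite V] [Finite A] : Finite (EGroup b) := Finite.of_equiv _ (equivProd b).symm

theorem center_eq (hb : IsNondeg b) : Subgroup.center (EGroup b) = base b := by
  ext s
  rw [Subgroup.mem_center_iff, mem_base]
  constructor
  · intro h
    refine hb _ fun y => ?_
    have := (commute_iff (b := b) ⟨y, 0⟩ s).1 (h _)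
    rw [comm_swap, this, neg_zero]
  · intro h t
    rw [commute_iff, h, map_zero]

end

section

variable {p : ℕ} [Fact p.Prime] {V : Type*} [AddCommGroup V] {b : V →+ V →+ ZMod p}

theorem card_base : Nat.card (base b) = p := by
  rw [Nat.card_congr (equivBase b), Nat.card_zmod]

theorem card_eq_mul : Nat.card (EGroup b) = Nat.card V * p := by
  rw [Nat.card_congr (equivProd b), Nat.card_prod, Nat.card_zmod]

theorem nsmul_eq_zero (hb : IsNondeg b) (x : V) : p • x = 0 := by
  refine hb _ fun y => ?_
  rw [map_nsmul, AddMonoidHom.nsmul_apply, nsmul_eq_mul, CharP.cast_eq_zero, zero_mul]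

theorem exists_card_eq_pow [Finite V] (hb : IsNondeg b) : ∃ k : ℕ, Nat.card V = p ^ k := by
  have h : IsPGroup p (Multiplicative V) := fun x =>
    ⟨1, by rw [pow_one]; exact congrArg Multiplicative.ofAdd (nsmul_eq_zero hb x.toAdd)⟩
  exact (IsPGroup.iff_card (G := Multiplicative V)).1 h

theorem exists_comm_eq (hb : IsNondeg b) {x : V} (hx : x ≠ 0) (c : ZMod p) :
    ∃ y, comm b x y = c := by
  obtain ⟨y, hy⟩ : ∃ y, comm b x y ≠ 0 := by
    by_contra! h
    exact hx (hb x h)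
  refine ⟨(c * (comm b x y)⁻¹).val • y, ?_⟩
  rw [map_nsmul, nsmul_eq_mul, ZMod.natCast_val, ZMod.cast_id, inv_mul_cancel_right₀ hy]

/-- For `x ≠ 0` the map `comm b x` is onto, so every element of `0 × 𝔽_p` is a single commutator. -/
theorem commutator_eq [Nontrivial V] (hb : IsNondeg b) : commutator (EGroup b) = base b := by
  apply le_antisymm
  · rw [commutator_def, Subgroup.commutator_le]
    intro s _ t _
    rw [commutatorElement_eq]
    rfl
  · intro s hs
    obtain ⟨x, hx⟩ := exists_ne (0 : V)
    obtain ⟨y, hy⟩ := exists_comm_eq hb hx s.z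
    have : s = ⁅(⟨x, 0⟩ : EGroup b), (⟨y, 0⟩ : EGroup b)⁆ := by
      rw [commutatorElement_eq]
      exact EGroup.ext hs hy.symm
    rw [this, commutator_def]
    exact Subgroup.commutator_mem_commutator trivial trivial

theorem isPGroup [Finite V] (hb : IsNondeg b) : IsPGroup p (EGroup b) := by
  obtain ⟨k, hk⟩ := exists_card_eq_pow hb
  exact IsPGroup.of_card (n := k + 1) (by rw [card_eq_mul, hk, pow_succ])

/-- The homomorphism `s ↦ comm b y s.x`. -/
def pairing (b : V →+ V →+ ZMod p) (y : V) : EGroup b →* Multiplicative (ZMod p) :=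
  (AddMonoidHom.toMultiplicative (comm b y)).comp (proj b)

/-- An element outside the base pairs nontrivially with some `y`, so it is missed by the maximal
subgroup `(pairing b y).ker`. Conversely a maximal subgroup `M` of this `p`-group is normal. If it
did not contain the base, then `M` and the base would generate the group; since commutators depend
only on the `V`-components, all of them would already be commutators of elements of `M`. -/
theorem frattini_eq [Finite V] [Nontrivial V] (hb : IsNondeg b) :
    frattini (EGroup b) = base b := by
  apply le_antisymm
  · intro s hs
    by_contra hsx
    rw [mem_base] at hsx
    obtain ⟨y, hy⟩ := exists_comm_eq hb hsx 1
    have hsurj : Function.Surjective (pairing b y) := by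
      intro c
      refine ⟨⟨(-c.toAdd).val • s.x, 0⟩, ?_⟩
      change Multiplicative.ofAdd (comm b y ((-c.toAdd).val • s.x)) = c
      rw [map_nsmul, comm_swap, hy, nsmul_eq_mul, ZMod.natCast_val, ZMod.cast_id]
      simp
    have : Fact (Nat.card (Multiplicative (ZMod p))).Prime :=
      ⟨by rw [Nat.card_eq_of_bijective Multiplicative.toAdd Multiplicative.toAdd.bijective,
        Nat.card_zmod]; exact Fact.out⟩
    have : IsSimpleGroup (Multiplicative (ZMod p)) := isSimpleGroup_of_prime_card
      (p := Nat.card (Multiplicative (ZMod p))) rfl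
    have hbot : IsCoatom (⊥ : Subgroup (Multiplicative (ZMod p))) := by
      refine ⟨bot_ne_top, fun H hH => ?_⟩
      have hn : H.Normal := inferInstance
      exact (hn.eq_bot_or_eq_top).resolve_left hH.ne'
    have hco := Subgroup.isCoatom_comap_of_surjective hsurj hbot
    have := frattini_le_coatom hco hs
    rw [Subgroup.mem_comap, Subgroup.mem_bot] at this
    have h0 : comm b y s.x = 0 := this
    rw [comm_swap, hy] at h0
    exact one_ne_zero (neg_eq_zero.1 h0)
  · rw [← commutator_eq hb, frattini, Order.radical]
    refine le_iInf fun M => le_iInf fun hM => ?_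
    have : Group.IsNilpotent (EGroup b) := (isPGroup hb).isNilpotent
    have hnorm : M.Normal := Subgroup.NormalizerCondition.normal_of_coatom M
      Group.normalizerCondition_of_isNilpotent hM
    by_contra hle
    have hsup : M ⊔ base b = ⊤ := by
      refine hM.2 _ (lt_of_le_of_ne le_sup_left fun h => hle ?_)
      rw [commutator_eq hb]
      exact left_eq_sup.1 h
    apply hle
    rw [commutator_def, ← hsup, Subgroup.commutator_le]
    have key : ∀ s ∈ M ⊔ base b, ∃ m ∈ M, m.x = s.x := by
      intro s hs
      obtain ⟨m, hm, z, hz, rfl⟩ := Subgroup.mem_sup_of_normal_left.1 hs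
      exact ⟨m, hm, by rw [mul_x, mem_base.1 hz, add_zero]⟩
    intro s hs t ht
    obtain ⟨s', hs', e⟩ := key s hs
    obtain ⟨t', ht', e'⟩ := key t ht
    rw [commutatorElement_eq, ← e, ← e', ← commutatorElement_eq, commutatorElement_def]
    exact M.mul_mem (M.mul_mem (M.mul_mem hs' ht') (M.inv_mem hs')) (M.inv_mem ht')

theorem isExtraspecial [Finite V] [Nontrivial V] (hb : IsNondeg b) :
    IsExtraspecial p (EGroup b) where
  finite := inferInstance
  card_eq := by
    obtain ⟨k, hk⟩ := exists_card_eq_pow hb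
    exact ⟨k + 1, by rw [card_eq_mul, hk, pow_succ]⟩
  card_commutator := by rw [commutator_eq hb, card_base]
  card_center := by rw [center_eq hb, card_base]
  card_frattini := by rw [frattini_eq hb, card_base]

end

end EGroup

/-! ### Twisted systems of operators -/

/-! ### Characters of `𝔽_p` and their orthogonality. -/

section CharacterSums

variable {p : ℕ} [Fact p.Prime] {k : Type*} [Field k] {ψ : AddChar (ZMod p) k}

/-- In characteristic `p` one has `(ψ 1 - 1) ^ p = ψ p - 1 = 0`, so `ψ` would be trivial. A
nontrivial `ψ` thus encodes that `p`, and hence `|V|`, is invertible in `k`. -/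
theorem natCast_prime_ne_zero (hψ : ψ ≠ 1) : (p : k) ≠ 0 := by
  intro h0
  have : CharP k p := (CharP.charP_iff_prime_eq_zero Fact.out).2 h0
  refine (AddChar.zmod_char_ne_one_iff p ψ).1 hψ ?_
  have h : (ψ 1 - 1) ^ p = 0 := by
    rw [sub_pow_char, one_pow, ← AddChar.map_nsmul_eq_pow]
    simp
  exact sub_eq_zero.1 (pow_eq_zero_iff (Fact.out : p.Prime).ne_zero |>.1 h)

theorem char_eq_one_iff (hψ : ψ ≠ 1) {a : ZMod p} : ψ a = 1 ↔ a = 0 :=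
  AddChar.IsPrimitive.zmod_char_eq_one_iff p (AddChar.IsPrimitive.of_ne_one hψ) a

theorem char_ne_zero (a : ZMod p) : ψ a ≠ 0 := by
  intro h
  have := AddChar.map_add_eq_mul ψ a (-a)
  rw [h, zero_mul, add_neg_cancel, AddChar.map_zero_eq_one] at this
  exact one_ne_zero this

theorem sum_char_comp (hψ : ψ ≠ 1) {U : Type*} [AddCommGroup U] [Fintype U] (φ : U →+ ZMod p)
    [Decidable (φ = 0)] : ∑ x, ψ (φ x) = if φ = 0 then (Nat.card U : k) else 0 := by
  split_ifs with h
  · simp [h]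
  · have hne : ψ.compAddMonoidHom φ ≠ 1 := by
      intro h1
      apply h
      ext x
      exact (char_eq_one_iff hψ).1 (DFunLike.congr_fun h1 x)
    exact AddChar.sum_eq_zero_of_ne_one hne

theorem sum_char_comm {V : Type*} [AddCommGroup V] [Fintype V] [DecidableEq V]
    {b : V →+ V →+ ZMod p} (hψ : ψ ≠ 1) (hb : IsNondeg b) (y : V) :
    ∑ x, ψ (comm b x y) = if y = 0 then (Nat.card V : k) else 0 := by
  classical
  have h := sum_char_comp hψ ((comm b).flip y)
  simp only [AddMonoidHom.flip_apply] at h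
  rw [h]
  refine if_congr ⟨fun h0 => hb _ fun x => ?_, fun h0 => by rw [h0, map_zero]⟩ rfl rfl
  rw [comm_swap, ← AddMonoidHom.flip_apply (comm b), h0]
  simp

theorem natCast_card_ne_zero {V : Type*} [AddCommGroup V] [Finite V] {b : V →+ V →+ ZMod p}
    (hψ : ψ ≠ 1) (hb : IsNondeg b) : (Nat.card V : k) ≠ 0 := by
  obtain ⟨n, hn⟩ := EGroup.exists_card_eq_pow hb
  rw [hn, Nat.cast_pow]
  exact pow_ne_zero _ (natCast_prime_ne_zero hψ)

end CharacterSums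

section Twisted

variable {p : ℕ} {V : Type*} [AddCommGroup V] {k : Type*} [Field k]
  {A : Type*} [Ring A] [Algebra k A]

/-- Elements `e x` of an algebra that multiply like the elements `(x, 0)` of `E(b)`, the centre
of `E(b)` acting by the character `ψ`. -/
structure IsTwisted (b : V →+ V →+ ZMod p) (ψ : AddChar (ZMod p) k) (e : V → A) : Prop where
  map_zero : e 0 = 1
  map_mul : ∀ x y, e x * e y = ψ (b x y) • e (x + y)

/-- The inverse of `e x` in a twisted system. -/
def tinv (b : V →+ V →+ ZMod p) (ψ : AddChar (ZMod p) k) (e : V → A) (x : V) : A :=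
  ψ (b x x) • e (-x)

/-- The operator `a ↦ ∑ e x * a * (e x)⁻¹`. -/
def avg [Fintype V] (b : V →+ V →+ ZMod p) (ψ : AddChar (ZMod p) k) (e : V → A) : A →ₗ[k] A :=
  ∑ x, LinearMap.mulLeft k (e x) ∘ₗ LinearMap.mulRight k (tinv b ψ e x)

/-- The operator `∑ e (g x) * (e x)⁻¹`, which intertwines `e` and `e ∘ g`. -/
def weilOp [Fintype V] (b : V →+ V →+ ZMod p) (ψ : AddChar (ZMod p) k) (e : V → A)
    (g : V ≃+ V) : A :=
  ∑ x, e (g x) * tinv b ψ e x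

/-- The number of fixed points of an automorphism. -/
def fixCard (g : V ≃+ V) : ℕ := Nat.card {x : V // g x = x}

/-- The quadratic form in the exponent of a product of two intertwining operators. -/
def cocycleForm (b : V →+ V →+ ZMod p) (g h : V ≃+ V) (v : V × V) : ZMod p :=
  b (g v.1 - v.1) (h v.2 - v.2) - b (g v.1 - v.1) v.1 - b (h v.2 - v.2) v.2

/-- The pairs `(x, y)` with `(g - 1) x + (h - 1) y = 0`. -/
def cocycleSet (g h : V ≃+ V) : AddSubgroup (V × V) where
  carrier := {v | g v.1 - v.1 + (h v.2 - v.2) = 0}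
  zero_mem' := by simp
  add_mem' := by
    intro v w hv hw
    simp only [Set.mem_ofPred_eq, Prod.fst_add, Prod.snd_add, map_add] at *
    calc _ = (g v.1 - v.1 + (h v.2 - v.2)) + (g w.1 - w.1 + (h w.2 - w.2)) := by abel
      _ = 0 := by rw [hv, hw, add_zero]
  neg_mem' := by
    intro v hv
    simp only [Set.mem_ofPred_eq, Prod.fst_neg, Prod.snd_neg, map_neg] at *
    rw [← neg_zero, ← hv]
    abel

theorem mem_cocycleSet {g h : V ≃+ V} {v : V × V} :
    v ∈ cocycleSet g h ↔ g v.1 - v.1 + (h v.2 - v.2) = 0 := Iff.rfl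

/-- The Gauss sum of the form `cocycleForm` on `cocycleSet`. -/
def cocycleSum (b : V →+ V →+ ZMod p) (ψ : AddChar (ZMod p) k) (g h : V ≃+ V) : k :=
  ∑ᶠ v : cocycleSet g h, ψ (cocycleForm b g h v)

theorem fixCard_dvd_card [Finite V] (g : V ≃+ V) : fixCard g ∣ Nat.card V := by
  let F : AddSubgroup V := (g.toAddMonoidHom - AddMonoidHom.id V).ker
  have : fixCard g = Nat.card F := Nat.card_congr (Equiv.subtypeEquivRight fun x => by
    simp [F, AddMonoidHom.mem_ker, sub_eq_zero])
  rw [this]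
  exact AddSubgroup.card_addSubgroup_dvd_card F

theorem natCast_fixCard_ne_zero [Fact p.Prime] [Finite V] {b : V →+ V →+ ZMod p}
    {ψ : AddChar (ZMod p) k} (hψ : ψ ≠ 1) (hb : IsNondeg b) (g : V ≃+ V) : (fixCard g : k) ≠ 0 := by
  obtain ⟨c, hc⟩ := fixCard_dvd_card g
  intro h0
  apply natCast_card_ne_zero hψ hb
  rw [hc, Nat.cast_mul, h0, zero_mul]

/-- The involution `(x, y) ↦ (h y, g x)` between the sets of pairs belonging to `(g, h)` and to
`(h⁻¹, g⁻¹)`. -/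
def cocycleEquiv (g h : V ≃+ V) : cocycleSet g h ≃ cocycleSet h.symm g.symm where
  toFun v := ⟨(h v.1.2, g v.1.1), by
    have := v.2
    rw [mem_cocycleSet] at this ⊢
    simp only [AddEquiv.symm_apply_apply]
    rw [← neg_zero, ← this]
    abel⟩
  invFun v := ⟨(g.symm v.1.2, h.symm v.1.1), by
    have := v.2
    rw [mem_cocycleSet] at this ⊢
    simp only [AddEquiv.apply_symm_apply]
    rw [← neg_zero, ← this]
    abel⟩
  left_inv v := by simp
  right_inv v := by simp

/-- Put `g x = x + w`. Membership in the set forces `h y = y - w`, and both sides expand to the same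
expression in `x`, `y`, `w`. Hence passing from `(g, h)` to `(h⁻¹, g⁻¹)` negates the form in the
Gauss sum. -/
theorem cocycleForm_equiv {b : V →+ V →+ ZMod p} {g h : V ≃+ V} (v : cocycleSet g h) :
    cocycleForm b h.symm g.symm (cocycleEquiv g h v) = -cocycleForm b g h v := by
  obtain ⟨⟨x, y⟩, hv⟩ := v
  rw [mem_cocycleSet] at hv
  obtain ⟨w, hw⟩ : ∃ w, g x = x + w := ⟨g x - x, by abel⟩
  have hy : h y = y - w := by
    simp only [hw] at hv
    rw [← sub_eq_zero, ← hv]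
    abel
  simp only [cocycleForm, cocycleEquiv, Equiv.coe_fn_mk, AddEquiv.symm_apply_apply]
  simp only [hw, hy, add_sub_cancel_left, sub_sub_cancel_left, sub_add_cancel_left, map_neg,
    map_add, map_sub, AddMonoidHom.neg_apply, sub_sub_cancel]
  abel

theorem cocycleSum_inv [Finite V] (b : V →+ V →+ ZMod p) (ψ : AddChar (ZMod p) k) (g h : V ≃+ V) :
    cocycleSum b ψ h.symm g.symm = ∑ᶠ v : cocycleSet g h, ψ (-cocycleForm b g h v) := by
  rw [cocycleSum, ← finsum_comp_equiv (cocycleEquiv g h)]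
  simp only [cocycleForm_equiv]

theorem fixCard_symm (g : V ≃+ V) : fixCard g.symm = fixCard g :=
  Nat.card_congr (Equiv.subtypeEquivRight fun x => by
    rw [AddEquiv.symm_apply_eq, eq_comm])

namespace IsTwisted

variable {b : V →+ V →+ ZMod p} {ψ : AddChar (ZMod p) k} {e : V → A}

theorem mul_tinv (he : IsTwisted b ψ e) (x : V) : e x * tinv b ψ e x = 1 := by
  rw [tinv, mul_smul_comm, he.map_mul, smul_smul, ← AddChar.map_add_eq_mul]
  simp [he.map_zero]

theorem tinv_mul (he : IsTwisted b ψ e) (x : V) : tinv b ψ e x * e x = 1 := by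
  rw [tinv, smul_mul_assoc, he.map_mul, smul_smul, ← AddChar.map_add_eq_mul]
  simp [he.map_zero]

theorem map_add (he : IsTwisted b ψ e) (x y : V) : e (x + y) = ψ (-b x y) • (e x * e y) := by
  rw [he.map_mul, smul_smul, ← AddChar.map_add_eq_mul]
  simp

theorem tinv_add (he : IsTwisted b ψ e) (x y : V) :
    tinv b ψ e (x + y) = ψ (b x y) • (tinv b ψ e y * tinv b ψ e x) := by
  simp only [tinv, smul_mul_smul_comm, he.map_mul, smul_smul, ← AddChar.map_add_eq_mul]
  congr 2
  · simp
    abel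
  · abel_nf

theorem conj (he : IsTwisted b ψ e) (x y : V) :
    e x * e y * tinv b ψ e x = ψ (comm b x y) • e y := by
  have h : e x * e y = ψ (comm b x y) • (e y * e x) := by
    rw [he.map_mul, he.map_mul, smul_smul, ← AddChar.map_add_eq_mul, add_comm y x]
    simp
  rw [h, smul_mul_assoc, mul_assoc, he.mul_tinv, mul_one]

theorem tinv_mul_map (he : IsTwisted b ψ e) (x y : V) :
    tinv b ψ e x * e y = ψ (-comm b x y) • (e y * tinv b ψ e x) := by
  have h : e y * tinv b ψ e x = ψ (comm b x y) • (tinv b ψ e x * e y) := by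
    rw [← mul_smul_comm, ← he.conj, ← mul_assoc, ← mul_assoc, he.tinv_mul, one_mul]
  rw [h, smul_smul, ← AddChar.map_add_eq_mul, neg_add_cancel, AddChar.map_zero_eq_one, one_smul]

theorem avg_apply [Fintype V] (a : A) : avg b ψ e a = ∑ x, e x * a * tinv b ψ e x := by
  simp [avg, mul_assoc]

theorem map_mul_tinv (he : IsTwisted b ψ e) (x y : V) :
    e y * tinv b ψ e x = ψ (-b (y - x) x) • e (y - x) := by
  rw [tinv, mul_smul_comm, he.map_mul, smul_smul, ← AddChar.map_add_eq_mul, sub_eq_add_neg]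
  simp

theorem avg_of_commute [Fintype V] (he : IsTwisted b ψ e) {a : A} (ha : ∀ x, e x * a = a * e x) :
    avg b ψ e a = (Nat.card V : k) • a := by
  rw [avg_apply]
  simp only [ha, mul_assoc, he.mul_tinv, mul_one]
  simp [Nat.cast_smul_eq_nsmul]

/-- Conjugation by `e t` permutes the summands by `x ↦ t + x`; the factors from `map_add` and
`tinv_add` cancel. -/
theorem avg_commute [Fintype V] (he : IsTwisted b ψ e) (a : A) (t : V) :
    e t * avg b ψ e a = avg b ψ e a * e t := by
  have h : e t * avg b ψ e a * tinv b ψ e t = avg b ψ e a := by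
    simp only [avg_apply, Finset.mul_sum, Finset.sum_mul]
    refine Fintype.sum_equiv (Equiv.addLeft t) _ _ fun x => ?_
    rw [Equiv.coe_addLeft, he.map_add, he.tinv_add, smul_mul_assoc, smul_mul_smul_comm,
      ← AddChar.map_add_eq_mul, neg_add_cancel, AddChar.map_zero_eq_one, one_smul]
    simp only [mul_assoc]
  rw [← h, mul_assoc (_ * _), he.tinv_mul, mul_one, h]

theorem mul_mem_span (he : IsTwisted b ψ e) {a a' : A} (ha : a ∈ Submodule.span k (Set.range e))
    (ha' : a' ∈ Submodule.span k (Set.range e)) : a * a' ∈ Submodule.span k (Set.range e) := by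
  have h := Submodule.mul_mem_mul ha ha'
  rw [Submodule.span_mul_span] at h
  refine Submodule.span_le.2 ?_ h
  rintro _ ⟨_, ⟨x, rfl⟩, _, ⟨y, rfl⟩, rfl⟩
  simp only [he.map_mul]
  exact Submodule.smul_mem _ _ (Submodule.subset_span ⟨_, rfl⟩)

variable [Fintype V]

theorem weilOp_mem_span (he : IsTwisted b ψ e) (g : V ≃+ V) :
    weilOp b ψ e g ∈ Submodule.span k (Set.range e) := by
  refine Submodule.sum_mem _ fun x _ => ?_
  rw [he.map_mul_tinv]
  exact Submodule.smul_mem _ _ (Submodule.subset_span ⟨_, rfl⟩)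

/-- The substitution `x ↦ t + x` produces the factors `ψ (-b (g t) (g x))` and `ψ (b t x)`. They
cancel because `g` preserves `b` itself and not merely the commutator form. -/
theorem weilOp_mul_map (he : IsTwisted b ψ e) {g : V ≃+ V} (hg : ∀ x y, b (g x) (g y) = b x y)
    (t : V) : weilOp b ψ e g * e t = e (g t) * weilOp b ψ e g := by
  have h : e (g t) * weilOp b ψ e g * tinv b ψ e t = weilOp b ψ e g := by
    simp only [weilOp, Finset.mul_sum, Finset.sum_mul]
    refine Fintype.sum_equiv (Equiv.addLeft t) _ _ fun x => ?_
    rw [Equiv.coe_addLeft, _root_.map_add, he.map_add, he.tinv_add, smul_mul_smul_comm,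
      ← AddChar.map_add_eq_mul, hg, neg_add_cancel, AddChar.map_zero_eq_one, one_smul]
    simp only [mul_assoc]
  nth_rw 1 [← h]
  rw [mul_assoc (_ * _), he.tinv_mul, mul_one]

theorem weilOp_one (he : IsTwisted b ψ e) :
    weilOp b ψ e (AddEquiv.refl V) = (Nat.card V : k) • 1 := by
  simp [weilOp, he.mul_tinv, Nat.cast_smul_eq_nsmul]

/-- In the double sum of `e y * (e (g y))⁻¹ * e (g z) * (e z)⁻¹`, put `z = y + t`; the factors
involving `g y` cancel and what remains is a sum of conjugates by `e y`. Together with `avg_weilOp`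
this evaluates the product as a nonzero scalar. -/
theorem weilOp_inv_mul (he : IsTwisted b ψ e) {g : V ≃+ V}
    (hg : ∀ x y, b (g x) (g y) = b x y) :
    weilOp b ψ e g.symm * weilOp b ψ e g = avg b ψ e (weilOp b ψ e g) := by
  have h1 : weilOp b ψ e g.symm = ∑ y, e y * tinv b ψ e (g y) := by
    refine (Fintype.sum_equiv g.toEquiv _ _ fun y => ?_).symm
    simp
  rw [h1, avg_apply, Finset.sum_mul]
  refine Finset.sum_congr rfl fun y _ => ?_
  rw [weilOp, Finset.mul_sum, Finset.mul_sum, Finset.sum_mul]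
  refine (Fintype.sum_equiv (Equiv.addLeft y) _ _ fun t => ?_).symm
  rw [Equiv.coe_addLeft, _root_.map_add, he.map_add, he.tinv_add, smul_mul_smul_comm,
    ← AddChar.map_add_eq_mul, hg, neg_add_cancel, AddChar.map_zero_eq_one, one_smul]
  calc _ = e y * (e (g t) * tinv b ψ e t) * tinv b ψ e y := rfl
    _ = e y * 1 * (e (g t) * tinv b ψ e t * tinv b ψ e y) := by simp only [mul_assoc, one_mul]
    _ = _ := by rw [← he.tinv_mul (g y)]; simp only [mul_assoc]

variable [Fact p.Prime]

section

variable (he : IsTwisted b ψ e) (hψ : ψ ≠ 1) (hb : IsNondeg b)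
include he hψ hb

/-- Conjugation by `e x` multiplies `e y` by `ψ (comm b x y)`, and the sum over `x` vanishes unless
`y = 0`. So on the span of the `e y` the average reads off the coefficient at `0`. -/
theorem avg_map [DecidableEq V] (y : V) :
    avg b ψ e (e y) = if y = 0 then (Nat.card V : k) • 1 else 0 := by
  have hs : avg b ψ e (e y) = (∑ x, ψ (comm b x y)) • e y := by
    simp only [avg_apply, he.conj, Finset.sum_smul]
  rw [hs, sum_char_comm hψ hb]
  split_ifs with h
  · rw [h, he.map_zero]
  · rw [zero_smul]

/-- Right multiplication by `(e z)⁻¹` moves the coefficient at `z` to `0`, where `avg` detects it.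
-/
theorem linearIndependent [Nontrivial A] : LinearIndependent k e := by
  classical
  rw [Fintype.linearIndependent_iff]
  intro c hc z
  have h : avg b ψ e ((∑ y, c y • e y) * tinv b ψ e z) = (c z * Nat.card V) • 1 := by
    rw [Finset.sum_mul, _root_.map_sum, Finset.sum_eq_single z]
    · rw [smul_mul_assoc, map_smul, he.mul_tinv, ← he.map_zero, he.avg_map hψ hb, if_pos rfl,
        smul_smul, he.map_zero]
    · intro y _ hy
      rw [smul_mul_assoc, map_smul, he.map_mul_tinv, map_smul, he.avg_map hψ hb,
        if_neg (sub_ne_zero.2 hy), smul_zero, smul_zero]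
    · simp
  rw [hc, zero_mul, _root_.map_zero, eq_comm, smul_eq_zero, mul_eq_zero] at h
  exact (h.resolve_right one_ne_zero).resolve_right (natCast_card_ne_zero hψ hb)

/-- The Fourier expansion of an arbitrary element, with coefficients in the commutant. -/
theorem card_smul_eq (T : A) :
    (Nat.card V : k) • T = ∑ y, avg b ψ e (T * tinv b ψ e y) * e y := by
  classical
  have h : ∀ x y, e x * (T * tinv b ψ e y) * tinv b ψ e x * e y =
      ψ (comm b y x) • (e x * T * tinv b ψ e x) := by
    intro x y
    rw [mul_assoc _ (tinv b ψ e x), he.tinv_mul_map, mul_smul_comm, comm_swap b x y]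
    congr 1
    calc _ = e x * T * (tinv b ψ e y * e y) * tinv b ψ e x := by simp only [mul_assoc]
      _ = _ := by rw [he.tinv_mul, mul_one]
  simp only [avg_apply, Finset.sum_mul, h]
  -- With the sum over `y` inside, `∑ y, ψ (comm b y x)` leaves only the term `x = 0`, which is `T`.
  rw [Finset.sum_comm]
  simp only [← Finset.sum_smul, sum_char_comm hψ hb, ite_smul, zero_smul]
  simp [he.map_zero, tinv]

theorem exists_avg_eq {a : A} (ha : a ∈ Submodule.span k (Set.range e)) :
    ∃ c : k, avg b ψ e a = c • 1 := by
  classical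
  induction ha using Submodule.span_induction with
  | mem a h =>
    obtain ⟨y, rfl⟩ := h
    rw [he.avg_map hψ hb]
    split_ifs
    · exact ⟨_, rfl⟩
    · exact ⟨0, by rw [zero_smul]⟩
  | zero => exact ⟨0, by rw [_root_.map_zero, zero_smul]⟩
  | add a a' _ _ h h' =>
    obtain ⟨c, hc⟩ := h
    obtain ⟨c', hc'⟩ := h'
    exact ⟨c + c', by rw [_root_.map_add, hc, hc', add_smul]⟩
  | smul r a _ h =>
    obtain ⟨c, hc⟩ := h
    exact ⟨r * c, by rw [map_smul, hc, smul_smul]⟩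

end

section

variable (he : IsTwisted b ψ e) (hψ : ψ ≠ 1) (hb : IsNondeg b)
include he hψ hb

theorem avg_weilOp (g : V ≃+ V) :
    avg b ψ e (weilOp b ψ e g) = ((Nat.card V * fixCard g : ℕ) : k) • 1 := by
  classical
  have h : ∀ x, avg b ψ e (e (g x) * tinv b ψ e x) =
      if g x = x then (Nat.card V : k) • (1 : A) else 0 := by
    intro x
    split_ifs with hx
    · rw [hx, he.mul_tinv, ← he.map_zero, he.avg_map hψ hb, if_pos rfl, he.map_zero]
    · rw [he.map_mul_tinv, map_smul, he.avg_map hψ hb, if_neg (sub_ne_zero.2 hx), smul_zero]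
  rw [weilOp, _root_.map_sum, Finset.sum_congr rfl fun x _ => h x, ← Finset.sum_filter,
    Finset.sum_const, fixCard, Nat.card_eq_fintype_card (α := {x // g x = x}),
    Fintype.card_subtype, ← Nat.cast_smul_eq_nsmul k, smul_smul, mul_comm, Nat.cast_mul]

/-- The term at `(x, y)` is a multiple of `e` at `(g - 1) x + (h - 1) y`. Averaging keeps the pairs
for which this vanishes, and the accumulated exponents of `ψ` make up `cocycleForm`. -/
theorem avg_weilOp_mul_weilOp (g h : V ≃+ V) :
    avg b ψ e (weilOp b ψ e g * weilOp b ψ e h) =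
      ((Nat.card V : k) * cocycleSum b ψ g h) • 1 := by
  classical
  have h1 : ∀ v : V × V, avg b ψ e ((e (g v.1) * tinv b ψ e v.1) * (e (h v.2) * tinv b ψ e v.2)) =
      if v ∈ cocycleSet g h then ((Nat.card V : k) * ψ (cocycleForm b g h v)) • (1 : A) else 0 := by
    intro v
    rw [he.map_mul_tinv, he.map_mul_tinv, smul_mul_smul_comm, he.map_mul, map_smul, map_smul,
      he.avg_map hψ hb, ← AddChar.map_add_eq_mul, smul_smul, ← AddChar.map_add_eq_mul]
    simp only [← mem_cocycleSet]
    split_ifs with hv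
    · rw [smul_smul, mul_comm]
      congr 3
      rw [cocycleForm]
      abel
    · rw [smul_zero]
  rw [weilOp, weilOp, Finset.sum_mul_sum, ← Fintype.sum_prod_type' (fun x y : V =>
      (e (g x) * tinv b ψ e x) * (e (h y) * tinv b ψ e y)), _root_.map_sum,
    Finset.sum_congr rfl fun v _ => h1 v, ← Finset.sum_filter, ← Finset.sum_smul,
    ← Finset.mul_sum, cocycleSum, finsum_eq_sum_of_fintype]
  congr 2
  exact (Finset.sum_subtype _ (by simp) _)

/-- The product `X g * X h * X (g h)⁻¹`, with the last factor the operator of the inverse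
automorphism, commutes with all `e x` and lies in their span, so it equals its average up to the
factor `|V|` and is therefore a scalar; no irreducibility is needed. This makes `X g * X h`
proportional to `X (g h)`, and averaging both sides identifies the constant. -/
theorem weilOp_mul_weilOp [Nontrivial A] {g h : V ≃+ V} (hg : ∀ x y, b (g x) (g y) = b x y)
    (hh : ∀ x y, b (h x) (h y) = b x y) :
    weilOp b ψ e g * weilOp b ψ e h =
      (cocycleSum b ψ g h / fixCard (h.trans g)) • weilOp b ψ e (h.trans g) := by
  have hgh : ∀ x y, b ((h.trans g) x) ((h.trans g) y) = b x y := fun x y => by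
    rw [AddEquiv.trans_apply, AddEquiv.trans_apply, hg, hh]
  have hgh' : ∀ x y, b ((h.trans g).symm x) ((h.trans g).symm y) = b x y := fun x y => by
    rw [← hgh, AddEquiv.apply_symm_apply, AddEquiv.apply_symm_apply]
  have hV := natCast_card_ne_zero (k := k) hψ hb
  have hF := natCast_fixCard_ne_zero (k := k) hψ hb (h.trans g)
  set a := weilOp b ψ e g * weilOp b ψ e h * weilOp b ψ e (h.trans g).symm with ha
  have hcomm : ∀ x, e x * a = a * e x := by
    intro x
    rw [ha, mul_assoc _ _ (e x), he.weilOp_mul_map hgh', ← mul_assoc (_ * _) (e _),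
      mul_assoc _ _ (e _),
      he.weilOp_mul_map hh, ← mul_assoc _ (e _), he.weilOp_mul_map hg, ← AddEquiv.trans_apply h g,
      AddEquiv.apply_symm_apply]
    simp only [mul_assoc]
  obtain ⟨c, hc⟩ := he.exists_avg_eq hψ hb (he.mul_mem_span (he.mul_mem_span
    (he.weilOp_mem_span g) (he.weilOp_mem_span h)) (he.weilOp_mem_span (h.trans g).symm))
  rw [he.avg_of_commute hcomm] at hc
  have h1 : ∃ γ : k, weilOp b ψ e g * weilOp b ψ e h = γ • weilOp b ψ e (h.trans g) := by
    have h2 : a * weilOp b ψ e (h.trans g) = ((Nat.card V * fixCard (h.trans g) : ℕ) : k) •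
        (weilOp b ψ e g * weilOp b ψ e h) := by
      rw [ha, mul_assoc, he.weilOp_inv_mul hgh, he.avg_weilOp hψ hb, mul_smul_comm, mul_one]
    have hne : (((Nat.card V * fixCard (h.trans g) : ℕ)) : k) ≠ 0 := by
      rw [Nat.cast_mul]
      exact mul_ne_zero hV hF
    refine ⟨(((Nat.card V * fixCard (h.trans g) : ℕ)) : k)⁻¹ * ((Nat.card V : k)⁻¹ * c), ?_⟩
    have h3 : a = ((Nat.card V : k)⁻¹ * c) • 1 := by
      rw [mul_smul, ← hc, smul_smul, inv_mul_cancel₀ hV, one_smul]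
    rw [h3, smul_mul_assoc, one_mul] at h2
    rw [mul_smul, h2, smul_smul, inv_mul_cancel₀ hne, one_smul]
  obtain ⟨γ, hγ⟩ := h1
  have h2 := congrArg (avg b ψ e) hγ
  rw [he.avg_weilOp_mul_weilOp hψ hb, map_smul, he.avg_weilOp hψ hb, smul_smul, ← sub_eq_zero,
    ← sub_smul, smul_eq_zero] at h2
  have h3 := sub_eq_zero.1 (h2.resolve_right one_ne_zero)
  rw [hγ]
  congr 1
  rw [eq_div_iff hF]
  apply mul_left_cancel₀ hV
  rw [h3]
  push_cast
  ring

/-- This replaces the absolute value of a Gauss sum over a field without complex conjugation: the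
product of the four operators of `h⁻¹`, `g⁻¹`, `g`, `h` is computed in two ways, by pairing the
outer two products and by cancelling from the inside. -/
theorem cocycleSum_mul_cocycleSum_inv [Nontrivial A] {g h : V ≃+ V}
    (hg : ∀ x y, b (g x) (g y) = b x y) (hh : ∀ x y, b (h x) (h y) = b x y) :
    cocycleSum b ψ g h * cocycleSum b ψ h.symm g.symm =
      (Nat.card V * fixCard g * fixCard h * fixCard (h.trans g) : ℕ) := by
  have hsymm : ∀ {f : V ≃+ V}, (∀ x y, b (f x) (f y) = b x y) →
      ∀ x y, b (f.symm x) (f.symm y) = b x y := fun {f} hf x y => by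
    rw [← hf, AddEquiv.apply_symm_apply, AddEquiv.apply_symm_apply]
  have hgh : ∀ x y, b ((h.trans g) x) ((h.trans g) y) = b x y := fun x y => by
    rw [AddEquiv.trans_apply, AddEquiv.trans_apply, hg, hh]
  have hV := natCast_card_ne_zero (k := k) hψ hb
  have hF := natCast_fixCard_ne_zero (k := k) hψ hb (h.trans g)
  have h1 := he.weilOp_mul_weilOp hψ hb hg hh
  have h2 := he.weilOp_mul_weilOp hψ hb (hsymm hh) (hsymm hg)
  have e3 : g.symm.trans h.symm = (h.trans g).symm := rfl
  rw [e3, fixCard_symm] at h2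
  have h3 : (weilOp b ψ e h.symm * weilOp b ψ e g.symm) *
      (weilOp b ψ e g * weilOp b ψ e h) = (((Nat.card V * fixCard g : ℕ) : k) *
        ((Nat.card V * fixCard h : ℕ) : k)) • 1 := by
    rw [mul_assoc, ← mul_assoc (weilOp b ψ e g.symm), he.weilOp_inv_mul hg, he.avg_weilOp hψ hb,
      smul_mul_assoc, one_mul, mul_smul_comm, he.weilOp_inv_mul hh, he.avg_weilOp hψ hb, smul_smul]
  rw [h1, h2, smul_mul_smul_comm, he.weilOp_inv_mul hgh, he.avg_weilOp hψ hb, smul_smul,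
    ← sub_eq_zero, ← sub_smul, smul_eq_zero] at h3
  have h4 := sub_eq_zero.1 (h3.resolve_right one_ne_zero)
  push_cast at h4 ⊢
  field_simp at h4
  linear_combination h4

end

end IsTwisted

end Twisted

/-! ### Absolutely irreducible representations of `E(b)` -/

section Schur

variable {k : Type u} [Field k] {Γ : Type v} [Group Γ] {W : Type w} [AddCommGroup W] [Module k W]

theorem nontrivial_of_absIrr {ρ : Representation k Γ W}
    (h : (scalarExt (AlgebraicClosure k) ρ).IsIrreducible) : Nontrivial W := by
  by_contra hW
  rw [not_nontrivial_iff_subsingleton] at hW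
  have : Subsingleton (AlgebraicClosure k ⊗[k] W) :=
    ⟨fun x y => by
      have h0 : ∀ z : AlgebraicClosure k ⊗[k] W, z = 0 := fun z => by
        induction z with
        | zero => rfl
        | tmul a w => rw [Subsingleton.elim w 0, TensorProduct.tmul_zero]
        | add a a' h h' => rw [h, h', add_zero]
      rw [h0 x, h0 y]⟩
  obtain ⟨U, U', hU⟩ := h.exists_pair_ne
  exact hU (Subrepresentation.toSubmodule_injective (Subsingleton.elim _ _))

/-- Schur's lemma for absolutely irreducible representations. -/
theorem exists_smul_of_commute [FiniteDimensional k W] {ρ : Representation k Γ W}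
    (h : (scalarExt (AlgebraicClosure k) ρ).IsIrreducible) {T : Module.End k W}
    (hT : ∀ a, T * ρ a = ρ a * T) : ∃ c : k, T = c • 1 := by
  have hW := nontrivial_of_absIrr h
  let L := AlgebraicClosure k
  let f : Representation.IntertwiningMap (scalarExt L ρ) (scalarExt L ρ) :=
    { T.baseChange L with
      isIntertwining' := fun a => by
        change T.baseChange L ∘ₗ (ρ a).baseChange L = (ρ a).baseChange L ∘ₗ T.baseChange L
        rw [← LinearMap.baseChange_comp, ← LinearMap.baseChange_comp]
        exact congrArg _ (hT a) }
  obtain ⟨μ, hμ⟩ :=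
    (Representation.IsIrreducible.algebraMap_intertwiningMap_bijective_of_isAlgClosed
    (ρ := scalarExt L ρ)).2 f
  have hμ' : ∀ w : W, (1 : L) ⊗ₜ[k] T w = μ ⊗ₜ[k] w := by
    intro w
    have := congrArg (fun F : Representation.IntertwiningMap (scalarExt L ρ) (scalarExt L ρ) =>
      F.toLinearMap ((1 : L) ⊗ₜ[k] w)) hμ
    have h2 : f.toLinearMap ((1 : L) ⊗ₜ[k] w) = (1 : L) ⊗ₜ[k] T w := rfl
    rw [h2] at this
    rw [← this]
    change μ • ((1 : L) ⊗ₜ[k] w) = _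
    rw [TensorProduct.smul_tmul', smul_eq_mul, mul_one]
  -- Over the algebraic closure `T` is the scalar `μ`. Functionals defined over `k` bring it back:
  -- if `φ w = 1`, then `μ` is the image of `φ (T w)`.
  have key : ∀ (φ : Module.Dual k W) (w : W),
      algebraMap k L (φ (T w)) = algebraMap k L (φ w) * μ := by
    intro φ w
    have := congrArg (Module.Dual.baseChange L φ) (hμ' w)
    simpa [Algebra.smul_def] using this
  obtain ⟨w, hw⟩ := exists_ne (0 : W)
  obtain ⟨φ, hφ⟩ := Module.Projective.exists_dual_eq_one k hw
  refine ⟨φ (T w), LinearMap.ext fun x => ?_⟩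
  have hμc : μ = algebraMap k L (φ (T w)) := by
    rw [key, hφ, map_one, one_mul]
  rw [← sub_eq_zero, ← Module.forall_dual_apply_eq_zero_iff k]
  intro χ
  apply (algebraMap k L).injective
  rw [map_sub, map_sub, key, hμc, LinearMap.smul_apply, map_smul, smul_eq_mul, map_mul,
    Module.End.one_apply, map_zero, mul_comm, sub_self]

/-- A subrepresentation of the scalar extension is stable under the base change of every
endomorphism of `W`. The rank-one endomorphisms built from a basis carry a vector with nonzero
`j`-th coordinate to a nonzero multiple of each basis vector. -/
theorem absIrr_of_span [FiniteDimensional k W] [Nontrivial W] {ρ : Representation k Γ W}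
    (h : Submodule.span k (Set.range ρ) = ⊤) :
    (scalarExt (AlgebraicClosure k) ρ).IsIrreducible := by
  let L := AlgebraicClosure k
  let B := Module.finBasis k W
  let B' := B.baseChange L
  have : Nonempty (Fin (Module.finrank k W)) := ⟨⟨0, Module.finrank_pos⟩⟩
  have hne : (⊥ : Subrepresentation (scalarExt L ρ)) ≠ ⊤ := by
    intro h0
    have h1 : B' (Classical.arbitrary _) ∈ (⊤ : Subrepresentation (scalarExt L ρ)) := trivial
    rw [← h0] at h1
    exact B'.ne_zero _ ((Submodule.mem_bot L).1 h1)
  have hU : ∀ (U : Subrepresentation (scalarExt L ρ)) (T : Module.End k W) (x : L ⊗[k] W),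
      x ∈ U.toSubmodule → T.baseChange L x ∈ U.toSubmodule := by
    intro U T x hx
    have hT : T ∈ Submodule.span k (Set.range ρ) := h ▸ trivial
    induction hT using Submodule.span_induction with
    | mem T hT =>
      obtain ⟨a, rfl⟩ := hT
      exact U.apply_mem_toSubmodule a hx
    | zero => simp
    | add T T' _ _ h h' =>
      rw [LinearMap.baseChange_add]
      exact U.toSubmodule.add_mem h h'
    | smul c T _ h =>
      rw [LinearMap.baseChange_smul]
      exact U.toSubmodule.smul_of_tower_mem c h
  refine { exists_pair_ne := ⟨⊥, ⊤, hne⟩, eq_bot_or_eq_top := fun U => ?_ }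
  by_cases hbot : U.toSubmodule = ⊥
  · left
    exact Subrepresentation.toSubmodule_injective hbot
  right
  obtain ⟨x, hxU, hx⟩ := (Submodule.ne_bot_iff _).1 hbot
  obtain ⟨j, hj⟩ : ∃ j, B'.repr x j ≠ 0 := by
    by_contra! h0
    exact hx (B'.repr.map_eq_zero_iff.1 (Finsupp.ext h0))
  apply Subrepresentation.toSubmodule_injective
  change U.toSubmodule = ⊤
  rw [eq_top_iff, ← B'.span_eq, Submodule.span_le]
  rintro _ ⟨i, rfl⟩
  have h1 := hU U ((B.coord j).smulRight (B i)) x hxU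
  have h2 : ((B.coord j).smulRight (B i)).baseChange L x = B'.repr x j • B' i := by
    clear hx hj hxU h1
    induction x with
    | zero => simp
    | tmul a w =>
      simp only [B', LinearMap.baseChange_tmul, LinearMap.smulRight_apply, Module.Basis.coord_apply,
        TensorProduct.tmul_smul, Module.Basis.baseChange_apply, Module.Basis.baseChange_repr_tmul,
        TensorProduct.smul_tmul', smul_eq_mul, mul_one]
    | add y z h h' => rw [map_add, h, h', map_add, Finsupp.add_apply, add_smul]
  rw [h2] at h1
  have h3 := U.toSubmodule.smul_mem (B'.repr x j)⁻¹ h1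
  rwa [smul_smul, inv_mul_cancel₀ hj, one_smul] at h3

end Schur

section Weil

variable {p : ℕ} [Fact p.Prime] {V : Type*} [AddCommGroup V] {b : V →+ V →+ ZMod p}
  {k : Type u} [Field k] {W : Type w} [AddCommGroup W] [Module k W]

/-- The operators of a representation of `E(b)` that belong to the elements `(x, 0)`. -/
def ops (ρ : Representation k (EGroup b) W) (x : V) : Module.End k W := ρ ⟨x, 0⟩

/-- A representation of `E(b)` in which the centre acts by the nontrivial character `ψ`, and whose
operators span the full endomorphism algebra. -/
structure IsWeil (ψ : AddChar (ZMod p) k) (ρ : Representation k (EGroup b) W) : Prop where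
  nontrivial : Nontrivial W
  ne_one : ψ ≠ 1
  apply_eq : ∀ s, ρ s = ψ s.z • ops ρ s.x
  span : Submodule.span k (Set.range (ops ρ)) = ⊤

theorem isTwisted_ops {ψ : AddChar (ZMod p) k} {ρ : Representation k (EGroup b) W}
    (h : ∀ s, ρ s = ψ s.z • ops ρ s.x) : IsTwisted b ψ (ops ρ) where
  map_zero := ρ.map_one
  map_mul x y := by
    rw [ops, ops, ← map_mul, h]
    simp

theorem tinv_ops {ψ : AddChar (ZMod p) k} {ρ : Representation k (EGroup b) W}
    (h : ∀ s, ρ s = ψ s.z • ops ρ s.x) (x : V) : tinv b ψ (ops ρ) x = ρ (⟨x, 0⟩⁻¹) := by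
  rw [h]
  simp [tinv]

theorem IsWeil.isTwisted {ψ : AddChar (ZMod p) k} {ρ : Representation k (EGroup b) W}
    (h : IsWeil ψ ρ) : IsTwisted b ψ (ops ρ) := isTwisted_ops h.apply_eq

/-- The coefficients in the expansion `card_smul_eq` lie in the commutant, so by hypothesis they are
scalars, and `|V|` can be divided out. -/
theorem isWeil_of_schur [Finite V] [Nontrivial W] {ψ : AddChar (ZMod p) k}
    {ρ : Representation k (EGroup b) W} (hb : IsNondeg b) (hψ : ψ ≠ 1)
    (h : ∀ s, ρ s = ψ s.z • ops ρ s.x)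
    (hs : ∀ T : Module.End k W, (∀ s, T * ρ s = ρ s * T) → ∃ c : k, T = c • 1) : IsWeil ψ ρ where
  nontrivial := inferInstance
  ne_one := hψ
  apply_eq := h
  span := by
    have := Fintype.ofFinite V
    have he := isTwisted_ops h
    rw [eq_top_iff]
    intro T _
    have h1 := he.card_smul_eq hψ hb T
    have h2 : (Nat.card V : k) • T ∈ Submodule.span k (Set.range (ops ρ)) := by
      rw [h1]
      refine Submodule.sum_mem _ fun y _ => ?_
      obtain ⟨c, hc⟩ := hs (avg b ψ (ops ρ) (T * tinv b ψ (ops ρ) y)) fun s => by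
        rw [h, mul_smul_comm, smul_mul_assoc, he.avg_commute]
      rw [hc, smul_mul_assoc, one_mul]
      exact Submodule.smul_mem _ _ (Submodule.subset_span ⟨y, rfl⟩)
    have h3 := Submodule.smul_mem _ (Nat.card V : k)⁻¹ h2
    rwa [smul_smul, inv_mul_cancel₀ (natCast_card_ne_zero hψ hb), one_smul] at h3

/-- By Schur's lemma the central elements act by scalars, which form the character `ψ`; faithfulness
makes it nontrivial. -/
theorem exists_isWeil [Finite V] [FiniteDimensional k W] {ρ : Representation k (EGroup b) W}
    (hb : IsNondeg b) (h : IsFaithfulAbsIrr ρ) : ∃ ψ : AddChar (ZMod p) k, IsWeil ψ ρ := by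
  have hW := nontrivial_of_absIrr h.2
  have hz : ∀ z : ZMod p, ∃ c : k, ρ ⟨0, z⟩ = c • 1 := fun z => by
    refine exists_smul_of_commute h.2 fun s => ?_
    rw [← map_mul, ← map_mul, (EGroup.commute_iff _ _).2]
    simp
  choose c hc using hz
  have hinj : ∀ {a a' : k}, a • (1 : Module.End k W) = a' • 1 → a = a' := fun {a a'} h0 =>
    smul_left_injective k one_ne_zero h0
  let ψ : AddChar (ZMod p) k :=
    { toFun := c
      map_zero_eq_one' := hinj (by rw [← hc, one_smul]; exact ρ.map_one)
      map_add_eq_mul' := fun z z' => hinj (by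
        have : (⟨0, z + z'⟩ : EGroup b) = ⟨0, z⟩ * ⟨0, z'⟩ := by ext <;> simp
        rw [← hc, this, map_mul, hc, hc, smul_mul_smul_comm, one_mul]) }
  have hψ : ψ ≠ 1 := by
    intro h0
    have h1 : ρ ⟨0, 1⟩ = ρ 1 := by
      rw [hc, map_one]
      have : c 1 = 1 := DFunLike.congr_fun h0 1
      rw [this, one_smul]
    have := congrArg EGroup.z (h.1 h1)
    exact one_ne_zero this
  refine ⟨ψ, isWeil_of_schur hb hψ (fun s => ?_) fun T hT => exists_smul_of_commute h.2 hT⟩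
  have : s = ⟨0, s.z⟩ * ⟨s.x, 0⟩ := by ext <;> simp
  conv_lhs => rw [this]
  rw [map_mul, hc, smul_mul_assoc, one_mul]
  rfl

namespace IsWeil

variable {ψ : AddChar (ZMod p) k} {ρ : Representation k (EGroup b) W}

theorem linearIndependent [Finite V] (h : IsWeil ψ ρ) (hb : IsNondeg b) :
    LinearIndependent k (ops ρ) := by
  have := Fintype.ofFinite V
  have := h.nontrivial
  exact h.isTwisted.linearIndependent h.ne_one hb

theorem finrank_sq [Finite V] [FiniteDimensional k W] (h : IsWeil ψ ρ) (hb : IsNondeg b) :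
    Module.finrank k W ^ 2 = Nat.card V := by
  have := Fintype.ofFinite V
  have B := Module.Basis.mk (h.linearIndependent hb) h.span.ge
  rw [Nat.card_eq_fintype_card, ← Module.finrank_eq_card_basis B, Module.finrank_linearMap, sq]

theorem span_range (h : IsWeil ψ ρ) : Submodule.span k (Set.range ρ) = ⊤ := by
  rw [eq_top_iff, ← h.span]
  apply Submodule.span_mono
  rintro _ ⟨x, rfl⟩
  exact ⟨_, rfl⟩

/-- Schur's lemma. -/
theorem exists_smul [FiniteDimensional k W] (h : IsWeil ψ ρ) {T : Module.End k W}
    (hT : ∀ x, T * ops ρ x = ops ρ x * T) : ∃ c : k, T = c • 1 := by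
  have := h.nontrivial
  refine exists_smul_of_commute (absIrr_of_span h.span_range) fun s => ?_
  rw [h.apply_eq, mul_smul_comm, smul_mul_assoc, hT]

/-- If `s` acts trivially, so do its commutators with all `(y, 0)`. These act by `ψ (comm b s.x y)`,
so `s.x = 0` by nondegeneracy, and then `ψ s.z = 1`. -/
theorem injective (h : IsWeil ψ ρ) (hb : IsNondeg b) : Function.Injective ρ := by
  have := h.nontrivial
  rw [injective_iff_map_eq_one]
  intro s hs
  have hx : s.x = 0 := hb _ fun y => by
    have h1 : ρ ⁅s, ⟨y, 0⟩⁆ = 1 := by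
      have h2 : ρ s⁻¹ = 1 := by
        rw [← one_mul (ρ s⁻¹), ← hs, ← map_mul, mul_inv_cancel, map_one, hs]
      rw [commutatorElement_def, map_mul, map_mul, map_mul, hs, h2, one_mul, mul_one, ← map_mul,
        mul_inv_cancel, map_one]
    rw [EGroup.commutatorElement_eq, h.apply_eq, h.isTwisted.map_zero] at h1
    exact (char_eq_one_iff h.ne_one).1 (smul_left_injective k
      (one_ne_zero (α := Module.End k W)) (by simpa using h1))
  rw [h.apply_eq] at hs
  rw [hx, h.isTwisted.map_zero] at hs
  have hz : ψ s.z = 1 := smul_left_injective k (one_ne_zero (α := Module.End k W)) (by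
    simpa using hs)
  exact EGroup.ext hx ((char_eq_one_iff h.ne_one).1 hz)

theorem isFaithfulAbsIrr [Finite V] [FiniteDimensional k W] (h : IsWeil ψ ρ) (hb : IsNondeg b) :
    IsFaithfulAbsIrr ρ :=
  have := h.nontrivial
  ⟨h.injective hb, absIrr_of_span h.span_range⟩

end IsWeil

end Weil

/-! ### Existence of irreducible representations over finite fields -/

section Regular

variable {p : ℕ} {V : Type*} [AddCommGroup V] (b : V →+ V →+ ZMod p)
  {k : Type*} [Field k] (ψ : AddChar (ZMod p) k)

/-- The twisted regular representation: `(e x φ)(v) = ψ(b(v, x)) φ(v + x)`. -/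
def regularOp (x : V) : Module.End k (V → k) where
  toFun φ v := ψ (b v x) * φ (v + x)
  map_add' φ χ := by ext v; simp [mul_add]
  map_smul' c φ := by ext v; simp [mul_left_comm]

theorem isTwisted_regularOp : IsTwisted b ψ (regularOp b ψ) where
  map_zero := by
    ext φ v
    simp [regularOp]
  map_mul x y := by
    refine LinearMap.ext fun φ => funext fun v => ?_
    simp only [regularOp, Module.End.mul_apply, LinearMap.coe_mk, AddHom.coe_mk, map_add,
      AddMonoidHom.add_apply, AddChar.map_add_eq_mul, LinearMap.smul_apply, Pi.smul_apply,
      smul_eq_mul, add_assoc]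
    ring

variable {b ψ} {W : Type*} [AddCommGroup W] [Module k W]

/-- The representation of `E(b)` given by a twisted system. -/
def IsTwisted.toRep {e : V → Module.End k W} (he : IsTwisted b ψ e) :
    Representation k (EGroup b) W where
  toFun s := ψ s.z • e s.x
  map_one' := by simp [he.map_zero]
  map_mul' s t := by
    rw [smul_mul_smul_comm, he.map_mul, smul_smul, ← AddChar.map_add_eq_mul,
      ← AddChar.map_add_eq_mul]
    rfl

theorem IsTwisted.ops_toRep [Fact p.Prime] {e : V → Module.End k W} (he : IsTwisted b ψ e) :
    ops he.toRep = e := by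
  funext x
  simp [ops, IsTwisted.toRep]

end Regular

section Existence

variable {p : ℕ} [Fact p.Prime] {V : Type*} [AddCommGroup V] [Finite V] {b : V →+ V →+ ZMod p}
  {k : Type u} [Field k] {ψ : AddChar (ZMod p) k}

/-- Over a finite field irreducibility already suffices. The commutant `C` of the `e x` has no zero
divisors, so, being finite, it is a field by Wedderburn's theorem and in particular commutative. By
`card_smul_eq` every endomorphism is a combination of the `e x` with coefficients in `C`. An element
of `C` commutes with all of these, so it is central in `End W` and hence a scalar. -/
theorem exists_smul_of_irreducible [Finite k] (hb : IsNondeg b) (hψ : ψ ≠ 1) {W : Type*}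
    [AddCommGroup W] [Module k W] [FiniteDimensional k W] [Nontrivial W]
    {e : V → Module.End k W} (he : IsTwisted b ψ e)
    (hirr : ∀ U : Submodule k W, (∀ x, ∀ w ∈ U, e x w ∈ U) → U ≠ ⊤ → U = ⊥)
    {T : Module.End k W} (hT : ∀ x, T * e x = e x * T) : ∃ c : k, T = c • 1 := by
  have := Fintype.ofFinite V
  let C : Subalgebra k (Module.End k W) := Subalgebra.centralizer k (Set.range e)
  have hC : ∀ {S : Module.End k W}, S ∈ C ↔ ∀ x, e x * S = S * e x := fun {S} => by
    rw [Subalgebra.mem_centralizer_iff]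
    simp
  have hinj : ∀ S ∈ C, S ≠ 0 → Function.Injective S := by
    intro S hS hS0
    rw [← LinearMap.ker_eq_bot]
    refine hirr _ (fun x w hw => ?_) fun htop => hS0 (LinearMap.ker_eq_top.1 htop)
    have h1 := congrArg (fun F => F w) (hC.1 hS x)
    simp only [Module.End.mul_apply] at h1
    rw [LinearMap.mem_ker] at hw ⊢
    rw [← h1, hw, map_zero]
  have : Finite W := Module.finite_of_finite k
  have : Finite (Module.End k W) := Module.finite_of_finite k
  have : NoZeroDivisors C := ⟨fun {S S'} h => by
    by_contra! h0
    have h1 := hinj S S.2 fun h => h0.1 (Subtype.ext h)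
    refine h0.2 (Subtype.ext (LinearMap.ext fun w => h1 ?_))
    have h2 := congrArg (fun F : C => F.1 w) h
    simpa using h2⟩
  have : IsDomain C := NoZeroDivisors.to_isDomain C
  have hcomm := (Finite.isDomain_to_isField C).mul_comm
  have hTC : T ∈ C := hC.2 fun x => (hT x).symm
  have hcenter : T ∈ Subalgebra.center k (Module.End k W) := by
    rw [Subalgebra.mem_center_iff]
    intro S
    have h1 := he.card_smul_eq hψ hb S
    have h2 : ((Nat.card V : k) • S) * T = T * ((Nat.card V : k) • S) := by
      rw [h1, Finset.sum_mul, Finset.mul_sum]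
      refine Finset.sum_congr rfl fun y _ => ?_
      have h3 : avg b ψ e (S * tinv b ψ e y) ∈ C := hC.2 fun x => he.avg_commute _ x
      have h4 := congrArg Subtype.val (hcomm ⟨T, hTC⟩ ⟨_, h3⟩)
      simp only [MulMemClass.mk_mul_mk] at h4
      rw [mul_assoc, ← hT, ← mul_assoc, ← h4, mul_assoc]
    rw [smul_mul_assoc, mul_smul_comm] at h2
    exact smul_right_injective _ (natCast_card_ne_zero hψ hb) h2
  obtain ⟨c, hc⟩ := Algebra.mem_bot.1 (Algebra.IsCentral.out hcenter)
  exact ⟨c, by rw [← hc, Algebra.algebraMap_eq_smul_one]⟩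

/-- The representation is a minimal nonzero invariant subspace of the twisted regular
representation. -/
theorem exists_representation {V : Type u} [AddCommGroup V] [Finite V] {b : V →+ V →+ ZMod p}
    [Finite k] (hb : IsNondeg b) (hψ : ψ ≠ 1) :
    ∃ (W : Type u) (_ : AddCommGroup W) (_ : Module k W) (_ : FiniteDimensional k W)
      (ρ : Representation k (EGroup b) W), IsWeil ψ ρ := by
  let e := regularOp b ψ
  have he : IsTwisted b ψ e := isTwisted_regularOp b ψ
  let S : Set (Submodule k (V → k)) := {U | U ≠ ⊥ ∧ ∀ x, ∀ w ∈ U, e x w ∈ U}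
  have hS : S.Nonempty := ⟨⊤, top_ne_bot, fun _ _ _ => trivial⟩
  obtain ⟨U, ⟨hU0, hUe⟩, hmin⟩ :=
    WellFounded.has_min (wellFounded_lt (α := Submodule k (V → k))) S hS
  let e' : V → Module.End k U := fun x => (e x).restrict (hUe x)
  have he' : IsTwisted b ψ e' :=
    { map_zero := by
        ext1 w
        apply Subtype.ext
        simp [e', he.map_zero]
      map_mul := fun x y => by
        ext1 w
        apply Subtype.ext
        have := congrArg (fun F => F w.1) (he.map_mul x y)
        simpa [e'] using this }
  have : Nontrivial U := Submodule.nontrivial_iff_ne_bot.2 hU0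
  have hops := he'.ops_toRep
  refine ⟨U, inferInstance, inferInstance, inferInstance, he'.toRep,
    isWeil_of_schur hb hψ (fun s => by rw [hops]; rfl) fun T hT => ?_⟩
  refine exists_smul_of_irreducible hb hψ he' (fun U' hU' hne => ?_) (T := T) fun x => ?_
  · by_contra h0
    refine hmin (U'.map U.subtype) ⟨fun h => h0 ?_, ?_⟩ ?_
    · exact Submodule.map_injective_of_injective U.subtype_injective (by rw [h, Submodule.map_bot])
    · rintro x _ ⟨w, hw, rfl⟩
      exact ⟨e' x w, hU' x w hw, rfl⟩
    · refine lt_of_le_of_ne (Submodule.map_subtype_le U U') fun h => hne ?_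
      rw [eq_top_iff]
      intro w _
      obtain ⟨w', hw', h'⟩ := h.ge w.2
      rwa [← Subtype.ext h']
  · have := hT ⟨x, 0⟩
    simpa [IsTwisted.toRep] using this

end Existence

/-! ### Invariant forms -/

section Forms

variable {p : ℕ} [Fact p.Prime] {V : Type*} [AddCommGroup V] {b : V →+ V →+ ZMod p}
  {k : Type u} [Field k] {W : Type w} [AddCommGroup W] [Module k W]
  {ψ : AddChar (ZMod p) k} {ρ : Representation k (EGroup b) W} {θ : k →+* k}

theorem Preserves.apply_left {Γ : Type*} [Group Γ] {ρ : Representation k Γ W}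
    {B : W →ₗ[k] W →ₛₗ[θ] k} (hB : Preserves ρ B)
    (s : Γ) (u v : W) : B (ρ s u) v = B u (ρ s⁻¹ v) := by
  rw [← hB s⁻¹ (ρ s u) v, ← Module.End.mul_apply, ← map_mul, inv_mul_cancel, map_one,
    Module.End.one_apply]

theorem Preserves.apply_right {Γ : Type*} [Group Γ] {ρ : Representation k Γ W}
    {B : W →ₗ[k] W →ₛₗ[θ] k} (hB : Preserves ρ B)
    (s : Γ) (u v : W) : B u (ρ s v) = B (ρ s⁻¹ u) v := by
  rw [hB.apply_left, inv_inv]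

/-- A nonzero form preserved by an irreducible representation is nondegenerate. -/
theorem IsWeil.separatingLeft (h : IsWeil ψ ρ) {B : W →ₗ[k] W →ₛₗ[θ] k} (hB : Preserves ρ B)
    (h0 : B ≠ 0) : B.SeparatingLeft := by
  intro u hu
  by_contra hu0
  apply h0
  have h1 : ∀ T : Module.End k W, ∀ v, B (T u) v = 0 := by
    intro T v
    have hT : T ∈ Submodule.span k (Set.range (ops ρ)) := h.span ▸ trivial
    induction hT using Submodule.span_induction with
    | mem T hT =>
      obtain ⟨x, rfl⟩ := hT
      rw [ops, hB.apply_left, hu]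
    | zero => simp
    | add T T' _ _ h h' => rw [LinearMap.add_apply, map_add, LinearMap.add_apply, h, h', add_zero]
    | smul c T _ h => rw [LinearMap.smul_apply, map_smul, LinearMap.smul_apply, h, smul_zero]
  obtain ⟨φ, hφ⟩ := Module.Projective.exists_dual_eq_one k hu0
  ext w v
  have := h1 (φ.smulRight w) v
  rwa [LinearMap.smulRight_apply, hφ, one_smul] at this

theorem IsWeil.separatingRight (h : IsWeil ψ ρ) {B : W →ₗ[k] W →ₛₗ[θ] k} (hB : Preserves ρ B)
    (h0 : B ≠ 0) : B.SeparatingRight := by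
  intro v hv
  by_contra hv0
  apply h0
  have h1 : ∀ T : Module.End k W, ∀ u, B u (T v) = 0 := by
    intro T u
    have hT : T ∈ Submodule.span k (Set.range (ops ρ)) := h.span ▸ trivial
    induction hT using Submodule.span_induction with
    | mem T hT =>
      obtain ⟨x, rfl⟩ := hT
      rw [ops, hB.apply_right, hv]
    | zero => simp
    | add T T' _ _ h h' => rw [LinearMap.add_apply, map_add, h, h', add_zero]
    | smul c T _ h => rw [LinearMap.smul_apply, LinearMap.map_smulₛₗ, h, smul_zero]
  obtain ⟨φ, hφ⟩ := Module.Projective.exists_dual_eq_one k hv0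
  ext u w
  have := h1 (φ.smulRight w) u
  rwa [LinearMap.smulRight_apply, hφ, one_smul] at this

theorem IsWeil.nondegenerate (h : IsWeil ψ ρ) {B : W →ₗ[k] W →ₛₗ[θ] k} (hB : Preserves ρ B)
    (h0 : B ≠ 0) : B.Nondegenerate :=
  ⟨h.separatingLeft hB h0, h.separatingRight hB h0⟩

/-- The determinant of a similitude of a nondegenerate sesquilinear form. -/
theorem det_mul_map_det [FiniteDimensional k W] {B : W →ₗ[k] W →ₛₗ[θ] k} (hB : B.SeparatingLeft)
    {X : Module.End k W} {c : k} (hX : ∀ u v, B (X u) (X v) = c * B u v) :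
    LinearMap.det X * θ (LinearMap.det X) = c ^ Module.finrank k W := by
  let w := Module.finBasis k W
  let M : Matrix (Fin (Module.finrank k W)) (Fin (Module.finrank k W)) k :=
    Matrix.of fun i j => B (w i) (w j)
  let T := LinearMap.toMatrix w w X
  have hM : M.det ≠ 0 := by
    intro h0
    obtain ⟨x, hx, hxM⟩ := Matrix.exists_vecMul_eq_zero_iff.2 h0
    apply hx
    have h1 : ∑ i, x i • w i = 0 := by
      refine hB _ fun v => ?_
      rw [← w.sum_repr v, map_sum]
      refine Finset.sum_eq_zero fun j _ => ?_
      have := congrFun hxM j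
      simp only [Matrix.vecMul, dotProduct, M, Matrix.of_apply, Pi.zero_apply] at this
      rw [LinearMap.map_smulₛₗ, map_sum, LinearMap.sum_apply]
      simp only [map_smul, LinearMap.smul_apply, smul_eq_mul]
      rw [this, mul_zero]
    exact funext fun i => Fintype.linearIndependent_iff.1 w.linearIndependent x h1 i
  have hw : ∀ j, X (w j) = ∑ i, T i j • w i := fun j => by
    conv_lhs => rw [← w.sum_repr (X (w j))]
    simp [T, LinearMap.toMatrix_apply]
  have hT : T.transpose * M * T.map θ = c • M := by
    ext j l
    rw [Matrix.smul_apply, smul_eq_mul]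
    change _ = c * B (w j) (w l)
    rw [← hX, hw, hw]
    simp only [Matrix.mul_apply, Finset.sum_mul, map_sum, map_smul, LinearMap.smul_apply,
      LinearMap.sum_apply, LinearMap.map_smulₛₗ, smul_eq_mul, Matrix.transpose_apply,
      Matrix.map_apply, Finset.mul_sum]
    refine Finset.sum_congr rfl fun i _ => ?_
    refine Finset.sum_congr rfl fun i' _ => ?_
    simp only [M, Matrix.of_apply]
    ring
  have h2 := congrArg Matrix.det hT
  rw [Matrix.det_mul, Matrix.det_mul, Matrix.det_transpose, Matrix.det_smul, Fintype.card_fin] at h2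
  have h3 : (T.map θ).det = θ T.det := (RingHom.map_det θ T).symm
  rw [h3, LinearMap.det_toMatrix] at h2
  apply mul_right_cancel₀ hM
  linear_combination h2

/-- Elements of `E(b)` act by isometries, so the adjoint of `X g` is the operator of `g⁻¹`. Their
product is a scalar that comes from an integer and is therefore fixed by `θ`. -/
theorem Preserves.apply_weilOp [Fintype V] {B : W →ₗ[k] W →ₛₗ[θ] k} (hB : Preserves ρ B)
    (h : IsWeil ψ ρ) (hb : IsNondeg b) {g : V ≃+ V} (hg : ∀ x y, b (g x) (g y) = b x y) (u v : W) :
    B (weilOp b ψ (ops ρ) g u) (weilOp b ψ (ops ρ) g v) =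
      ((Nat.card V * fixCard g : ℕ) : k) * B u v := by
  have h1 : ∀ u v, B (weilOp b ψ (ops ρ) g u) v = B u (weilOp b ψ (ops ρ) g.symm v) := by
    intro u v
    have h2 : weilOp b ψ (ops ρ) g.symm = ∑ y, ops ρ y * tinv b ψ (ops ρ) (g y) := by
      refine (Fintype.sum_equiv g.toEquiv _ _ fun y => ?_).symm
      simp
    rw [h2, weilOp, LinearMap.sum_apply, LinearMap.sum_apply, map_sum, map_sum,
      LinearMap.sum_apply]
    refine Finset.sum_congr rfl fun x _ => ?_
    rw [tinv_ops h.apply_eq, tinv_ops h.apply_eq, ops, ops, Module.End.mul_apply,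
      Module.End.mul_apply, hB.apply_left, hB.apply_left, inv_inv]
  rw [h1, ← Module.End.mul_apply, h.isTwisted.weilOp_inv_mul hg,
    h.isTwisted.avg_weilOp h.ne_one hb, LinearMap.smul_apply, Module.End.one_apply,
    LinearMap.map_smulₛₗ, map_natCast, smul_eq_mul]

end Forms

/-! ### Extension to the split extension -/

namespace FormSpace

variable (D : FormSpace.{u})

instance : Finite D.V := Module.finite_of_finite D.K

/-- An element of `G(f̂)` as an automorphism of the additive group `V`. -/
def aut (g : D.G) : D.V ≃+ D.V := g.1.toAddEquiv

variable {D}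

@[simp] theorem aut_apply (g : D.G) (x : D.V) : D.aut g x = g.1 x := rfl

theorem aut_mul (g h : D.G) : D.aut (g * h) = (D.aut h).trans (D.aut g) := rfl

@[simp] theorem act_x (g : D.G) (s : D.E) : (D.act g s).x = g.1 s.x := rfl

theorem hat_aut (g : D.G) (x y : D.V) : D.hat (D.aut g x) (D.aut g y) = D.hat x y := g.2 x y

end FormSpace

section Extension

variable {D : FormSpace.{u}} {k : Type v} [Field k] {W : Type w} [AddCommGroup W] [Module k W]
  {ψ : AddChar (ZMod D.p) k} {ρ : Representation k D.E W}

theorem weilOp_mul_apply [Fintype D.V] (h : IsWeil ψ ρ) (g : D.G) (s : D.E) :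
    weilOp D.hat ψ (ops ρ) (D.aut g) * ρ s =
      ρ (D.act g s) * weilOp D.hat ψ (ops ρ) (D.aut g) := by
  rw [h.apply_eq s, h.apply_eq (D.act g s), mul_smul_comm, smul_mul_assoc,
    h.isTwisted.weilOp_mul_map (hat_aut g)]
  rfl

/-- If the intertwining operators can be rescaled to a homomorphism on `G(f̂)`, then the
representation extends. -/
theorem exists_extension_of_rescaling [Fintype D.V] (hb : IsNondeg D.hat) (h : IsWeil ψ ρ)
    (c : D.G → k) (hc : ∀ g, c g ≠ 0)
    (hmul : ∀ g g' : D.G, c g * c g' * (cocycleSum D.hat ψ (D.aut g) (D.aut g') /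
      fixCard (D.aut (g * g'))) = c (g * g'))
    (hform : ∀ (θ : k →+* k) (B : W →ₗ[k] W →ₛₗ[θ] k), Preserves ρ B → B ≠ 0 →
      ∀ g, c g * θ (c g) * ((Nat.card D.V * fixCard (D.aut g) : ℕ) : k) = 1) :
    ∃ σ : Representation k D.GE W,
      (∀ s : D.E, σ (SemidirectProduct.inl s) = ρ s) ∧ Function.Injective σ ∧
      ∀ (θ : k →+* k) (B : W →ₗ[k] W →ₛₗ[θ] k), Preserves ρ B → Preserves σ B := by
  have hW := h.nontrivial
  have he := h.isTwisted
  let X : D.G → Module.End k W := fun g => weilOp D.hat ψ (ops ρ) (D.aut g)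
  have hV := natCast_card_ne_zero (k := k) h.ne_one hb
  have hXmul : ∀ g g', (c g • X g) * (c g' • X g') = c (g * g') • X (g * g') := by
    intro g g'
    rw [smul_mul_smul_comm, he.weilOp_mul_weilOp h.ne_one hb (hat_aut g) (hat_aut g'), smul_smul,
      ← aut_mul, hmul]
  -- `X 1` is a nonzero scalar and `c 1 • X 1` is idempotent, so the latter is the identity.
  have hXone : c 1 • X 1 = 1 := by
    have h1 : X 1 = (Nat.card D.V : k) • 1 := he.weilOp_one
    have h2 := hXmul 1 1
    rw [mul_one, h1, smul_smul, smul_mul_smul_comm, one_mul] at h2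
    have h3 := smul_left_injective k (one_ne_zero (α := Module.End k W)) h2
    rw [h1, smul_smul, (mul_eq_left₀ (mul_ne_zero (hc 1) hV)).1 h3, one_smul]
  let M : D.G →* Module.End k W :=
    { toFun := fun g => c g • X g
      map_one' := hXone
      map_mul' := fun g g' => (hXmul g g').symm }
  have hM : ∀ g s, M g * ρ s = ρ (D.act g s) * M g := by
    intro g s
    change (c g • X g) * ρ s = ρ (D.act g s) * (c g • X g)
    rw [smul_mul_assoc, weilOp_mul_apply h, mul_smul_comm]
  let σ : Representation k D.GE W :=
    { toFun := fun a => ρ a.left * M a.right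
      map_one' := by simp
      map_mul' := fun a a' => by
        rw [SemidirectProduct.mul_left, SemidirectProduct.mul_right, map_mul, map_mul, mul_assoc,
          ← mul_assoc (ρ (D.act _ _)), ← hM]
        simp only [mul_assoc] }
  refine ⟨σ, fun s => ?_, ?_, fun θ B hB a u v => ?_⟩
  · change ρ s * M 1 = ρ s
    rw [map_one, mul_one]
  · rw [injective_iff_map_eq_one]
    intro a ha
    have ha' : ρ a.left * M a.right = 1 := ha
    -- If `a` acts trivially, then `a.right` acts on `E(f̂)` as an inner automorphism, and inner
    -- automorphisms are trivial on `V`.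
    have h1 : M a.right = ρ a.left⁻¹ := by
      rw [← one_mul (M _), ← map_one ρ, ← inv_mul_cancel a.left, map_mul, mul_assoc, ha', mul_one]
    have h2 : a.right = 1 := by
      apply Subtype.ext
      apply LinearEquiv.ext
      intro x
      have h3 := hM a.right ⟨x, 0⟩
      rw [h1, ← map_mul, ← map_mul] at h3
      have h4 := congrArg EGroup.x (h.injective hb h3)
      simp only [EGroup.mul_x, EGroup.inv_x, act_x] at h4
      rw [add_comm] at h4
      exact (add_right_cancel h4).symm
    have h3 : a.left = 1 := by
      rw [h2, map_one, mul_one] at ha'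
      exact h.injective hb (by rw [ha', map_one])
    exact SemidirectProduct.ext h3 h2
  · change B (ρ a.left (M a.right u)) (ρ a.left (M a.right v)) = B u v
    rw [hB]
    by_cases h0 : B = 0
    · rw [h0]
      simp
    change B (c a.right • X a.right u) (c a.right • X a.right v) = B u v
    rw [LinearMap.map_smulₛₗ, map_smul, LinearMap.smul_apply, hB.apply_weilOp h hb (hat_aut _),
      smul_eq_mul, smul_eq_mul]
    linear_combination (B u v) * hform θ B hB h0 a.right

end Extension

/-! ### Rescaling in odd characteristic -/

section GaussSum

variable {p : ℕ} [Fact p.Prime] {k : Type*} [Field k]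

/-- The square of a quadratic Gauss sum does not change if the form is replaced by its negative. -/
theorem gaussSum_sq_eq {Y : Type*} [AddCommGroup Y] [Fintype Y] [Module (ZMod p) Y]
    (ψ : AddChar (ZMod p) k) (β : Y →+ Y →+ ZMod p) :
    (∑ v, ψ (β v v)) ^ 2 = (∑ v, ψ (-β v v)) ^ 2 := by
  -- With `a² + c² = -1` in `𝔽_p`, the substitution `F` is a bijection of `Y × Y` that negates the
  -- form `β v₁ v₁ + β v₂ v₂`; the mixed terms cancel.
  obtain ⟨a, c, hac⟩ := ZMod.sq_add_sq p (-1)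
  let F : Y × Y → Y × Y := fun v => (a • v.1 + c • v.2, a • v.2 - c • v.1)
  have hF : Function.Injective F := by
    intro v v' h
    have h1 := congrArg Prod.fst h
    have h2 := congrArg Prod.snd h
    simp only [F] at h1 h2
    have e1 : ∀ v : Y × Y, v.1 = -(a • (a • v.1 + c • v.2) - c • (a • v.2 - c • v.1)) := by
      intro v
      have : -(a • (a • v.1 + c • v.2) - c • (a • v.2 - c • v.1)) = (-(a ^ 2 + c ^ 2)) • v.1 := by
        module
      rw [this, hac, neg_neg, one_smul]
    have e2 : ∀ v : Y × Y, v.2 = -(a • (a • v.2 - c • v.1) + c • (a • v.1 + c • v.2)) := by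
      intro v
      have : -(a • (a • v.2 - c • v.1) + c • (a • v.1 + c • v.2)) = (-(a ^ 2 + c ^ 2)) • v.2 := by
        module
      rw [this, hac, neg_neg, one_smul]
    ext
    · rw [e1 v, e1 v', h1, h2]
    · rw [e2 v, e2 v', h1, h2]
  have hbij : Function.Bijective F := Finite.injective_iff_bijective.1 hF
  have hs : ∀ (r : ZMod p) (v w : Y), β (r • v) w = r * β v w := by
    intro r v w
    have := ZMod.map_smul (β.flip w) r v
    simpa using this
  have hs' : ∀ (r : ZMod p) (v w : Y), β v (r • w) = r * β v w := by
    intro r v w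
    have := ZMod.map_smul (β v) r w
    simpa using this
  rw [sq, sq, Finset.sum_mul_sum, Finset.sum_mul_sum, ← Fintype.sum_prod_type',
    ← Fintype.sum_prod_type', ← Function.Bijective.sum_comp hbij]
  refine Finset.sum_congr rfl fun v _ => ?_
  rw [← AddChar.map_add_eq_mul, ← AddChar.map_add_eq_mul]
  congr 1
  simp only [F, map_add, map_sub, AddMonoidHom.add_apply, AddMonoidHom.sub_apply, hs, hs']
  linear_combination (β v.1 v.1 + β v.2 v.2) * hac

variable {V : Type*} [AddCommGroup V]

/-- The biadditive form whose quadratic form is `cocycleForm`. -/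
def cocycleBilin (b : V →+ V →+ ZMod p) (g h : V ≃+ V) : V × V →+ V × V →+ ZMod p :=
  AddMonoidHom.mk' (fun v => AddMonoidHom.mk' (fun w =>
      b (g v.1 - v.1) (h w.2 - w.2) - b (g v.1 - v.1) w.1 - b (h v.2 - v.2) w.2)
      (by intro w w'; simp only [Prod.fst_add, Prod.snd_add, map_add, map_sub]; abel))
    (by
      intro v v'
      ext w
      all_goals
        simp
        try abel)

theorem cocycleSum_sq [Finite V] {b : V →+ V →+ ZMod p} (hb : IsNondeg b)
    (ψ : AddChar (ZMod p) k) (g h : V ≃+ V) :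
    cocycleSum b ψ g h ^ 2 = cocycleSum b ψ h.symm g.symm ^ 2 := by
  have := Fintype.ofFinite (cocycleSet g h)
  let _ : Module (ZMod p) (cocycleSet g h) := AddCommGroup.zmodModule (n := p) fun v => by
    ext
    · exact EGroup.nsmul_eq_zero hb _
    · exact EGroup.nsmul_eq_zero hb _
  rw [cocycleSum_inv, cocycleSum, finsum_eq_sum_of_fintype, finsum_eq_sum_of_fintype]
  -- The double flip restricts `cocycleBilin` to the subgroup in both arguments.
  exact gaussSum_sq_eq ψ (((cocycleBilin b g h).comp (cocycleSet g h).subtype).compr₂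
    (AddMonoidHom.id _) |>.flip.comp (cocycleSet g h).subtype |>.flip)

end GaussSum

section Odd

variable {D : FormSpace.{u}} {k : Type v} [Field k] {W : Type w} [AddCommGroup W] [Module k W]
  {ψ : AddChar (ZMod D.p) k} {ρ : Representation k D.E W}

/-- Let `n g = |V| |fix g|`, let `d g` be the determinant of `X g`, and `N = dim W`. The Gauss sum
identities give `γ⁴` as the coboundary of `n²`, and taking determinants in `X g * X g' = γ • X (g
g')` gives `γ^N` as the coboundary of `d`. Since `N² = |V|` is a power of the odd prime `p`, there
are integers with `4 s + N t = 1`, and `δ = (n²)^s d^t` has coboundary `γ`. For an invariant form,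
`d θ(d) = n^N` yields `δ θ(δ) = n`, which is the norm that is needed. -/
theorem exists_extension_of_odd [FiniteDimensional k W] (hp : D.p ≠ 2) (hb : IsNondeg D.hat)
    (h : IsWeil ψ ρ) :
    ∃ σ : Representation k D.GE W,
      (∀ s : D.E, σ (SemidirectProduct.inl s) = ρ s) ∧ Function.Injective σ ∧
      ∀ (θ : k →+* k) (B : W →ₗ[k] W →ₛₗ[θ] k), Preserves ρ B → Preserves σ B := by
  have := Fintype.ofFinite D.V
  have hW := h.nontrivial
  have he := h.isTwisted
  set N := Module.finrank k W with hN
  have hcop : Nat.Coprime 4 N := by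
    obtain ⟨j, hj⟩ := EGroup.exists_card_eq_pow hb
    have h1 : N ∣ D.p ^ j := by
      rw [← hj, ← h.finrank_sq hb, sq]
      exact dvd_mul_right _ _
    refine Nat.Coprime.coprime_dvd_right h1 (Nat.Coprime.pow_right _ ?_)
    have h2 : Nat.Coprime 2 D.p :=
      (Nat.coprime_primes Nat.prime_two D.prime.out).2 hp.symm
    exact Nat.Coprime.pow_left 2 h2
  obtain ⟨s, t, hst⟩ : ∃ s t : ℤ, 4 * s + N * t = 1 := by
    have h1 := Nat.gcd_eq_gcd_ab 4 N
    rw [hcop] at h1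
    exact ⟨_, _, h1.symm⟩
  let n : D.G → k := fun g => ((Nat.card D.V * fixCard (D.aut g) : ℕ) : k)
  let d : D.G → k := fun g => LinearMap.det (weilOp D.hat ψ (ops ρ) (D.aut g))
  let γ : D.G → D.G → k := fun g g' =>
    cocycleSum D.hat ψ (D.aut g) (D.aut g') / fixCard (D.aut (g * g'))
  have hV := natCast_card_ne_zero (k := k) h.ne_one hb
  have hF : ∀ g : D.G, (fixCard (D.aut g) : k) ≠ 0 := fun g =>
    natCast_fixCard_ne_zero h.ne_one hb _
  have hn : ∀ g, n g ≠ 0 := fun g => by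
    simp only [n, Nat.cast_mul]
    exact mul_ne_zero hV (hF g)
  have hd : ∀ g, d g ≠ 0 := by
    intro g h0
    have h1 := congrArg LinearMap.det (he.weilOp_inv_mul (hat_aut g))
    rw [he.avg_weilOp h.ne_one hb, map_mul] at h1
    change _ * d g = LinearMap.det (n g • (1 : Module.End k W)) at h1
    rw [h0, mul_zero, LinearMap.det_smul, map_one, mul_one] at h1
    exact pow_ne_zero _ (hn g) h1.symm
  have hγ4 : ∀ g g', γ g g' ^ 4 * n (g * g') ^ 2 = (n g * n g') ^ 2 := by
    intro g g'
    have h1 := cocycleSum_sq hb ψ (D.aut g) (D.aut g')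
    have h2 := he.cocycleSum_mul_cocycleSum_inv h.ne_one hb (hat_aut g) (hat_aut g')
    rw [← aut_mul] at h2
    have h3 : cocycleSum D.hat ψ (D.aut g) (D.aut g') ^ 4 = ((Nat.card D.V * fixCard (D.aut g) *
        fixCard (D.aut g') * fixCard (D.aut (g * g')) : ℕ) : k) ^ 2 := by
      rw [← h2, mul_pow, ← h1]
      ring
    simp only [γ, n, div_pow, h3]
    have := hF (g * g')
    push_cast
    field_simp
  have hγ0 : ∀ g g', γ g g' ≠ 0 := by
    intro g g' h0
    have := hγ4 g g'
    rw [h0, zero_pow (by norm_num), zero_mul] at this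
    exact pow_ne_zero 2 (mul_ne_zero (hn g) (hn g')) this.symm
  have hγd : ∀ g g', d g * d g' = γ g g' ^ N * d (g * g') := by
    intro g g'
    have h1 := congrArg LinearMap.det (he.weilOp_mul_weilOp h.ne_one hb (hat_aut g) (hat_aut g'))
    rwa [map_mul, LinearMap.det_smul, ← aut_mul] at h1
  let δ : D.G → k := fun g => (n g ^ 2) ^ s * d g ^ t
  have hδ : ∀ g g', δ g * δ g' = γ g g' * δ (g * g') := by
    intro g g'
    have e1 : δ g * δ g' = ((n g * n g') ^ 2) ^ s * (d g * d g') ^ t := by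
      simp only [δ, mul_zpow, mul_pow]
      ring
    have e2 : γ g g' = (γ g g' ^ 4) ^ s * (γ g g' ^ N) ^ t := by
      rw [← zpow_natCast, ← zpow_natCast, ← zpow_mul, ← zpow_mul, ← zpow_add₀ (hγ0 g g')]
      push_cast
      rw [hst, zpow_one]
    rw [e1, ← hγ4, hγd, mul_zpow, mul_zpow]
    conv_rhs => rw [e2]
    simp only [δ]
    ring
  have hδ0 : ∀ g, δ g ≠ 0 := fun g =>
    mul_ne_zero (zpow_ne_zero _ (pow_ne_zero _ (hn g))) (zpow_ne_zero _ (hd g))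
  refine exists_extension_of_rescaling hb h (fun g => (δ g)⁻¹) (fun g => inv_ne_zero (hδ0 g))
    (fun g g' => ?_) fun θ B hB h0 g => ?_
  · change (δ g)⁻¹ * (δ g')⁻¹ * γ g g' = (δ (g * g'))⁻¹
    rw [← mul_inv, hδ]
    have := hδ0 (g * g')
    have := hγ0 g g'
    field_simp
  · change (δ g)⁻¹ * θ (δ g)⁻¹ * n g = 1
    have h1 : d g * θ (d g) = n g ^ N :=
      det_mul_map_det (h.separatingLeft hB h0) (hB.apply_weilOp h hb (hat_aut g))
    have h2 : δ g * θ (δ g) = n g := by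
      have h3 : θ (δ g) = (n g ^ 2) ^ s * θ (d g) ^ t := by
        simp only [δ, n, map_mul, map_zpow₀, map_pow, map_natCast]
      have h4 : δ g * θ (δ g) = ((n g) ^ 4) ^ s * (d g * θ (d g)) ^ t := by
        have e3 : (n g) ^ 4 = n g ^ 2 * n g ^ 2 := by ring
        rw [h3, e3, mul_zpow, mul_zpow]
        simp only [δ]
        ring
      rw [h4, h1, ← zpow_natCast, ← zpow_natCast, ← zpow_mul, ← zpow_mul, ← zpow_add₀ (hn g)]
      push_cast
      rw [hst, zpow_one]
    rw [map_inv₀, ← mul_inv, h2, inv_mul_cancel₀ (hn g)]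

end Odd

/-! ### The forms `f̂` -/

namespace FormSpace

variable {D : FormSpace.{u}}

theorem hat_apply (x y : D.V) :
    D.hat x y = Algebra.trace (ZMod D.p) D.K (D.lam * D.f x y) := rfl

instance : Module.Finite (ZMod D.p) D.K := Module.Finite.of_finite

theorem eq_zero_of_trace {a : D.K} (h : ∀ c, Algebra.trace (ZMod D.p) D.K (c * a) = 0) : a = 0 :=
  (traceForm_nondegenerate (ZMod D.p) D.K).2 a h

theorem trace_eta (hη : ∀ a, D.η (D.η a) = a) (a : D.K) :
    Algebra.trace (ZMod D.p) D.K (D.η a) = Algebra.trace (ZMod D.p) D.K a := by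
  let σ : D.K ≃ₐ[ZMod D.p] D.K := AlgEquiv.ofRingEquiv
    (f := RingEquiv.ofRingHom D.η D.η (RingHom.ext hη) (RingHom.ext hη)) fun a =>
      RingHom.congr_fun (Subsingleton.elim (D.η.comp (algebraMap (ZMod D.p) D.K))
        (algebraMap (ZMod D.p) D.K)) a
  exact Algebra.trace_eq_of_algEquiv σ a

theorem IsHermitian.lam_ne_zero (h : D.IsHermitian) : D.lam ≠ 0 := by
  intro h0
  apply h.2.2.2.2
  rw [h0, map_zero]

theorem IsAdmissible.lam_ne_zero (h : D.IsAdmissible) : D.lam ≠ 0 := by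
  rcases h with h | ⟨W, _, _, e, h⟩ | h
  · rw [h.2.2.2.2]
    exact one_ne_zero
  · rw [h.2.2]
    exact one_ne_zero
  · exact h.lam_ne_zero

/-- Here `f̂` is itself alternating, so `comm f̂ = 2 f̂`; this is where `p ≠ 2` enters. -/
theorem IsAlternating.isNondeg (h : D.IsAlternating) : IsNondeg D.hat := by
  obtain ⟨hη, hp, halt, hnd, hlam⟩ := h
  intro x hx
  refine hnd.1 x fun y => ?_
  have h2 : (2 : D.K) ≠ 0 := by
    have : CharP D.K D.p := charP_of_injective_algebraMap (algebraMap (ZMod D.p) D.K).injective D.p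
    exact Ring.two_ne_zero (by rwa [ringChar.eq D.K D.p])
  have h0 : 2 * D.f x y = 0 := eq_zero_of_trace fun c => by
    have h1 := hx (c • y)
    have hc : D.η c = c := RingHom.congr_fun hη c
    rw [comm_apply, hat_apply, hat_apply, ← map_sub, hlam, LinearMap.map_smulₛₗ, map_smul,
      LinearMap.smul_apply, hc] at h1
    have h3 : D.f y x = -D.f x y := by
      have := halt (x + y)
      rw [map_add, map_add, LinearMap.add_apply, LinearMap.add_apply, halt x, halt y, zero_add,
        add_zero] at this
      exact eq_neg_of_add_eq_zero_left this
    rw [h3, smul_eq_mul, smul_eq_mul] at h1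
    rw [← h1]
    congr 1
    ring
  exact (mul_eq_zero.1 h0).resolve_left h2

/-- The trace is invariant under `η`, which turns `λ f(y, x)` into `η(λ) f(x, y)`. Nondegeneracy
then amounts to `η λ ≠ λ`. -/
theorem IsHermitian.comm_hat (h : D.IsHermitian) (x y : D.V) :
    comm D.hat x y = Algebra.trace (ZMod D.p) D.K ((D.lam - D.η D.lam) * D.f x y) := by
  obtain ⟨hη, hη2, hherm, hnd, hlam⟩ := h
  rw [comm_apply, hat_apply, hat_apply, sub_mul, map_sub, ← trace_eta hη2 (D.lam * D.f y x),
    map_mul D.η, ← hherm]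

theorem IsHermitian.isNondeg (h : D.IsHermitian) : IsNondeg D.hat := by
  have hc := h.comm_hat
  obtain ⟨hη, hη2, hherm, hnd, hlam⟩ := h
  intro x hx
  refine hnd.1 x fun y => ?_
  have h0 : (D.lam - D.η D.lam) * D.f x y = 0 := eq_zero_of_trace fun c => by
    have h1 := hx (D.η c • y)
    rw [hc, LinearMap.map_smulₛₗ, hη2, smul_eq_mul] at h1
    rw [← h1]
    congr 1
    ring
  exact (mul_eq_zero.1 h0).resolve_left (sub_ne_zero.2 (Ne.symm hlam))

/-! ### Split forms and the left radical `W*`. -/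

section Split

variable {W : Type u} [AddCommGroup W] [Module D.K W] {e : D.V ≃ₗ[D.K] Module.Dual D.K W × W}

theorem IsSplitVia.snd_eq_zero (h : D.IsSplitVia e) {x : D.V}
    (hx : ∀ β : Module.Dual D.K W, D.hat x (e.symm (β, 0)) = 0) : (e x).2 = 0 := by
  obtain ⟨hη, hf, hlam⟩ := h
  rw [← Module.forall_dual_apply_eq_zero_iff D.K]
  intro β
  refine eq_zero_of_trace fun c => ?_
  have h1 := hx (c • β)
  rw [hat_apply, hlam, one_mul, hf, LinearEquiv.apply_symm_apply] at h1
  simpa using h1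

theorem IsSplitVia.mem_ker (h : D.IsSplitVia e) {x : D.V} : x ∈ D.hat.ker ↔ (e x).2 = 0 := by
  constructor
  · intro hx
    rw [AddMonoidHom.mem_ker] at hx
    exact h.snd_eq_zero fun β => by rw [hx]; rfl
  · intro hx
    obtain ⟨hη, hf, hlam⟩ := h
    rw [AddMonoidHom.mem_ker]
    ext y
    rw [hat_apply, hf, hx]
    simp

theorem IsSplitVia.isNondeg (h : D.IsSplitVia e) : IsNondeg D.hat := by
  have h' := h
  obtain ⟨hη, hf, hlam⟩ := h'
  intro x hx
  have h2 : (e x).2 = 0 := h.snd_eq_zero fun β => by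
    have h1 := hx (e.symm (β, 0))
    have h3 : D.hat (e.symm (β, 0)) x = 0 := by
      rw [hat_apply, hf]
      simp
    rwa [comm_apply, h3, sub_zero] at h1
  have h1 : (e x).1 = 0 := by
    ext y
    refine eq_zero_of_trace fun c => ?_
    have h1 := hx (e.symm (0, c • y))
    rw [comm_apply, hat_apply, hat_apply, hf, hf] at h1
    simpa [hlam] using h1
  exact e.map_eq_zero_iff.1 (Prod.ext h1 h2)

/-- This is the only property of split forms that the extension uses: the left radical of `f̂`,
which is `W*` and is stable under `G(f̂)`, contains every vector annihilating it. -/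
theorem IsSplitVia.mem_ker_of_apply_ker (h : D.IsSplitVia e) {x : D.V}
    (hx : ∀ a ∈ D.hat.ker, D.hat x a = 0) : x ∈ D.hat.ker :=
  h.mem_ker.2 (h.snd_eq_zero fun β => hx _ (h.mem_ker.2 (by simp)))

end Split

theorem IsAdmissible.isNondeg (h : D.IsAdmissible) : IsNondeg D.hat := by
  rcases h with h | ⟨W, _, _, e, h⟩ | h
  · exact h.isNondeg
  · exact h.isNondeg
  · exact h.isNondeg

/-- Since `g` is `K`-linear, invariance of `f̂` may be applied to all multiples `c • x`;
nondegeneracy of the trace form then recovers `λ f`, and `λ ≠ 0`. -/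
theorem IsAdmissible.mem_G_iff (h : D.IsAdmissible) (g : D.V ≃ₗ[D.K] D.V) :
    g ∈ D.G ↔ ∀ x y, D.f (g x) (g y) = D.f x y := by
  constructor
  · intro hg x y
    have h0 : D.lam * (D.f (g x) (g y) - D.f x y) = 0 := eq_zero_of_trace fun c => by
      have h1 := hg (c • x) y
      rw [hat_apply, hat_apply, ← sub_eq_zero, ← map_sub, map_smul, map_smul, map_smul,
        LinearMap.smul_apply, LinearMap.smul_apply, smul_eq_mul, smul_eq_mul] at h1
      rw [← h1]
      congr 1
      ring
    exact sub_eq_zero.1 ((mul_eq_zero.1 h0).resolve_left h.lam_ne_zero)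
  · intro hg x y
    rw [hat_apply, hat_apply, hg]

end FormSpace

/-! ### Rescaling for split forms -/

section SplitExtension

variable {D : FormSpace.{u}} {k : Type v} [Field k] {W : Type w} [AddCommGroup W] [Module k W]
  {ψ : AddChar (ZMod D.p) k} {ρ : Representation k D.E W}

/-- On the left radical `A` of `f̂` the operators `ops ρ` multiply without a cocycle. The sum `P` of
these operators over `A` satisfies `P T P ∈ k P` for every `T`, so the vectors of `W` fixed by `A`
form a line `k w₀`. The group `G(f̂)` stabilizes `A`, hence `X g w₀ = δ g • w₀`, and `δ` has
coboundary `γ`. Dividing by `δ` normalizes the operators so that they fix `w₀`. -/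
theorem exists_extension_of_split (hb : IsNondeg D.hat)
    (hs : ∀ x, (∀ a ∈ D.hat.ker, D.hat x a = 0) → x ∈ D.hat.ker) (h : IsWeil ψ ρ) :
    ∃ σ : Representation k D.GE W,
      (∀ s : D.E, σ (SemidirectProduct.inl s) = ρ s) ∧ Function.Injective σ ∧
      ∀ (θ : k →+* k) (B : W →ₗ[k] W →ₛₗ[θ] k), Preserves ρ B → Preserves σ B := by
  classical
  have := Fintype.ofFinite D.V
  have hW := h.nontrivial
  have he := h.isTwisted
  let A : AddSubgroup D.V := D.hat.ker
  have hA : ∀ {a}, a ∈ A → ∀ y, D.hat a y = 0 := fun {a} ha y => by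
    rw [AddMonoidHom.mem_ker.1 ha, AddMonoidHom.zero_apply]
  have hcardA : (Nat.card A : k) ≠ 0 := by
    obtain ⟨c, hc⟩ := AddSubgroup.card_addSubgroup_dvd_card A
    intro h0
    apply natCast_card_ne_zero (k := k) h.ne_one hb
    rw [hc, Nat.cast_mul, h0, zero_mul]
  let P : Module.End k W := ∑ a : A, ops ρ a
  have hP0 : P ≠ 0 := by
    intro h0
    have h1 := (h.linearIndependent hb).comp (fun a : A => a.1) Subtype.val_injective
    have h2 := Fintype.linearIndependent_iff.1 h1 (fun _ => 1) (by simpa [P] using h0) 0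
    exact one_ne_zero h2
  have hPa : ∀ a ∈ A, ops ρ a * P = P := by
    intro a ha
    rw [Finset.mul_sum]
    refine Fintype.sum_equiv (Equiv.addLeft (⟨a, ha⟩ : A)) _ _ fun a' => ?_
    rw [he.map_mul, hA ha, AddChar.map_zero_eq_one, one_smul]
    rfl
  have hPx : ∀ x, ∃ c : k, P * ops ρ x * P = c • P := by
    intro x
    have h1 : ∀ a a' : A, ops ρ a * ops ρ x * ops ρ a' =
        ψ (D.hat x a') • ops ρ ((a + a' : A) + x : D.V) := by
      intro a a'
      rw [he.map_mul, hA a.2, AddChar.map_zero_eq_one, one_smul, he.map_mul, map_add,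
        AddMonoidHom.add_apply, hA a.2, zero_add]
      congr 2
      push_cast
      abel
    have h2 : P * ops ρ x * P = (∑ a' : A, ψ (D.hat x a')) • ∑ a : A, ops ρ (a + x) := by
      simp only [P, Finset.sum_mul, Finset.mul_sum, h1]
      rw [Finset.sum_smul]
      refine Finset.sum_congr rfl fun a' _ => ?_
      rw [Finset.smul_sum]
      exact Fintype.sum_equiv (Equiv.addRight a') _ _ fun a => rfl
    -- For `x ∈ A` the translate is absorbed in the sum over `A`. For `x ∉ A` the map `a ↦ f̂(x, a)`
    -- is nonzero on `A` by `hs`, so the character sum vanishes.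
    by_cases hx : x ∈ A
    · refine ⟨∑ a' : A, ψ (D.hat x a'), ?_⟩
      rw [h2]
      congr 1
      exact Fintype.sum_equiv (Equiv.addRight (⟨x, hx⟩ : A)) _ _ fun a => rfl
    · refine ⟨0, ?_⟩
      have h3 := sum_char_comp h.ne_one ((D.hat x).comp A.subtype)
      rw [if_neg] at h3
      · simp only [AddMonoidHom.comp_apply, AddSubgroup.subtype_apply] at h3
        rw [h2, h3, zero_smul, zero_smul]
      · intro h0
        exact hx (hs x fun a ha => DFunLike.congr_fun h0 (⟨a, ha⟩ : A))
  have hPT : ∀ T : Module.End k W, ∃ c : k, P * T * P = c • P := by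
    intro T
    have hT : T ∈ Submodule.span k (Set.range (ops ρ)) := h.span ▸ trivial
    induction hT using Submodule.span_induction with
    | mem T hT =>
      obtain ⟨x, rfl⟩ := hT
      exact hPx x
    | zero => exact ⟨0, by simp⟩
    | add T T' _ _ h h' =>
      obtain ⟨c, hc⟩ := h
      obtain ⟨c', hc'⟩ := h'
      exact ⟨c + c', by rw [mul_add, add_mul, hc, hc', add_smul]⟩
    | smul r T _ h =>
      obtain ⟨c, hc⟩ := h
      exact ⟨r * c, by rw [mul_smul_comm, smul_mul_assoc, hc, smul_smul]⟩
  obtain ⟨w₁, hw₁⟩ : ∃ w, P w ≠ 0 := by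
    by_contra! h0
    exact hP0 (LinearMap.ext h0)
  set w₀ := P w₁ with hw₀
  have hfix₀ : ∀ a ∈ A, ops ρ a w₀ = w₀ := fun a ha => by
    rw [hw₀, ← Module.End.mul_apply, hPa a ha]
  have hfix : ∀ w, (∀ a ∈ A, ops ρ a w = w) → ∃ c : k, w = c • w₀ := by
    intro w hw
    obtain ⟨φ, hφ⟩ := Module.Projective.exists_dual_eq_one k hw₁
    -- This rank-one operator takes `w₀ = P w₁` to `w`, so applying `P T P` to `w₁` gives `P w = |A|
    -- w` on one side and `c w₀` on the other.
    obtain ⟨c, hc⟩ := hPT (φ.smulRight w)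
    have h1 := congrArg (fun F => F w₁) hc
    have h2 : P w = (Nat.card A : k) • w := by
      simp only [P, LinearMap.sum_apply]
      rw [Finset.sum_congr rfl fun a _ => hw a.1 a.2]
      simp [Nat.cast_smul_eq_nsmul]
    simp only [Module.End.mul_apply, LinearMap.smulRight_apply, LinearMap.smul_apply, ← hw₀, hφ,
      one_smul, h2] at h1
    refine ⟨(Nat.card A : k)⁻¹ * c, ?_⟩
    rw [mul_smul, ← h1, smul_smul, inv_mul_cancel₀ hcardA, one_smul]
  let X : D.G → Module.End k W := fun g => weilOp D.hat ψ (ops ρ) (D.aut g)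
  have hX : ∀ g, ∃ c : k, X g w₀ = c • w₀ := by
    intro g
    refine hfix _ fun a ha => ?_
    have ha' : (D.aut g).symm a ∈ A := by
      rw [AddMonoidHom.mem_ker]
      ext y
      rw [← hat_aut g, AddEquiv.apply_symm_apply, hA ha]
      rfl
    have h1 := congrArg (fun F => F w₀) (he.weilOp_mul_map (hat_aut g) ((D.aut g).symm a))
    simp only [Module.End.mul_apply, AddEquiv.apply_symm_apply, hfix₀ _ ha'] at h1
    exact h1.symm
  choose δ hδ using hX
  have hn : ∀ g : D.G, ((Nat.card D.V * fixCard (D.aut g) : ℕ) : k) ≠ 0 := fun g => by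
    rw [Nat.cast_mul]
    exact mul_ne_zero (natCast_card_ne_zero h.ne_one hb) (natCast_fixCard_ne_zero h.ne_one hb _)
  have hδ0 : ∀ g, δ g ≠ 0 := by
    intro g h0
    have h1 := congrArg (fun F => F w₀) (he.weilOp_inv_mul (hat_aut g))
    simp only [Module.End.mul_apply] at h1
    rw [he.avg_weilOp h.ne_one hb, show weilOp D.hat ψ (ops ρ) (D.aut g) w₀ = δ g • w₀ from hδ g,
      h0, zero_smul, map_zero, LinearMap.smul_apply, eq_comm, smul_eq_zero] at h1
    exact h1.elim (hn g) hw₁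
  have hδmul : ∀ g g' : D.G, δ g * δ g' = cocycleSum D.hat ψ (D.aut g) (D.aut g') /
      fixCard (D.aut (g * g')) * δ (g * g') := by
    intro g g'
    have h1 := congrArg (fun F => F w₀)
      (he.weilOp_mul_weilOp h.ne_one hb (hat_aut g) (hat_aut g'))
    simp only [Module.End.mul_apply, LinearMap.smul_apply] at h1
    change X g (X g' w₀) = _ • X (g * g') w₀ at h1
    rw [hδ, map_smul, hδ, hδ, smul_smul, smul_smul, mul_comm] at h1
    exact smul_left_injective k hw₁ h1
  refine exists_extension_of_rescaling hb h (fun g => (δ g)⁻¹) (fun g => inv_ne_zero (hδ0 g))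
    (fun g g' => ?_) fun θ B hB h0 g => ?_
  · rw [← mul_inv, hδmul]
    have h1 := hδ0 (g * g')
    have h2 : cocycleSum D.hat ψ (D.aut g) (D.aut g') / fixCard (D.aut (g * g')) ≠ 0 := by
      intro h2
      have h3 := hδmul g g'
      rw [h2, zero_mul] at h3
      exact mul_ne_zero (hδ0 g) (hδ0 g') h3
    rw [mul_inv, mul_comm, ← mul_assoc, mul_inv_cancel₀ h2, one_mul]
  · have hB0 : B w₀ w₀ ≠ 0 := by
      intro hB0
      refine hw₁ (h.separatingLeft hB h0 w₀ fun v => ?_)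
      obtain ⟨c, hc⟩ := hfix (P v) fun a ha => by rw [← Module.End.mul_apply, hPa a ha]
      have h1 : B w₀ (P v) = (Nat.card A : k) * B w₀ v := by
        have h2 : ∀ a : A, B w₀ (ops ρ a v) = B w₀ v := fun a => by
          conv_lhs => rw [← hfix₀ a a.2]
          exact hB _ _ _
        simp only [P, LinearMap.sum_apply, map_sum, h2]
        simp
      rw [hc, LinearMap.map_smulₛₗ, hB0, smul_zero, eq_comm] at h1
      exact (mul_eq_zero.1 h1).resolve_left hcardA
    have h1 := hB.apply_weilOp h hb (hat_aut g) w₀ w₀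
    rw [show weilOp D.hat ψ (ops ρ) (D.aut g) w₀ = δ g • w₀ from hδ g, LinearMap.map_smulₛₗ,
      map_smul, LinearMap.smul_apply, smul_eq_mul, smul_eq_mul, ← mul_assoc] at h1
    have h2 := mul_right_cancel₀ hB0 h1
    rw [← h2, map_inv₀]
    have := hδ0 g
    have : θ (δ g) ≠ 0 := (map_ne_zero θ).2 this
    field_simp

end SplitExtension

/-! ### Rescaling for Hermitian forms in characteristic two -/

section Sign

variable {p : ℕ}

/-- The sign `(-1)^a`, for `p = 2`. -/
def sgn (a : ZMod p) : ℤ := if a = 0 then 1 else -1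

theorem neg_eq_of_two (hp : p = 2) (a : ZMod p) : -a = a := by
  subst hp
  exact CharTwo.neg_eq a

theorem char_eq_sgn [Fact p.Prime] (hp : p = 2) {k : Type*} [Field k] {ψ : AddChar (ZMod p) k}
    (hψ : ψ ≠ 1) (a : ZMod p) : ψ a = (sgn a : k) := by
  subst hp
  by_cases ha : a = 0
  · simp [ha, sgn]
  · have h1 : ψ a ≠ 1 := fun h => ha ((char_eq_one_iff hψ).1 h)
    have h2 : ψ a * ψ a = 1 := by
      rw [← AddChar.map_add_eq_mul, CharTwo.add_self_eq_zero, AddChar.map_zero_eq_one]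
    rw [sgn, if_neg ha]
    push_cast
    exact (mul_self_eq_one_iff.1 h2).resolve_left h1

theorem exists_char_of_two [Fact p.Prime] (hp : p = 2) (k : Type*) [Field k] (hk : (2 : k) ≠ 0) :
    ∃ ψ : AddChar (ZMod p) k, ψ ≠ 1 := by
  subst hp
  refine ⟨AddChar.zmodChar 2 (ζ := -1) (by norm_num), ?_⟩
  rw [AddChar.zmod_char_ne_one_iff, show (1 : ZMod 2) = ((1 : ℕ) : ZMod 2) by simp,
    AddChar.zmodChar_apply']
  intro h
  rw [pow_one] at h
  apply hk
  linear_combination (-1 : k) * h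

/-- A sum of signs that is invariant under a permutation of prime order with one fixed point. -/
theorem sum_sgn_modEq {Y : Type*} [Fintype Y] {r : ℕ} [Fact r.Prime] (σ : Y → Y) (y₀ : Y)
    (hσ : σ^[r] = id) (hfix : ∀ y, σ y = y ↔ y = y₀) (Q : Y → ZMod p) (hQ : ∀ y, Q (σ y) = Q y)
    (hQ0 : Q y₀ = 0) : ∑ y, sgn (Q y) ≡ 1 [ZMOD r] := by
  classical
  have hcard : ∀ (S : Type _) [Fintype S] (τ : Function.End S) (s₀ : S), τ^[r] = id →
      (∀ s, τ s = s ↔ s = s₀) → (Fintype.card S : ℤ) ≡ 1 [ZMOD r] := by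
    intro S _ τ s₀ hτ hf
    have h1 := Equiv.Perm.card_fixedPoints_modEq (f := τ) (p := r) (n := 1) (by
      rw [pow_one]
      exact hτ)
    have h2 : Fintype.card S ≡ 1 [MOD r] := by
      convert h1
      refine (Fintype.card_eq_one_iff.2 ?_).symm
      exact ⟨⟨s₀, (hf s₀).2 rfl⟩, fun s => Subtype.ext ((hf s).1 s.2)⟩
    exact_mod_cast (Int.natCast_modEq_iff.2 h2)
  have h1 := hcard Y σ y₀ hσ hfix
  let τ : {y // Q y = 0} → {y // Q y = 0} := fun y => ⟨σ y, by rw [hQ, y.2]⟩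
  have h2 := hcard {y // Q y = 0} τ ⟨y₀, hQ0⟩ (by
    have : ∀ (n : ℕ) y, (τ^[n] y).1 = σ^[n] y.1 := by
      intro n
      induction n with
      | zero => intro y; rfl
      | succ n ih => intro y; rw [Function.iterate_succ_apply, ih, Function.iterate_succ_apply]
    funext y
    apply Subtype.ext
    rw [this, hσ]
    rfl) (fun s => by
      rw [Subtype.ext_iff, Subtype.ext_iff]
      exact hfix s.1)
  -- The sum is twice the number of zeros minus `|Y|`. Both counts are `1` modulo `r`, because `σ`
  -- acts on the zeros and on `Y` with a single fixed point and all other orbits of length `r`.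
  have h3 : ∑ y, sgn (Q y) = 2 * (Fintype.card {y // Q y = 0} : ℤ) - Fintype.card Y := by
    have h4 : ∀ y, sgn (Q y) = 2 * (if Q y = 0 then 1 else 0) - 1 := fun y => by
      rw [sgn]
      split_ifs <;> norm_num
    simp only [h4, Finset.sum_sub_distrib, ← Finset.mul_sum, Finset.sum_boole, Fintype.card_subtype]
    simp
  rw [h3]
  have := (Int.ModEq.mul_left 2 h2).sub h1
  simpa using this

end Sign

/-! ### Scalars of norm one for Hermitian forms with `p = 2`. -/

namespace FormSpace

variable {D : FormSpace.{u}}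

/-- `K` has basis `1, λ` over the fixed field of `η`, whose order `q` is even. So `q + 1` is odd and
has an odd prime divisor `r`, and `r` divides `|Kˣ| = q² - 1`. For `z` of order `r`, the norm `z
η(z)` lies in the fixed field, so its order divides both `r` and `q - 1`. These are coprime, since
`r` divides `q + 1` and is odd. -/
theorem exists_norm_one (h : D.IsHermitian) (hp : D.p = 2) :
    ∃ (q r : ℕ) (z : D.K), Nat.card D.K = q ^ 2 ∧ r.Prime ∧ r ≠ 2 ∧ r ∣ q + 1 ∧ z ^ r = 1 ∧
      z ≠ 1 ∧ z * D.η z = 1 := by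
  classical
  obtain ⟨hη, hη2, -, -, hlam⟩ := h
  let F : Subfield D.K := RingHom.eqLocusField D.η (RingHom.id D.K)
  have hF : ∀ {a}, a ∈ F ↔ D.η a = a := Iff.rfl
  have hne : D.lam - D.η D.lam ≠ 0 := sub_ne_zero.2 (Ne.symm hlam)
  let φ : F × F ≃ D.K := Equiv.ofBijective (fun a => a.1.1 + a.2.1 * D.lam) (by
    constructor
    · intro a a' haa
      have e1 := congrArg D.η haa
      simp only [map_add, map_mul, hF.1 a.1.2, hF.1 a.2.2, hF.1 a'.1.2, hF.1 a'.2.2] at e1 haa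
      have e2 : a.2.1 = a'.2.1 := by
        apply mul_right_cancel₀ hne
        linear_combination haa - e1
      have e3 : a.1.1 = a'.1.1 := by
        rw [e2] at haa
        exact add_right_cancel haa
      exact Prod.ext (Subtype.ext e3) (Subtype.ext e2)
    · intro c
      have hb : (c - D.η c) / (D.lam - D.η D.lam) ∈ F := by
        rw [hF, map_div₀, map_sub, map_sub, hη2, hη2, ← neg_sub c, ← neg_sub D.lam, neg_div_neg_eq]
      have ha : c - (c - D.η c) / (D.lam - D.η D.lam) * D.lam ∈ F := by
        rw [hF, map_sub, map_mul, hF.1 hb]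
        field_simp
        ring
      exact ⟨(⟨_, ha⟩, ⟨_, hb⟩), sub_add_cancel _ _⟩)
  have hcard : Nat.card D.K = Nat.card F ^ 2 := by
    rw [← Nat.card_congr φ, Nat.card_prod, sq]
  set q := Nat.card F with hq
  have hq2 : 2 ∣ q := by
    have hK : ∃ n : ℕ, Nat.card D.K = 2 ^ n := by
      refine ⟨Module.finrank (ZMod D.p) D.K, ?_⟩
      rw [Module.natCard_eq_pow_finrank (K := ZMod D.p), Nat.card_zmod]
      exact congrArg (· ^ _) hp
    obtain ⟨n, hn⟩ := hK
    have h1 : 1 < Nat.card D.K := Finite.one_lt_card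
    have h2 : n ≠ 0 := by
      rintro rfl
      rw [hn] at h1
      norm_num at h1
    have h3 : 2 ∣ q ^ 2 := by
      rw [← hcard, hn]
      exact dvd_pow_self 2 h2
    exact Nat.prime_two.dvd_of_dvd_pow h3
  have hq1 : q + 1 ≠ 1 := by
    have : 0 < q := Nat.card_pos
    omega
  set r := (q + 1).minFac with hr
  have hrp : r.Prime := Nat.minFac_prime hq1
  have hrq : r ∣ q + 1 := Nat.minFac_dvd _
  have hr2 : r ≠ 2 := by
    intro h2
    rw [h2] at hrq
    omega
  have hrK : r ∣ Nat.card D.Kˣ := by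
    rw [Nat.card_units, hcard]
    refine hrq.trans ⟨q - 1, ?_⟩
    rw [← Nat.sq_sub_sq, one_pow]
  have := Fact.mk hrp
  obtain ⟨z, hz⟩ := exists_prime_orderOf_dvd_card' (G := D.Kˣ) r hrK
  have hzr : (z : D.K) ^ r = 1 := by
    rw [← Units.val_pow_eq_pow_val, ← hz, pow_orderOf_eq_one, Units.val_one]
  refine ⟨q, r, z, hcard, hrp, hr2, hrq, hzr, ?_, ?_⟩
  · intro h1
    have : z = 1 := Units.ext h1
    rw [this, orderOf_one] at hz
    exact hrp.one_lt.ne hz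
  · have hyF : (z : D.K) * D.η z ∈ F := by
      rw [hF, map_mul, hη2, mul_comm]
    have hy0 : (z : D.K) * D.η z ≠ 0 :=
      mul_ne_zero z.ne_zero ((map_ne_zero D.η).2 z.ne_zero)
    have h1 : ((z : D.K) * D.η z) ^ r = 1 := by
      rw [mul_pow, ← map_pow, hzr, map_one, one_mul]
    have h2 : ((z : D.K) * D.η z) ^ (q - 1) = 1 := by
      have := Fintype.ofFinite F
      have h3 := FiniteField.pow_card_sub_one_eq_one (⟨_, hyF⟩ : F)
        (fun h0 => hy0 (congrArg Subtype.val h0))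
      rw [← Nat.card_eq_fintype_card] at h3
      exact congrArg Subtype.val h3
    have h3 : Nat.Coprime r (q - 1) := by
      rw [Nat.Prime.coprime_iff_not_dvd hrp]
      intro h4
      have h5 : r ∣ 2 := by
        have := Nat.dvd_sub hrq h4
        rwa [show q + 1 - (q - 1) = 2 by omega] at this
      exact hr2 ((Nat.prime_dvd_prime_iff_eq hrp Nat.prime_two).1 h5)
    have h4 := orderOf_dvd_of_pow_eq_one h1
    have h5 := orderOf_dvd_of_pow_eq_one h2
    have h6 := Nat.dvd_gcd h4 h5
    rw [h3, Nat.dvd_one, orderOf_eq_one_iff] at h6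
    exact h6

/-- The dimension of the space of fixed vectors. -/
def fixDim (g : D.G) : ℕ := Module.finrank D.K (LinearMap.ker (g.1.toLinearMap - LinearMap.id))

theorem fixCard_aut (g : D.G) : fixCard (D.aut g) = Nat.card D.K ^ fixDim g := by
  rw [fixDim, ← Module.natCard_eq_pow_finrank]
  exact Nat.card_congr (Equiv.subtypeEquivRight fun x => by
    simp [LinearMap.mem_ker, sub_eq_zero])

theorem hat_smul (z : D.K) (hz : z * D.η z = 1) (x y : D.V) :
    D.hat (z • x) (z • y) = D.hat x y := by
  rw [hat_apply, hat_apply, LinearMap.map_smulₛₗ, map_smul D.f, LinearMap.smul_apply, smul_eq_mul,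
    smul_eq_mul, ← mul_assoc (D.η z), mul_comm (D.η z), hz, one_mul]

theorem cocycleForm_smul (z : D.K) (hz : z * D.η z = 1) (g h : D.G) (v : D.V × D.V) :
    cocycleForm D.hat (D.aut g) (D.aut h) (z • v) = cocycleForm D.hat (D.aut g) (D.aut h) v := by
  simp only [cocycleForm, aut_apply, Prod.smul_fst, Prod.smul_snd, map_smul, ← smul_sub,
    hat_smul z hz]

theorem smul_mem_cocycleSet (z : D.K) (g h : D.G) {v : D.V × D.V}
    (hv : v ∈ cocycleSet (D.aut g) (D.aut h)) : z • v ∈ cocycleSet (D.aut g) (D.aut h) := by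
  rw [mem_cocycleSet] at hv ⊢
  simp only [aut_apply, Prod.smul_fst, Prod.smul_snd, map_smul, ← smul_sub, ← smul_add] at hv ⊢
  rw [hv, smul_zero]

theorem iterate_smul {U : Type*} [AddCommGroup U] [Module D.K U] {S : Type*} (ι : S → U)
    (hι : Function.Injective ι) {z : D.K} (σ : S → S) (hσ : ∀ s, ι (σ s) = z • ι s) {r : ℕ}
    (hz : z ^ r = 1) : σ^[r] = id := by
  have h : ∀ (n : ℕ) s, ι (σ^[n] s) = z ^ n • ι s := by
    intro n
    induction n with
    | zero => intro s; simp
    | succ n ih => intro s; rw [Function.iterate_succ_apply, ih, hσ, smul_smul, pow_succ]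
  funext s
  apply hι
  rw [h, hz, one_smul]
  rfl

theorem smul_eq_self_iff {U : Type*} [AddCommGroup U] [Module D.K U] {z : D.K} (hz : z ≠ 1)
    (x : U) : z • x = x ↔ x = 0 := by
  constructor
  · intro h
    have h1 : (z - 1) • x = 0 := by rw [sub_smul, one_smul, h, sub_self]
    exact (smul_eq_zero.1 h1).resolve_left (sub_ne_zero.2 hz)
  · rintro rfl
    simp

/-- The value of a sum of signs is determined by its absolute value and its residue. -/
theorem eq_neg_pow_of_modEq {S : ℤ} {q r M : ℕ} (hr : r.Prime) (hr2 : r ≠ 2) (hrq : r ∣ q + 1)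
    (hS : S ^ 2 = (q : ℤ) ^ (2 * M)) (hmod : S ≡ 1 [ZMOD r]) : S = (-(q : ℤ)) ^ M := by
  have hq : (-(q : ℤ)) ≡ 1 [ZMOD r] := by
    apply Int.ModEq.symm
    rw [Int.modEq_iff_dvd]
    have : (r : ℤ) ∣ (q : ℤ) + 1 := by exact_mod_cast hrq
    have h2 := (dvd_neg (α := ℤ)).2 this
    rwa [neg_add, ← sub_eq_add_neg] at h2
  have hqM : (-(q : ℤ)) ^ M ≡ 1 [ZMOD r] := by simpa using hq.pow M
  have h1 : S ^ 2 = ((-(q : ℤ)) ^ M) ^ 2 := by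
    rw [hS, ← pow_mul, mul_comm M 2, pow_mul, pow_mul, neg_sq]
  -- As `-q ≡ 1` modulo `r` and `r ≠ 2`, only one of the two signs is compatible with `S ≡ 1`.
  rcases sq_eq_sq_iff_eq_or_eq_neg.1 h1 with h2 | h2
  · exact h2
  · exfalso
    rw [h2] at hmod
    have h3 : -(1 : ℤ) ≡ 1 [ZMOD r] := hqM.neg.symm.trans hmod
    rw [Int.modEq_iff_dvd] at h3
    have h4 : (r : ℤ) ∣ ((2 : ℕ) : ℤ) := by simpa using h3
    exact hr2 ((Nat.prime_dvd_prime_iff_eq hr Nat.prime_two).1 (by exact_mod_cast h4))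

end FormSpace

/-! ### Gauss sums of Hermitian forms with `p = 2`, and the extension theorem. -/

section HermitianExtension

variable {D : FormSpace.{u}} {k : Type v} [Field k] {W : Type w} [AddCommGroup W] [Module k W]
  {ψ : AddChar (ZMod D.p) k} {ρ : Representation k D.E W}

theorem cocycleSum_eq_sum_sgn (hp : D.p = 2) {ψ : AddChar (ZMod D.p) k} (hψ : ψ ≠ 1) (g h : D.G)
    [Fintype (cocycleSet (D.aut g) (D.aut h))] :
    cocycleSum D.hat ψ (D.aut g) (D.aut h) = ((∑ v : cocycleSet (D.aut g) (D.aut h),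
      sgn (cocycleForm D.hat (D.aut g) (D.aut h) v) : ℤ) : k) := by
  rw [cocycleSum, finsum_eq_sum_of_fintype]
  push_cast
  exact Finset.sum_congr rfl fun v _ => char_eq_sgn hp hψ _

/-- For `p = 2` the values of `ψ` are signs, so the Gauss sum is the image of an integer `S` that
does not depend on `k` or `ψ`. Negating the form changes nothing, so the product formula gives `S²`
as an even power of `q`. Multiplication by the scalar `z` of norm one preserves the form and fixes
only the zero pair, so `S ≡ 1` modulo `r`, and this determines the sign. -/
theorem exists_cocycleSum_eq (hp : D.p = 2) (h : D.IsHermitian) :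
    ∃ q : ℕ, Nat.card D.K = q ^ 2 ∧ ∀ (ψ : AddChar (ZMod D.p) k), ψ ≠ 1 → ∀ g g' : D.G,
      cocycleSum D.hat ψ (D.aut g) (D.aut g') =
        (-(q : k)) ^ (Module.finrank D.K D.V + fixDim g + fixDim g' + fixDim (g * g')) := by
  have := Fintype.ofFinite D.V
  have hb := h.isNondeg
  obtain ⟨q, r, z, hcard, hr, hr2, hrq, hzr, hz1, hz⟩ := exists_norm_one h hp
  refine ⟨q, hcard, fun ψ hψ g g' => ?_⟩
  have := Fintype.ofFinite (cocycleSet (D.aut g) (D.aut g'))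
  set S : ℤ := ∑ v : cocycleSet (D.aut g) (D.aut g'),
    sgn (cocycleForm D.hat (D.aut g) (D.aut g') v) with hS
  have hmod : S ≡ 1 [ZMOD r] := by
    have := Fact.mk hr
    let σ : cocycleSet (D.aut g) (D.aut g') → cocycleSet (D.aut g) (D.aut g') :=
      fun v => ⟨z • v.1, smul_mem_cocycleSet z g g' v.2⟩
    refine sum_sgn_modEq σ 0 (iterate_smul Subtype.val Subtype.val_injective σ (fun _ => rfl) hzr)
      (fun y => ?_) _ (fun y => cocycleForm_smul z hz g g' y) (by simp [cocycleForm])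
    rw [Subtype.ext_iff, Subtype.ext_iff]
    exact smul_eq_self_iff hz1 y.1
  have hsq : S ^ 2 = (q : ℤ) ^
      (2 * (Module.finrank D.K D.V + fixDim g + fixDim g' + fixDim (g * g'))) := by
    -- The square of the integer `S` is computed in characteristic zero, where the twisted regular
    -- representation provides a twisted system.
    obtain ⟨χ, hχ⟩ := exists_char_of_two hp ℚ (by norm_num)
    have h1 := (isTwisted_regularOp D.hat χ).cocycleSum_mul_cocycleSum_inv hχ hb
      (hat_aut g) (hat_aut g')
    have h2 : cocycleSum D.hat χ (D.aut g').symm (D.aut g).symm = S := by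
      rw [cocycleSum_inv, ← cocycleSum_eq_sum_sgn hp hχ, cocycleSum]
      refine finsum_congr fun v => ?_
      congr 1
      exact neg_eq_of_two hp _
    rw [h2, cocycleSum_eq_sum_sgn hp hχ, ← aut_mul, fixCard_aut, fixCard_aut, fixCard_aut,
      Module.natCard_eq_pow_finrank (K := D.K) (V := D.V), hcard] at h1
    have h3 : ((S ^ 2 : ℤ) : ℚ) = ((q : ℤ) ^
      (2 * (Module.finrank D.K D.V + fixDim g + fixDim g' + fixDim (g * g'))) : ℤ) := by
      push_cast
      rw [sq, h1]
      push_cast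
      ring
    exact_mod_cast h3
  rw [cocycleSum_eq_sum_sgn hp hψ, ← hS, eq_neg_pow_of_modEq hr hr2 hrq hsq hmod]
  push_cast
  rfl

/-- With `m = dim V` and `d` the dimension of the fixed space, `γ(g, g') = (-q)^(m + d(g) + d(g') -
d(g g'))`, the coboundary of `(-q)^(m + d(g))`. The square of the latter is `|V| |fix g|`, as
invariance of forms requires. -/
theorem exists_extension_of_hermitian (hp : D.p = 2) (hD : D.IsHermitian) (h : IsWeil ψ ρ) :
    ∃ σ : Representation k D.GE W,
      (∀ s : D.E, σ (SemidirectProduct.inl s) = ρ s) ∧ Function.Injective σ ∧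
      ∀ (θ : k →+* k) (B : W →ₗ[k] W →ₛₗ[θ] k), Preserves ρ B → Preserves σ B := by
  have := Fintype.ofFinite D.V
  have hb := hD.isNondeg
  obtain ⟨q, hcard, hsum⟩ := exists_cocycleSum_eq (k := k) hp hD
  set m := Module.finrank D.K D.V with hm
  have hq : (q : k) ≠ 0 := by
    intro h0
    apply natCast_card_ne_zero (k := k) h.ne_one hb
    rw [Module.natCard_eq_pow_finrank (K := D.K) (V := D.V), hcard]
    push_cast
    rw [h0, zero_pow two_ne_zero, zero_pow (Module.finrank_pos (R := D.K) (M := D.V)).ne']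
  have hq' : -(q : k) ≠ 0 := neg_ne_zero.2 hq
  refine exists_extension_of_rescaling hb h (fun g => ((-(q : k)) ^ (m + fixDim g))⁻¹)
    (fun g => inv_ne_zero (pow_ne_zero _ hq')) (fun g g' => ?_) fun θ B hB h0 g => ?_
  · rw [hsum ψ h.ne_one, fixCard_aut, hcard]
    have e : ((((q ^ 2) ^ fixDim (g * g') : ℕ)) : k) = (-(q : k)) ^ (2 * fixDim (g * g')) := by
      push_cast
      rw [pow_mul, neg_sq]
    rw [e]
    field_simp
    ring
  · rw [fixCard_aut, Module.natCard_eq_pow_finrank (K := D.K) (V := D.V), hcard, ← hm]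
    have e : ((((q ^ 2) ^ m * (q ^ 2) ^ fixDim g : ℕ)) : k) =
        (-(q : k)) ^ (2 * (m + fixDim g)) := by
      push_cast
      rw [pow_mul, neg_sq, pow_add]
    rw [e, map_inv₀, map_pow, map_neg, map_natCast]
    field_simp
    ring

/-- Extension of the irreducible representations of `E(f̂)` to `G(f̂) ⋉ E(f̂)`. -/
theorem exists_extension [FiniteDimensional k W] (hD : D.IsAdmissible) (h : IsWeil ψ ρ) :
    ∃ σ : Representation k D.GE W,
      (∀ s : D.E, σ (SemidirectProduct.inl s) = ρ s) ∧ Function.Injective σ ∧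
      ∀ (θ : k →+* k) (B : W →ₗ[k] W →ₛₗ[θ] k), Preserves ρ B → Preserves σ B := by
  have hb := hD.isNondeg
  by_cases hp : D.p = 2
  · rcases hD with hD | ⟨W, _, _, e, hD⟩ | hD
    · exact absurd hp hD.2.1
    · exact exists_extension_of_split hb (fun x => hD.mem_ker_of_apply_ker) h
    · exact exists_extension_of_hermitian hp hD h
  · exact exists_extension_of_odd hp hb h

end HermitianExtension

/-! ### Existence of invariant forms -/

section InvariantForms

variable {p : ℕ} [Fact p.Prime] {V : Type*} [AddCommGroup V] {b : V →+ V →+ ZMod p}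
  {k : Type u} [Field k] {W : Type w} [AddCommGroup W] [Module k W]
  {ψ : AddChar (ZMod p) k} {ρ : Representation k (EGroup b) W}

/-- Sum `φ(u) θ(φ'(v))` over the translates by all `ops ρ x`; the scalars arising from `E(b)` cancel
because `θ` inverts the values of `ψ`. To make the result nonzero, choose `φ' v = 1`. Then `∑
θ(φ'(ops ρ x v)) • ops ρ x` has coefficient `1` at `0`, so it is a nonzero operator by linear
independence, and `u`, `φ` can be chosen with `B u v = 1`. -/
theorem IsWeil.exists_preserves_ne_zero [Finite V] (h : IsWeil ψ ρ) (hb : IsNondeg b) (θ : k →+* k)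
    (hθ : ∀ a, θ (ψ a) = ψ (-a)) : ∃ B : W →ₗ[k] W →ₛₗ[θ] k, Preserves ρ B ∧ B ≠ 0 := by
  have := Fintype.ofFinite V
  have := h.nontrivial
  have he := h.isTwisted
  obtain ⟨v, hv⟩ := exists_ne (0 : W)
  obtain ⟨φ', hφ'⟩ := Module.Projective.exists_dual_eq_one k hv
  have hT : ∑ x, θ (φ' (ops ρ x v)) • ops ρ x ≠ 0 := by
    intro h0
    have h1 := Fintype.linearIndependent_iff.1 (h.linearIndependent hb) _ h0 0
    rw [he.map_zero, Module.End.one_apply, hφ', map_one] at h1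
    exact one_ne_zero h1
  obtain ⟨u, hu⟩ : ∃ u, (∑ x, θ (φ' (ops ρ x v)) • ops ρ x) u ≠ 0 := by
    by_contra! h0
    exact hT (LinearMap.ext h0)
  obtain ⟨φ, hφ⟩ := Module.Projective.exists_dual_eq_one k hu
  let B : W →ₗ[k] W →ₛₗ[θ] k := LinearMap.mk₂'ₛₗ (RingHom.id k) θ
    (fun u v => ∑ x, φ (ops ρ x u) * θ (φ' (ops ρ x v)))
    (by intro u u' v; simp [add_mul, Finset.sum_add_distrib])
    (by intro c u v; simp [Finset.mul_sum, mul_assoc])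
    (by intro u v v'; simp [mul_add, Finset.sum_add_distrib])
    (by intro c u v; simp [Finset.mul_sum, mul_left_comm])
  have hB : ∀ u v, B u v = ∑ x, φ (ops ρ x u) * θ (φ' (ops ρ x v)) := fun _ _ => rfl
  refine ⟨B, fun s u v => ?_, fun h0 => ?_⟩
  · rw [hB, hB]
    refine Fintype.sum_equiv (Equiv.addRight s.x) _ _ fun x => ?_
    have h1 : ∀ w, ops ρ x (ρ s w) = ψ (s.z + b x s.x) • ops ρ (x + s.x) w := by
      intro w
      rw [h.apply_eq, LinearMap.smul_apply, map_smul, ← Module.End.mul_apply, he.map_mul,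
        LinearMap.smul_apply, smul_smul, AddChar.map_add_eq_mul]
    rw [h1, h1, map_smul, map_smul, smul_eq_mul, smul_eq_mul, map_mul, hθ, Equiv.coe_addRight,
      mul_mul_mul_comm, ← AddChar.map_add_eq_mul, add_neg_cancel, AddChar.map_zero_eq_one, one_mul]
  · have h1 : B u v = 1 := by
      rw [hB, ← hφ, LinearMap.sum_apply, map_sum]
      refine Finset.sum_congr rfl fun x _ => ?_
      rw [LinearMap.smul_apply, map_smul, smul_eq_mul, mul_comm]
    rw [h0] at h1
    exact zero_ne_one h1

theorem char_pow_eq_one (ψ : AddChar (ZMod p) k) (a : ZMod p) : ψ a ^ p = 1 := by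
  rw [← AddChar.map_nsmul_eq_pow, nsmul_eq_mul, CharP.cast_eq_zero, zero_mul,
    AddChar.map_zero_eq_one]

/-- The form `a B(u, v) + η(a B(v, u))` is Hermitian for every `a`. If it vanished for all `a`,
comparing `a = 1` with arbitrary `a` at a pair where `B` is nonzero would give `η = 1`. -/
theorem IsWeil.exists_hermitian [Finite V] (h : IsWeil ψ ρ) (hb : IsNondeg b) (η : k →+* k)
    (hη : η ≠ RingHom.id k) (hη2 : ∀ a, η (η a) = a) (hε : ∀ ε : k, ε ^ p = 1 → η ε = ε⁻¹) :
    ∃ B : W →ₗ[k] W →ₛₗ[η] k, (∀ x y, B y x = η (B x y)) ∧ B.Nondegenerate ∧ Preserves ρ B := by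
  obtain ⟨B, hB, hB0⟩ := h.exists_preserves_ne_zero hb η fun a => by
    rw [hε _ (char_pow_eq_one ψ a), AddChar.map_neg_eq_inv]
  let C : k → W →ₗ[k] W →ₛₗ[η] k := fun a => LinearMap.mk₂'ₛₗ (RingHom.id k) η
    (fun u v => a * B u v + η (a * B v u))
    (by intro u u' v; simp; ring)
    (by intro c u v; simp [hη2]; ring)
    (by intro u v v'; simp; ring)
    (by intro c u v; simp; ring)
  have hC : ∀ a u v, C a u v = a * B u v + η (a * B v u) := fun _ _ _ => rfl
  obtain ⟨a, ha⟩ : ∃ a, C a ≠ 0 := by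
    by_contra! h0
    apply hη
    have h1 : ∀ a u v, a * B u v + η a * η (B v u) = 0 := by
      intro a u v
      rw [← map_mul, ← hC, h0]
      rfl
    obtain ⟨u, hu⟩ : ∃ u, B u ≠ 0 := by
      by_contra! h
      exact hB0 (LinearMap.ext h)
    obtain ⟨v, hv⟩ : ∃ v, B u v ≠ 0 := by
      by_contra! h
      exact hu (LinearMap.ext h)
    ext a
    have h2 := h1 1 u v
    have h3 := h1 a u v
    rw [map_one, one_mul, one_mul] at h2
    apply mul_right_cancel₀ hv
    rw [RingHom.id_apply]
    linear_combination η a * h2 - h3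
  have hCp : Preserves ρ (C a) := fun s u v => by rw [hC, hC, hB, hB]
  refine ⟨C a, fun x y => ?_, h.nondegenerate hCp ha, hCp⟩
  rw [hC, hC, map_add, hη2, add_comm]

/-- Expand the square over pairs `x`, `x + t`. The exponents combine to `b t t + comm b x t`, and
the sum over `x` leaves only `t = 0`. -/
theorem sum_sgn_sq (hp : p = 2) (hb : IsNondeg b) [Fintype V] :
    (∑ x, sgn (b x x)) ^ 2 = (Nat.card V : ℤ) := by
  classical
  obtain ⟨χ, hχ⟩ := exists_char_of_two hp ℚ (by norm_num)
  have h1 : ((∑ x, sgn (b x x) : ℤ) : ℚ) = ∑ x, χ (b x x) := by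
    push_cast
    exact Finset.sum_congr rfl fun x _ => (char_eq_sgn hp hχ _).symm
  have h2 : (∑ x, χ (b x x)) ^ 2 = (Nat.card V : ℚ) := by
    rw [sq, Finset.sum_mul_sum]
    have h3 : ∀ x, ∑ y, χ (b x x) * χ (b y y) = ∑ t, χ (b t t) * χ (comm b x t) := by
      intro x
      refine (Fintype.sum_equiv (Equiv.addLeft x) _ _ fun t => ?_).symm
      rw [Equiv.coe_addLeft, ← AddChar.map_add_eq_mul, ← AddChar.map_add_eq_mul]
      congr 1
      have e1 : b x x + b x x = 0 := by
        nth_rw 1 [← neg_eq_of_two hp (b x x)]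
        exact neg_add_cancel _
      have e2 := neg_eq_of_two hp (b t x)
      simp only [comm_apply, map_add, AddMonoidHom.add_apply, sub_eq_add_neg, e2]
      rw [← add_zero (b t t + _), ← e1]
      abel
    rw [Finset.sum_congr rfl fun x _ => h3 x, Finset.sum_comm]
    simp only [← Finset.mul_sum, sum_char_comm hχ hb]
    simp
  rw [← h1] at h2
  exact_mod_cast h2

/-- If an irreducible representation preserves a nonzero symmetric form, then the quadratic form
`b(x, x)` has more zeros than ones. -/
theorem IsWeil.sum_sgn_pos [FiniteDimensional k W] [Fintype V] (h : IsWeil ψ ρ) (hp : p = 2)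
    (hb : IsNondeg b) {B : W →ₗ[k] W →ₗ[k] k} (hB : Preserves ρ B) (h0 : B ≠ 0)
    (hsymm : ∀ u v, B u v = B v u) : 0 < ∑ x, sgn (b x x) := by
  have := h.nontrivial
  have he := h.isTwisted
  set S := ∑ x, sgn (b x x) with hS
  set N := Module.finrank k W with hN
  have hSk : (S : k) = ∑ x, ψ (b x x) := by
    rw [hS]
    push_cast
    exact Finset.sum_congr rfl fun x _ => (char_eq_sgn hp h.ne_one _).symm
  have hN2 : N ^ 2 = Nat.card V := h.finrank_sq hb
  have hNk : (N : k) ≠ 0 := by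
    intro h1
    apply natCast_card_ne_zero (k := k) h.ne_one hb
    rw [← hN2, Nat.cast_pow, h1, zero_pow two_ne_zero]
  have h2V : ∀ x : V, x + x = 0 := fun x => by
    have := EGroup.nsmul_eq_zero hb x
    rwa [hp, two_nsmul] at this
  have hinv : ∀ y, tinv b ψ (ops ρ) y = ρ (⟨y, 0⟩⁻¹) := tinv_ops h.apply_eq
  -- For `T = ops ρ y` each summand is `ψ (b (x + y) (x + y))` times the inverse of `T`, which is
  -- the adjoint of `T` for `B`. So the sum is `S` times the adjoint, and this extends linearly to
  -- all `T`.
  have key1 : ∀ (T : Module.End k W) (u v : W),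
      B ((∑ x, ops ρ x * T * ops ρ x) u) v = S * B u (T v) := by
    intro T u v
    have hT : T ∈ Submodule.span k (Set.range (ops ρ)) := h.span ▸ trivial
    induction hT using Submodule.span_induction with
    | mem T hT =>
      obtain ⟨y, rfl⟩ := hT
      have h1 : ∀ x, ops ρ x * ops ρ y * ops ρ x =
          ψ (b (x + y) (x + y)) • tinv b ψ (ops ρ) y := by
        intro x
        have e1 : -y = y := neg_eq_of_add_eq_zero_left (h2V y)
        rw [he.map_mul, smul_mul_assoc, he.map_mul, tinv, smul_smul, smul_smul, e1,
          ← AddChar.map_add_eq_mul, ← AddChar.map_add_eq_mul]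
        have e2 : x + y + x = y := by rw [add_right_comm, h2V, zero_add]
        rw [e2]
        congr 2
        simp only [map_add, AddMonoidHom.add_apply]
        have e3 : b y y + b y y = 0 := by
          nth_rw 1 [← neg_eq_of_two hp (b y y)]
          exact neg_add_cancel _
        rw [← add_zero (b x y + _), ← e3]
        abel
      have h2 : ∑ x, ops ρ x * ops ρ y * ops ρ x = (S : k) • tinv b ψ (ops ρ) y := by
        rw [hSk, Finset.sum_congr rfl fun x _ => h1 x, ← Finset.sum_smul]
        congr 1
        exact Fintype.sum_equiv (Equiv.addRight y) _ _ fun x => rfl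
      rw [h2, LinearMap.smul_apply, map_smul, LinearMap.smul_apply, smul_eq_mul, hinv,
        hB.apply_left, inv_inv]
      rfl
    | zero => simp
    | add T T' _ _ h h' =>
      simp only [mul_add, add_mul, Finset.sum_add_distrib, LinearMap.add_apply, map_add] at h h' ⊢
      rw [h, h']
    | smul c T _ h =>
      simp only [mul_smul_comm, smul_mul_assoc, ← Finset.smul_sum, LinearMap.smul_apply, map_smul,
        smul_eq_mul] at h ⊢
      rw [h]
      ring
  -- The average of the rank-one operator `B(c, ·) a` is a scalar by Schur's lemma; its trace is
  -- `|V| B(c, a) = N² B(c, a)`, so the scalar is `N B(c, a)`.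
  have key2 : ∀ c a w, ∑ x, B c (ρ (⟨x, 0⟩⁻¹) w) • ops ρ x a = (N * B c a) • w := by
    intro c a w
    obtain ⟨τ, hτ⟩ := h.exists_smul (T := avg b ψ (ops ρ) ((B c).smulRight a)) fun x =>
      (he.avg_commute _ x).symm
    have h1 := congrArg (LinearMap.trace k W) hτ
    have h2 : ∀ x, LinearMap.trace k W (ops ρ x * (B c).smulRight a * tinv b ψ (ops ρ) x) =
        B c a := fun x => by
      rw [LinearMap.trace_mul_comm, ← mul_assoc, he.tinv_mul, one_mul, LinearMap.trace_smulRight]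
    rw [IsTwisted.avg_apply, map_sum, Finset.sum_congr rfl fun x _ => h2 x, map_smul,
      LinearMap.trace_one, Finset.sum_const, Finset.card_univ, ← Nat.card_eq_fintype_card,
      nsmul_eq_mul, ← hN2, smul_eq_mul, ← hN, Nat.cast_pow, sq, mul_assoc, mul_comm τ] at h1
    rw [mul_left_cancel₀ hNk h1, ← Module.End.one_apply (R := k) w, ← LinearMap.smul_apply, ← hτ,
      IsTwisted.avg_apply, LinearMap.sum_apply]
    refine Finset.sum_congr rfl fun x _ => ?_
    rw [hinv]
    simp
  obtain ⟨c, v, hcv⟩ : ∃ c v, B c v ≠ 0 := by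
    by_contra! h1
    exact h0 (LinearMap.ext fun c => LinearMap.ext (h1 c))
  -- Apply both evaluations to `T = B(c, ·) v`. Symmetry of `B` is what converts `ops ρ x` into its
  -- inverse inside `B(c, ·)`, so that `key1` and `key2` concern the same sum.
  have hSN : (S : k) = (N : k) := by
    have h1 := key1 ((B c).smulRight v) c v
    have h2 : (∑ x, ops ρ x * (B c).smulRight v * ops ρ x) c = (N * B c v) • c := by
      rw [← key2, LinearMap.sum_apply]
      refine Finset.sum_congr rfl fun x _ => ?_
      rw [← hB.apply_left, hsymm]
      simp [ops]
    rw [h2] at h1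
    simp only [map_smul, LinearMap.smul_apply, smul_eq_mul, LinearMap.smulRight_apply] at h1
    apply mul_right_cancel₀ (mul_ne_zero hcv hcv)
    linear_combination -h1
  have hS2 : S ^ 2 = (N : ℤ) ^ 2 := by
    rw [sum_sgn_sq hp hb, ← hN2]
    push_cast
    rfl
  have hN0 : (0 : ℤ) < N := by
    rw [Nat.cast_pos]
    exact Module.finrank_pos
  -- The integer `S` is `N` or `-N`. The second is impossible because `S = N` in `k`, where `2` and
  -- `N` are nonzero.
  rcases sq_eq_sq_iff_eq_or_eq_neg.1 hS2 with h1 | h1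
  · rw [h1]
    exact hN0
  · exfalso
    rw [h1] at hSN
    push_cast at hSN
    have h2 : (2 : k) ≠ 0 := by
      have := natCast_prime_ne_zero h.ne_one
      rw [hp] at this
      exact_mod_cast this
    apply mul_ne_zero h2 hNk
    linear_combination -hSN

/-- In characteristic different from two, `E(b)` for `p = 2` preserves a symplectic form, unless
the quadratic form `b(x, x)` has more zeros than ones. -/
theorem IsWeil.exists_alternating [FiniteDimensional k W] [Fintype V] (h : IsWeil ψ ρ) (hp : p = 2)
    (hb : IsNondeg b) (hS : ¬ 0 < ∑ x, sgn (b x x)) :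
    ∃ B : W →ₗ[k] W →ₗ[k] k, B.IsAlt ∧ B.Nondegenerate ∧ Preserves ρ B := by
  obtain ⟨B, hB, hB0⟩ := h.exists_preserves_ne_zero hb (RingHom.id k) fun a => by
    rw [neg_eq_of_two hp]
    rfl
  have hne : B - B.flip ≠ 0 := fun h0 => hS <| h.sum_sgn_pos hp hb hB hB0 fun u v => by
    have := LinearMap.congr_fun₂ h0 u v
    simpa [sub_eq_zero] using this
  have hpr : Preserves ρ (B - B.flip) := fun s u v => by
    simp only [LinearMap.sub_apply, LinearMap.flip_apply, hB s]
  exact ⟨B - B.flip, fun u => by simp, h.nondegenerate hpr hne, hpr⟩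

end InvariantForms

/-! ### Symplectic families -/

section Families

variable {p : ℕ} [Fact p.Prime] {V : Type*} [AddCommGroup V] {b : V →+ V →+ ZMod p}

/-- `V` carries only its additive structure here, so combinations over `𝔽_p` are written below with
integer lifts of the coefficients. -/
theorem comm_zsmul_left (m : ℤ) (x y : V) : comm b (m • x) y = m * comm b x y := by
  rw [map_zsmul, AddMonoidHom.zsmul_apply, zsmul_eq_mul]

theorem comm_zsmul_right (m : ℤ) (x y : V) : comm b x (m • y) = m * comm b x y := by
  rw [map_zsmul, zsmul_eq_mul]

theorem comm_add_left (x y z : V) : comm b (x + y) z = comm b x z + comm b y z := by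
  rw [map_add, AddMonoidHom.add_apply]

theorem comm_add_right (x y z : V) : comm b x (y + z) = comm b x y + comm b x z := by
  rw [map_add]

theorem zsmul_eq_zero_of_intCast (hb : IsNondeg b) {m : ℤ} (hm : (m : ZMod p) = 0) (x : V) :
    m • x = 0 := by
  refine hb _ fun y => ?_
  rw [comm_zsmul_left, hm, zero_mul]

/-- The vectors orthogonal to `u` and `v`. -/
def perp (b : V →+ V →+ ZMod p) (u v : V) : AddSubgroup V :=
  (comm b u).ker ⊓ (comm b v).ker

theorem mem_perp {u v x : V} : x ∈ perp b u v ↔ comm b u x = 0 ∧ comm b v x = 0 := Iff.rfl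

/-- A symplectic basis of `V`. -/
structure IsSymplectic (b : V →+ V →+ ZMod p) {n : ℕ} (u v : Fin n → V) : Prop where
  left_right : ∀ i j, comm b (u i) (v j) = if i = j then 1 else 0
  left_left : ∀ i j, comm b (u i) (u j) = 0
  right_right : ∀ i j, comm b (v i) (v j) = 0
  eq_zero : ∀ x, (∀ i, x ∈ perp b (u i) (v i)) → x = 0

/-- Symplectic bases are obtained by splitting off hyperbolic planes repeatedly. -/
theorem exists_isSymplectic [Finite V] (R : V → V → Prop) (good : AddSubgroup V → Prop)
    (step : ∀ U, good U → U ≠ ⊥ → ∃ u ∈ U, ∃ v ∈ U, comm b u v = 1 ∧ R u v ∧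
      good (U ⊓ perp b u v)) (htop : good ⊤) :
    ∃ (n : ℕ) (u v : Fin n → V), IsSymplectic b u v ∧ ∀ i, R (u i) (v i) := by
  -- Induction on the order of `U`. `good` is the property inherited by the part of `U` orthogonal
  -- to the chosen pair, and `R` is the condition imposed on each pair.
  suffices H : ∀ (N : ℕ) (U : AddSubgroup V), Nat.card U = N → good U →
      ∃ (n : ℕ) (u v : Fin n → V), (∀ i, u i ∈ U) ∧ (∀ i, v i ∈ U) ∧
        (∀ i j, comm b (u i) (v j) = if i = j then 1 else 0) ∧
        (∀ i j, comm b (u i) (u j) = 0) ∧ (∀ i j, comm b (v i) (v j) = 0) ∧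
        (∀ x ∈ U, (∀ i, x ∈ perp b (u i) (v i)) → x = 0) ∧ ∀ i, R (u i) (v i) by
    obtain ⟨n, u, v, -, -, h1, h2, h3, h4, h5⟩ := H _ ⊤ rfl htop
    exact ⟨n, u, v, ⟨h1, h2, h3, fun x => h4 x trivial⟩, h5⟩
  intro N
  induction N using Nat.strong_induction_on with
  | _ N ih =>
    intro U hN hU
    by_cases hbot : U = ⊥
    · exact ⟨0, Fin.elim0, Fin.elim0, fun i => i.elim0, fun i => i.elim0, fun i => i.elim0,
        fun i => i.elim0, fun i => i.elim0, fun x hx _ => by rwa [hbot] at hx, fun i => i.elim0⟩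
    obtain ⟨u, hu, v, hv, huv, hR, hgood⟩ := step U hU hbot
    have hlt : U ⊓ perp b u v < U := by
      refine inf_le_left.lt_of_ne fun h => ?_
      have h1 : v ∈ U ⊓ perp b u v := by rwa [h]
      have h2 := (mem_perp.1 h1.2).1
      rw [huv] at h2
      exact one_ne_zero h2
    have hcard : Nat.card (U ⊓ perp b u v : AddSubgroup V) < N := by
      rw [← hN]
      exact Set.Finite.card_lt_card (Set.toFinite _) hlt
    obtain ⟨n, u', v', h1, h2, h3, h4, h5, h6, h7⟩ := ih _ hcard _ rfl hgood
    have o1 : ∀ i, comm b u (u' i) = 0 := fun i => (mem_perp.1 (h1 i).2).1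
    have o2 : ∀ i, comm b v (u' i) = 0 := fun i => (mem_perp.1 (h1 i).2).2
    have o3 : ∀ i, comm b u (v' i) = 0 := fun i => (mem_perp.1 (h2 i).2).1
    have o4 : ∀ i, comm b v (v' i) = 0 := fun i => (mem_perp.1 (h2 i).2).2
    refine ⟨n + 1, Fin.cons u u', Fin.cons v v', Fin.cases hu fun i => (h1 i).1,
      Fin.cases hv fun i => (h2 i).1, ?_, ?_, ?_, ?_, Fin.cases hR h7⟩
    · refine Fin.cases (Fin.cases ?_ fun j => ?_) fun i => Fin.cases ?_ fun j => ?_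
      · rw [Fin.cons_zero, Fin.cons_zero, huv, if_pos rfl]
      · rw [Fin.cons_zero, Fin.cons_succ, o3, if_neg (Fin.succ_ne_zero j).symm]
      · rw [Fin.cons_zero, Fin.cons_succ, comm_swap, o2, neg_zero, if_neg (Fin.succ_ne_zero i)]
      · simp only [Fin.cons_succ, h3, Fin.succ_inj]
    · refine Fin.cases (Fin.cases ?_ fun j => ?_) fun i => Fin.cases ?_ fun j => ?_
      · rw [Fin.cons_zero, comm_self]
      · rw [Fin.cons_zero, Fin.cons_succ, o1]
      · rw [Fin.cons_zero, Fin.cons_succ, comm_swap, o1, neg_zero]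
      · simp only [Fin.cons_succ, h4]
    · refine Fin.cases (Fin.cases ?_ fun j => ?_) fun i => Fin.cases ?_ fun j => ?_
      · rw [Fin.cons_zero, comm_self]
      · rw [Fin.cons_zero, Fin.cons_succ, o4]
      · rw [Fin.cons_zero, Fin.cons_succ, comm_swap, o4, neg_zero]
      · simp only [Fin.cons_succ, h5]
    · intro x hx h
      exact h6 x ⟨hx, h 0⟩ fun i => h i.succ

/-- The form is nondegenerate on `U`. -/
def IsNondegOn (b : V →+ V →+ ZMod p) (U : AddSubgroup V) : Prop :=
  ∀ x ∈ U, (∀ y ∈ U, comm b x y = 0) → x = 0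

/-- The component of `x` orthogonal to the hyperbolic pair `u`, `v`. -/
def perpPart (b : V →+ V →+ ZMod p) (u v x : V) : V :=
  x - ((comm b x v).cast : ℤ) • u + ((comm b x u).cast : ℤ) • v

theorem comm_perpPart (u v x y : V) :
    comm b y (perpPart b u v x) =
      comm b y x - comm b x v * comm b y u + comm b x u * comm b y v := by
  rw [perpPart, map_add, map_sub, comm_zsmul_right, comm_zsmul_right, ZMod.intCast_zmod_cast,
    ZMod.intCast_zmod_cast]

theorem perpPart_mem_perp {u v : V} (huv : comm b u v = 1) (x : V) :
    perpPart b u v x ∈ perp b u v := by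
  have hvu : comm b v u = -1 := by rw [comm_swap, huv]
  rw [mem_perp, comm_perpPart, comm_perpPart, comm_self, comm_self, huv, hvu, comm_swap b x u,
    comm_swap b x v]
  constructor <;> ring

theorem perpPart_mem {U : AddSubgroup V} {u v x : V} (hu : u ∈ U) (hv : v ∈ U) (hx : x ∈ U) :
    perpPart b u v x ∈ U :=
  U.add_mem (U.sub_mem hx (U.zsmul_mem hu _)) (U.zsmul_mem hv _)

theorem IsNondegOn.inf_perp {U : AddSubgroup V} (hU : IsNondegOn b U) {u v : V} (hu : u ∈ U)
    (hv : v ∈ U) (huv : comm b u v = 1) : IsNondegOn b (U ⊓ perp b u v) := by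
  intro x hx h
  refine hU x hx.1 fun y hy => ?_
  have h1 := h _ ⟨perpPart_mem hu hv hy, perpPart_mem_perp huv y⟩
  obtain ⟨h2, h3⟩ := mem_perp.1 hx.2
  rwa [comm_perpPart, comm_swap b u x, comm_swap b v x, h2, h3, neg_zero, mul_zero, mul_zero,
    sub_zero, add_zero] at h1

theorem IsNondegOn.exists_pair {U : AddSubgroup V} (hU : IsNondegOn b U) {u : V} (hu : u ∈ U)
    (h0 : u ≠ 0) : ∃ v ∈ U, comm b u v = 1 := by
  obtain ⟨v, hv, huv⟩ : ∃ v ∈ U, comm b u v ≠ 0 := by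
    by_contra! h
    exact h0 (hU u hu h)
  refine ⟨((comm b u v)⁻¹.cast : ℤ) • v, U.zsmul_mem hv _, ?_⟩
  rw [comm_zsmul_right, ZMod.intCast_zmod_cast, inv_mul_cancel₀ huv]

theorem IsNondeg.isNondegOn_top (hb : IsNondeg b) : IsNondegOn b ⊤ :=
  fun x _ h => hb x fun y => h y trivial

theorem IsNondeg.exists_isSymplectic [Finite V] (hb : IsNondeg b) :
    ∃ (n : ℕ) (u v : Fin n → V), IsSymplectic b u v := by
  obtain ⟨n, u, v, h, -⟩ := WeilTower.exists_isSymplectic (b := b) (fun _ _ => True) (IsNondegOn b)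
    (fun U hU hbot => by
      obtain ⟨u, hu, hu0⟩ := U.bot_or_exists_ne_zero.resolve_left hbot
      obtain ⟨v, hv, huv⟩ := hU.exists_pair hu hu0
      exact ⟨u, hu, v, hv, huv, trivial, hU.inf_perp hu hv huv⟩) hb.isNondegOn_top
  exact ⟨n, u, v, h⟩

namespace IsSymplectic

variable {n : ℕ} {u v : Fin n → V}

theorem right_left (h : IsSymplectic b u v) (i j : Fin n) :
    comm b (v i) (u j) = if i = j then -1 else 0 := by
  rw [comm_swap, h.left_right]
  simp only [eq_comm (a := j)]
  split_ifs <;> simp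

/-- The vector with given coordinates. -/
def vec (u v : Fin n → V) (c : Fin n → ZMod p × ZMod p) : V :=
  ∑ i, (((c i).1.cast : ℤ) • u i + ((c i).2.cast : ℤ) • v i)

theorem comm_vec_left (h : IsSymplectic b u v) (c : Fin n → ZMod p × ZMod p) (i : Fin n) :
    comm b (u i) (vec u v c) = (c i).2 := by
  rw [vec, map_sum]
  simp [map_add, comm_zsmul_right, h.left_left, h.left_right, -comm_apply]

theorem comm_vec_right (h : IsSymplectic b u v) (c : Fin n → ZMod p × ZMod p) (i : Fin n) :
    comm b (v i) (vec u v c) = -(c i).1 := by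
  rw [vec, map_sum]
  simp [map_add, comm_zsmul_right, h.right_right, h.right_left, -comm_apply]

theorem vec_coords (h : IsSymplectic b u v) (x : V) :
    vec u v (fun i => (-comm b (v i) x, comm b (u i) x)) = x := by
  rw [← sub_eq_zero]
  refine h.eq_zero _ fun i => ?_
  rw [mem_perp, map_sub, map_sub, h.comm_vec_left, h.comm_vec_right]
  simp

/-- Coordinates with respect to a symplectic basis. -/
def equiv (h : IsSymplectic b u v) : V ≃ (Fin n → ZMod p × ZMod p) where
  toFun x i := (-comm b (v i) x, comm b (u i) x)
  invFun := vec u v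
  left_inv := h.vec_coords
  right_inv c := by
    funext i
    beta_reduce
    rw [h.comm_vec_left, h.comm_vec_right, neg_neg]

theorem card_eq (h : IsSymplectic b u v) : Nat.card V = p ^ (2 * n) := by
  rw [Nat.card_congr h.equiv, Nat.card_fun, Nat.card_prod, Nat.card_zmod, Nat.card_fin, pow_mul, sq]

end IsSymplectic

/-! ### Central products -/

/-- The subgroup of `E(b)` that lies over the span of `u` and `v`. -/
def plane (b : V →+ V →+ ZMod p) (u v : V) : Subgroup (EGroup b) :=
  (AddSubgroup.toSubgroup (AddSubgroup.closure {u, v})).comap (EGroup.proj b)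

theorem mem_plane {u v : V} {s : EGroup b} :
    s ∈ plane b u v ↔ ∃ m n : ℤ, m • u + n • v = s.x :=
  AddSubgroup.mem_closure_pair

/-- Distinct planes are orthogonal, so the subgroups over them commute; each contains the base, and
together they cover `V`. A central element of one subgroup is orthogonal to its own pair and to all
the others, so its `V`-component vanishes. -/
theorem IsSymplectic.isCentralProduct [Nontrivial V] (hb : IsNondeg b) {n : ℕ} {u v : Fin n → V}
    (h : IsSymplectic b u v) : IsCentralProduct fun i => plane b (u i) (v i) := by
  have hcomm : ∀ i j, i ≠ j → ∀ s ∈ plane b (u i) (v i), ∀ t ∈ plane b (u j) (v j),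
      comm b s.x t.x = 0 := by
    intro i j hij s hs t ht
    obtain ⟨m, n, hs⟩ := mem_plane.1 hs
    obtain ⟨m', n', ht⟩ := mem_plane.1 ht
    rw [← hs, ← ht]
    simp only [comm_add_left, comm_add_right, comm_zsmul_left, comm_zsmul_right, h.left_left,
      h.left_right, h.right_left, h.right_right, if_neg hij]
    ring
  have hu : ∀ i, (⟨u i, 0⟩ : EGroup b) ∈ plane b (u i) (v i) := fun i =>
    mem_plane.2 ⟨1, 0, by simp⟩
  have hv : ∀ i, (⟨v i, 0⟩ : EGroup b) ∈ plane b (u i) (v i) := fun i =>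
    mem_plane.2 ⟨0, 1, by simp⟩
  have hbase : ∀ i, EGroup.base b ≤ plane b (u i) (v i) := fun i s hs => by
    rw [EGroup.mem_base] at hs
    exact mem_plane.2 ⟨0, 0, by simp [hs]⟩
  refine ⟨fun i j hij s hs t ht => (EGroup.commute_iff s t).2 (hcomm i j hij s hs t ht), ?_, ?_⟩
  · rw [eq_top_iff]
    set T := ⨆ i, plane b (u i) (v i) with hT
    have hle : ∀ i, plane b (u i) (v i) ≤ T := le_iSup _
    have hTb : EGroup.base b ≤ T := by
      obtain ⟨x, hx⟩ := exists_ne (0 : V)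
      -- The base is reached only if there is at least one plane; `V ≠ 0` excludes the empty family.
      rcases n with _ | n
      · exact absurd (h.eq_zero x fun i => i.elim0) hx
      · exact (hbase 0).trans (hle 0)
    let A : AddSubgroup V := Subgroup.toAddSubgroup' (T.map (EGroup.proj b))
    have hA : ∀ s ∈ T, s.x ∈ A := fun s hs => ⟨s, hs, rfl⟩
    intro s _
    have hs : s.x ∈ A := by
      rw [← h.vec_coords s.x]
      exact AddSubgroup.sum_mem _ fun i _ => A.add_mem (A.zsmul_mem (hA _ (hle i (hu i))) _)
        (A.zsmul_mem (hA _ (hle i (hv i))) _)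
    obtain ⟨t, ht, hts⟩ := hs
    have hx : t.x = s.x := hts
    have h1 : t⁻¹ * s ∈ T := hTb (by simp [hx])
    simpa using T.mul_mem ht h1
  · intro i
    rw [EGroup.center_eq hb]
    ext s
    rw [EGroup.mem_base]
    constructor
    · rintro ⟨s, hs, rfl⟩
      refine h.eq_zero _ fun j => ?_
      rw [mem_perp]
      by_cases hij : j = i
      · subst hij
        rw [SetLike.mem_coe, Subgroup.mem_center_iff] at hs
        exact ⟨(EGroup.commute_iff _ _).1 (congrArg Subtype.val (hs ⟨_, hu j⟩)),
          (EGroup.commute_iff _ _).1 (congrArg Subtype.val (hs ⟨_, hv j⟩))⟩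
      · exact ⟨hcomm j i hij _ (hu j) _ s.2, hcomm j i hij _ (hv j) _ s.2⟩
    · intro hs
      refine ⟨⟨s, hbase i (EGroup.mem_base.2 hs)⟩, ?_, rfl⟩
      rw [SetLike.mem_coe, Subgroup.mem_center_iff]
      intro t
      apply Subtype.ext
      exact (EGroup.commute_iff t.1 s).2 (by rw [hs, map_zero])

/-- Coordinates on `plane b u v`. -/
def planeEquiv (hb : IsNondeg b) {u v : V} (huv : comm b u v = 1) :
    plane b u v ≃ (ZMod p × ZMod p) × ZMod p where
  toFun s := ((-comm b v s.1.x, comm b u s.1.x), s.1.z)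
  invFun c := ⟨⟨(c.1.1.cast : ℤ) • u + (c.1.2.cast : ℤ) • v, c.2⟩, mem_plane.2 ⟨_, _, rfl⟩⟩
  left_inv s := by
    obtain ⟨⟨x, z⟩, hs⟩ := s
    obtain ⟨m, n, hmn⟩ : ∃ m n : ℤ, m • u + n • v = x := mem_plane.1 hs
    refine Subtype.ext (EGroup.ext ?_ rfl)
    have hvu : comm b v u = -1 := by rw [comm_swap, huv]
    have e1 : comm b v x = -m := by
      rw [← hmn, comm_add_right, comm_zsmul_right, comm_zsmul_right, comm_self, hvu]
      ring
    have e2 : comm b u x = n := by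
      rw [← hmn, comm_add_right, comm_zsmul_right, comm_zsmul_right, comm_self, huv]
      ring
    change ((-comm b v x).cast : ℤ) • u + ((comm b u x).cast : ℤ) • v = x
    rw [← sub_eq_zero, e1, e2, neg_neg]
    conv_lhs => rw [← hmn]
    rw [add_sub_add_comm, ← sub_smul, ← sub_smul, zsmul_eq_zero_of_intCast hb (by simp),
      zsmul_eq_zero_of_intCast hb (by simp), add_zero]
  right_inv c := by
    have hvu : comm b v u = -1 := by rw [comm_swap, huv]
    refine Prod.ext (Prod.ext ?_ ?_) rfl
    · change -comm b v ((c.1.1.cast : ℤ) • u + (c.1.2.cast : ℤ) • v) = c.1.1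
      rw [comm_add_right, comm_zsmul_right, comm_zsmul_right, comm_self, hvu,
        ZMod.intCast_zmod_cast]
      ring
    · change comm b u ((c.1.1.cast : ℤ) • u + (c.1.2.cast : ℤ) • v) = c.1.2
      rw [comm_add_right, comm_zsmul_right, comm_zsmul_right, comm_self, huv,
        ZMod.intCast_zmod_cast, ZMod.intCast_zmod_cast]
      ring

theorem card_plane (hb : IsNondeg b) {u v : V} (huv : comm b u v = 1) :
    Nat.card (plane b u v) = p ^ 3 := by
  rw [Nat.card_congr (planeEquiv hb huv), Nat.card_prod, Nat.card_prod, Nat.card_zmod]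
  ring

end Families

/-! ### Recognition of dihedral and quaternion groups -/

section Recognition

variable {H : Type*} [Group H]

/-- The powers of `c` are indexed by `ZMod n` to match the constructors of `DihedralGroup` and
`QuaternionGroup`. -/
theorem exists_zmod_pow {n : ℕ} {c : H} (hc : orderOf c = n) :
    ∃ e : ZMod n → H, (∀ i j, e (i + j) = e i * e j) ∧ (∀ m : ℤ, e m = c ^ m) ∧
      ∀ i, e i = 1 → i = 0 := by
  have hn : zmultiplesHom (Additive H) (Additive.ofMul c) n = 0 := by
    rw [zmultiplesHom_apply, ← ofMul_zpow, zpow_natCast, ← hc, pow_orderOf_eq_one]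
    rfl
  let e : ZMod n →+ Additive H := ZMod.lift n ⟨zmultiplesHom (Additive H) (Additive.ofMul c), hn⟩
  have he : ∀ m : ℤ, (e m).toMul = c ^ m := fun m => by
    rw [ZMod.lift_coe, zmultiplesHom_apply]
    rfl
  refine ⟨fun i => (e i).toMul, fun i j => congrArg Additive.toMul (map_add e i j), he,
    fun i hi => ?_⟩
  obtain ⟨m, rfl⟩ := ZMod.intCast_surjective i
  beta_reduce at hi
  rw [he, ← orderOf_dvd_iff_zpow_eq_one, hc] at hi
  exact (ZMod.intCast_zmod_eq_zero_iff_dvd m n).2 hi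

theorem zpow_mul_comm_of_inv {c d : H} (hdc : c * d = d * c⁻¹) (m : ℤ) :
    c ^ m * d = d * c ^ (-m) := by
  have h : SemiconjBy d c⁻¹ c := hdc.symm
  rw [zpow_neg, ← inv_zpow]
  exact ((h.zpow_right m).eq).symm

theorem nonempty_mulEquiv_dihedral {n : ℕ} [NeZero n] {c d : H} (hc : orderOf c = n)
    (hd : d * d = 1) (hdc : c * d = d * c⁻¹) (hne : ∀ m : ℤ, d ≠ c ^ m)
    (hcard : Nat.card H = 2 * n) : Nonempty (H ≃* DihedralGroup n) := by
  obtain ⟨e, hadd, hint, hinj⟩ := exists_zmod_pow hc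
  have hcomm : ∀ i, e i * d = d * e (-i) := fun i => by
    obtain ⟨m, rfl⟩ := ZMod.intCast_surjective i
    rw [hint, zpow_mul_comm_of_inv hdc, ← Int.cast_neg, hint]
  have he0 : e 0 = 1 := by
    have := hint 0
    rwa [Int.cast_zero, zpow_zero] at this
  let φ : DihedralGroup n →* H := MonoidHom.mk'
    (fun g => match g with
      | .r i => e i
      | .sr i => d * e i) (by
    rintro (i | i) (j | j)
    · exact hadd i j
    · change d * e (j - i) = e i * (d * e j)
      rw [← mul_assoc, hcomm, mul_assoc, ← hadd, neg_add_eq_sub]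
    · change d * e (i + j) = d * e i * e j
      rw [hadd, mul_assoc]
    · change e (j - i) = d * e i * (d * e j)
      rw [mul_assoc, ← mul_assoc (e i), hcomm, mul_assoc, ← mul_assoc, hd, one_mul, ← hadd,
        neg_add_eq_sub])
  have hφ : Function.Injective φ := by
    rw [injective_iff_map_eq_one]
    rintro (i | i) hi
    · rw [hinj i hi]
      rfl
    · exfalso
      have h1 : d * e i = 1 := hi
      obtain ⟨m, rfl⟩ := ZMod.intCast_surjective i
      rw [hint] at h1
      exact hne (-m) (by rw [zpow_neg, eq_inv_of_mul_eq_one_left h1])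
  have : Finite H := Nat.finite_of_card_ne_zero (by rw [hcard]; simp [NeZero.ne n])
  have hb : Function.Bijective φ :=
    (Nat.bijective_iff_injective_and_card φ).2 ⟨hφ, by rw [hcard, DihedralGroup.nat_card]⟩
  exact ⟨(MulEquiv.ofBijective φ hb).symm⟩

theorem nonempty_mulEquiv_quaternion {n : ℕ} [NeZero n] {c d : H} (hc : orderOf c = 2 * n)
    (hd : d * d = c ^ n) (hdc : c * d = d * c⁻¹) (hne : ∀ m : ℤ, d ≠ c ^ m)
    (hcard : Nat.card H = 4 * n) : Nonempty (H ≃* QuaternionGroup n) := by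
  obtain ⟨e, hadd, hint, hinj⟩ := exists_zmod_pow hc
  have hcomm : ∀ i, e i * d = d * e (-i) := fun i => by
    obtain ⟨m, rfl⟩ := ZMod.intCast_surjective i
    rw [hint, zpow_mul_comm_of_inv hdc, ← Int.cast_neg, hint]
  have hen : e n = c ^ n := by
    have := hint n
    rwa [Int.cast_natCast, zpow_natCast] at this
  let φ : QuaternionGroup n →* H := MonoidHom.mk'
    (fun g => match g with
      | .a i => e i
      | .xa i => d * e i) (by
    rintro (i | i) (j | j)
    · exact hadd i j
    · change d * e (j - i) = e i * (d * e j)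
      rw [← mul_assoc, hcomm, mul_assoc, ← hadd, neg_add_eq_sub]
    · change d * e (i + j) = d * e i * e j
      rw [hadd, mul_assoc]
    · change e (n + j - i) = d * e i * (d * e j)
      rw [mul_assoc, ← mul_assoc (e i), hcomm, mul_assoc, ← mul_assoc, hd, ← hen, ← hadd, ← hadd,
        neg_add_eq_sub, add_sub_assoc])
  have hφ : Function.Injective φ := by
    rw [injective_iff_map_eq_one]
    rintro (i | i) hi
    · rw [hinj i hi]
      rfl
    · exfalso
      have h1 : d * e i = 1 := hi
      obtain ⟨m, rfl⟩ := ZMod.intCast_surjective i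
      rw [hint] at h1
      exact hne (-m) (by rw [zpow_neg, eq_inv_of_mul_eq_one_left h1])
  have : Finite H := Nat.finite_of_card_ne_zero (by rw [hcard]; simp [NeZero.ne n])
  have hb : Function.Bijective φ := (Nat.bijective_iff_injective_and_card φ).2
    ⟨hφ, by rw [hcard, Nat.card_eq_fintype_card, QuaternionGroup.card]⟩
  exact ⟨(MulEquiv.ofBijective φ hb).symm⟩

/-- Generation by two involutions is wanted because involutions in `E(b)` have singular
`V`-component when `p = 2`. -/
theorem DihedralGroup.mem_closure_reflections {n : ℕ} [NeZero n] (g : DihedralGroup n) :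
    g ∈ Subgroup.closure {DihedralGroup.sr 0, DihedralGroup.sr 1} := by
  have h0 : DihedralGroup.sr (0 : ZMod n) ∈
      Subgroup.closure {DihedralGroup.sr (0 : ZMod n), DihedralGroup.sr 1} :=
    Subgroup.subset_closure (by simp)
  have h1 : DihedralGroup.r (1 : ZMod n) ∈
      Subgroup.closure {DihedralGroup.sr (0 : ZMod n), DihedralGroup.sr 1} := by
    have h2 := Subgroup.mul_mem _ h0 (Subgroup.subset_closure
      (show DihedralGroup.sr (1 : ZMod n) ∈ {DihedralGroup.sr (0 : ZMod n), DihedralGroup.sr 1} by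
        simp))
    rwa [DihedralGroup.sr_mul_sr, sub_zero] at h2
  have hr : ∀ i : ZMod n, DihedralGroup.r i ∈
      Subgroup.closure {DihedralGroup.sr (0 : ZMod n), DihedralGroup.sr 1} := fun i => by
    have h2 := Subgroup.pow_mem _ h1 i.val
    rwa [DihedralGroup.r_one_pow, ZMod.natCast_zmod_val] at h2
  rcases g with i | i
  · exact hr i
  · have h2 := Subgroup.mul_mem _ h0 (hr i)
    rwa [DihedralGroup.sr_mul_r, zero_add] at h2

end Recognition

/-! ### The structure of `E(b)` -/

section Structure

variable {p : ℕ} [Fact p.Prime] {V : Type*} [AddCommGroup V] {b : V →+ V →+ ZMod p}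

theorem IsSymplectic.left_right_self {n : ℕ} {u v : Fin n → V} (h : IsSymplectic b u v)
    (i : Fin n) : comm b (u i) (v i) = 1 := by
  rw [h.left_right, if_pos rfl]

theorem EGroup.zpow_x (s : EGroup b) (m : ℤ) : (s ^ m).x = m • s.x :=
  congrArg Multiplicative.toAdd (map_zpow (EGroup.proj b) s m)

/-- For `p = 2` the map `x ↦ b x x`, which describes squaring in `E(b)`, is a quadratic form with
polar form `comm b`. -/
theorem quad_add (hp : p = 2) (x y : V) : b (x + y) (x + y) = b x x + b y y + comm b x y := by
  have h := neg_eq_of_two hp (b y x)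
  rw [comm_apply, sub_eq_add_neg, h]
  simp only [map_add, AddMonoidHom.add_apply]
  abel

theorem add_self_of_two (hp : p = 2) (a : ZMod p) : a + a = 0 := by
  nth_rw 1 [← neg_eq_of_two hp a]
  exact neg_add_cancel a

theorem eq_one_of_ne_zero (hp : p = 2) {a : ZMod p} (ha : a ≠ 0) : a = 1 := by
  subst hp
  have h : ∀ a : Fin 2, a ≠ 0 → a = 1 := by decide
  exact h a ha

theorem vec_add_self (hp : p = 2) (hb : IsNondeg b) (x : V) : x + x = 0 := by
  have := EGroup.nsmul_eq_zero hb x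
  rwa [hp, two_nsmul] at this

/-- `(u, 0)` is an involution, and `(u + v, 0)` has order four because `b (u + v) (u + v) = comm b u
v = 1`; the former inverts the latter. -/
theorem plane_mulEquiv_dihedral (hp : p = 2) (hb : IsNondeg b) {u v : V} (huv : comm b u v = 1)
    (hu : b u u = 0) (hv : b v v = 0) : Nonempty (plane b u v ≃* DihedralGroup 4) := by
  have hvu : comm b v u = 1 := by rw [comm_swap, neg_eq_of_two hp, huv]
  have h2 := vec_add_self hp hb
  have hz := add_self_of_two hp
  have hq : b (u + v) (u + v) = 1 := by rw [quad_add hp, hu, hv, huv, zero_add, zero_add]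
  let c : EGroup b := ⟨u + v, 0⟩
  let d : EGroup b := ⟨u, 0⟩
  have hc : c ∈ plane b u v := mem_plane.2 ⟨1, 1, by simp [c]⟩
  have hd : d ∈ plane b u v := mem_plane.2 ⟨1, 0, by simp [d]⟩
  have hc2 : c * c = ⟨0, 1⟩ := by
    ext
    · exact h2 _
    · simp [c, -map_add, hq]
  have hord : orderOf (⟨c, hc⟩ : plane b u v) = 2 ^ (1 + 1) := by
    refine orderOf_eq_prime_pow ?_ ?_
    · intro h
      have h1 := congrArg (fun s => s.1.z) h
      change (c ^ 2 ^ 1).z = 0 at h1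
      rw [pow_one, sq, hc2] at h1
      exact one_ne_zero h1
    · apply Subtype.ext
      change c ^ (2 ^ 2) = 1
      rw [show 2 ^ 2 = 2 * 2 by norm_num, pow_mul, sq c, hc2, sq]
      ext
      · simp
      · simpa using hz 1
  refine nonempty_mulEquiv_dihedral (c := ⟨c, hc⟩) (d := ⟨d, hd⟩) hord ?_ ?_ ?_ ?_
  · apply Subtype.ext
    change d * d = 1
    ext
    · exact h2 u
    · simp [d, hu]
  · apply Subtype.ext
    change c * d = d * c⁻¹
    ext
    · change u + v + u = u + -(u + v)
      rw [neg_eq_of_add_eq_zero_left (h2 (u + v)), add_comm]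
    · simp only [c, d, EGroup.mul_z, EGroup.inv_z, EGroup.inv_x, hq]
      have h3 : b u v = 1 + b v u := by rw [← huv, comm_apply, sub_add_cancel]
      simp only [map_add, map_neg, AddMonoidHom.add_apply, hu, h3]
      simp only [zero_add, add_zero, neg_eq_of_two hp]
      rw [← add_assoc, hz, zero_add]
  · intro m h
    have h1 : u = m • (u + v) := by
      have h3 := congrArg (fun s => s.1.x) h
      change d.x = (c ^ m).x at h3
      rwa [EGroup.zpow_x] at h3
    have e1 : comm b u u = m := by
      nth_rw 1 [h1]
      rw [comm_zsmul_left, comm_add_left, comm_self, hvu, zero_add, mul_one]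
    have e2 : comm b u v = m := by
      nth_rw 1 [h1]
      rw [comm_zsmul_left, comm_add_left, comm_self, huv, add_zero, mul_one]
    rw [comm_self] at e1
    rw [huv, ← e1] at e2
    exact one_ne_zero e2
  · rw [card_plane hb huv, hp]
    norm_num

/-- Both `(u, 0)` and `(v, 0)` have the nontrivial central element `(0, 1)` as their square, and
they do not commute. -/
theorem plane_mulEquiv_quaternion (hp : p = 2) (hb : IsNondeg b) {u v : V} (huv : comm b u v = 1)
    (hu : b u u = 1) (hv : b v v = 1) : Nonempty (plane b u v ≃* QuaternionGroup 2) := by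
  have h2 := vec_add_self hp hb
  have hz := add_self_of_two hp
  let c : EGroup b := ⟨u, 0⟩
  let d : EGroup b := ⟨v, 0⟩
  have hc : c ∈ plane b u v := mem_plane.2 ⟨1, 0, by simp [c]⟩
  have hd : d ∈ plane b u v := mem_plane.2 ⟨0, 1, by simp [d]⟩
  have hc2 : c * c = ⟨0, 1⟩ := by
    ext
    · exact h2 _
    · simp [c, hu]
  have hord : orderOf (⟨c, hc⟩ : plane b u v) = 2 ^ (1 + 1) := by
    refine orderOf_eq_prime_pow ?_ ?_
    · intro h
      have h1 := congrArg (fun s => s.1.z) h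
      change (c ^ 2 ^ 1).z = 0 at h1
      rw [pow_one, sq, hc2] at h1
      exact one_ne_zero h1
    · apply Subtype.ext
      change c ^ (2 ^ 2) = 1
      rw [show 2 ^ 2 = 2 * 2 by norm_num, pow_mul, sq c, hc2, sq]
      ext
      · simp
      · simpa using hz 1
  refine nonempty_mulEquiv_quaternion (c := ⟨c, hc⟩) (d := ⟨d, hd⟩) hord ?_ ?_ ?_ ?_
  · apply Subtype.ext
    change d * d = c ^ 2
    rw [sq, hc2]
    ext
    · exact h2 v
    · simp [d, hv]
  · apply Subtype.ext
    change c * d = d * c⁻¹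
    ext
    · change u + v = v + -u
      rw [neg_eq_of_add_eq_zero_left (h2 u), add_comm]
    · have h3 : b u v = 1 + b v u := by rw [← huv, comm_apply, sub_add_cancel]
      simp [c, d, hu, h3, neg_eq_of_two hp]
  · intro m h
    have h1 : v = m • u := by
      have h3 := congrArg (fun s => s.1.x) h
      change d.x = (c ^ m).x at h3
      rwa [EGroup.zpow_x] at h3
    rw [h1, comm_zsmul_right, comm_self, mul_zero] at huv
    exact zero_ne_one huv
  · rw [card_plane hb huv, hp]
    norm_num

theorem EGroup.pow_of_isAlt (h : ∀ x, b x x = 0) (s : EGroup b) (m : ℕ) :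
    s ^ m = ⟨m • s.x, m • s.z⟩ := by
  induction m with
  | zero => ext <;> simp
  | succ m ih => ext <;> simp [pow_succ, ih, add_smul, h]

theorem plane_exponent (hb : IsNondeg b) (h : ∀ x, b x x = 0) {u v : V} (huv : comm b u v = 1) :
    Nat.card (plane b u v) = p ^ 3 ∧ Monoid.exponent (plane b u v) = p ∧
      ¬ ∀ s t : plane b u v, s * t = t * s := by
  have hp : p.Prime := Fact.out
  have hcard := card_plane hb huv
  have : Nontrivial (plane b u v) := by
    have : Finite (plane b u v) := Nat.finite_of_card_ne_zero (by rw [hcard]; simp [hp.ne_zero])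
    rw [← Finite.one_lt_card_iff_nontrivial, hcard]
    exact Nat.one_lt_pow (by norm_num) hp.one_lt
  refine ⟨hcard, ?_, ?_⟩
  · rw [Monoid.exponent_eq_prime_iff hp]
    intro g hg
    refine orderOf_eq_prime ?_ hg
    apply Subtype.ext
    rw [Subgroup.coe_pow, EGroup.pow_of_isAlt h, EGroup.nsmul_eq_zero hb]
    ext <;> simp
  · intro hcomm
    have hu : (⟨u, 0⟩ : EGroup b) ∈ plane b u v := mem_plane.2 ⟨1, 0, by simp⟩
    have hv : (⟨v, 0⟩ : EGroup b) ∈ plane b u v := mem_plane.2 ⟨0, 1, by simp⟩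
    have h1 := (EGroup.commute_iff _ _).1 (congrArg Subtype.val (hcomm ⟨_, hu⟩ ⟨_, hv⟩))
    rw [huv] at h1
    exact one_ne_zero h1

theorem isEPower_of_isAlt [Finite V] [Nontrivial V] (hb : IsNondeg b) (h : ∀ x, b x x = 0) {n : ℕ}
    (hn : Nat.card V = p ^ (2 * n)) : IsEPower p n (EGroup b) := by
  obtain ⟨m, u, v, hs⟩ := hb.exists_isSymplectic
  have hmn : m = n := by
    have h1 := hs.card_eq
    rw [hn] at h1
    have := Nat.pow_right_injective (Fact.out : p.Prime).two_le h1
    omega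
  subst hmn
  exact ⟨_, hs.isCentralProduct hb, fun i => plane_exponent hb h (hs.left_right_self i)⟩

/-! ### Quadratic forms over the field with two elements -/

/-- The vectors orthogonal to `L`. -/
def orth (b : V →+ V →+ ZMod p) (L : AddSubgroup V) : AddSubgroup V :=
  ⨅ l : L, (comm b l.1).ker

theorem mem_orth {L : AddSubgroup V} {x : V} : x ∈ orth b L ↔ ∀ l ∈ L, comm b l x = 0 := by
  simp only [orth, AddSubgroup.mem_iInf, AddMonoidHom.mem_ker, Subtype.forall]

-- Translation by `l ∈ L` multiplies the sign of `b x x` by that of `comm b l x`. Averaging over `L`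
-- therefore kills all `x` not orthogonal to `L`.
open Classical in
theorem sum_sgn_eq_sum_orth [Fintype V] (hp : p = 2) {L : AddSubgroup V}
    (hL : ∀ l ∈ L, b l l = 0) :
    ∑ x, sgn (b x x) = ∑ x, if x ∈ orth b L then sgn (b x x) else 0 := by
  obtain ⟨χ, hχ⟩ := exists_char_of_two hp ℚ (by norm_num)
  have h1 : ∀ x : V, ∑ l : L, χ (comm b l.1 x) = if x ∈ orth b L then (Nat.card L : ℚ) else 0 := by
    intro x
    have h2 := sum_char_comp hχ (((comm b).flip x).comp L.subtype)
    refine h2.trans (if_congr ?_ rfl rfl)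
    rw [mem_orth, DFunLike.ext_iff, Subtype.forall]
    rfl
  have h2 : ∀ l : L, ∑ x, χ (b x x) = ∑ x, χ (b x x) * χ (comm b l.1 x) := fun l => by
    refine (Fintype.sum_equiv (Equiv.addLeft l.1) _ _ fun x => ?_).symm
    rw [Equiv.coe_addLeft, quad_add hp, hL l.1 l.2, zero_add, AddChar.map_add_eq_mul]
  have h3 : (Nat.card L : ℚ) * ∑ x, χ (b x x) =
      Nat.card L * ∑ x, if x ∈ orth b L then χ (b x x) else 0 := by
    calc (Nat.card L : ℚ) * ∑ x, χ (b x x) = ∑ _l : L, ∑ x, χ (b x x) := by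
          rw [Finset.sum_const, Finset.card_univ, nsmul_eq_mul, Nat.card_eq_fintype_card]
      _ = ∑ x, χ (b x x) * ∑ l : L, χ (comm b l.1 x) := by
          rw [Finset.sum_congr rfl fun l _ => h2 l, Finset.sum_comm]
          simp only [Finset.mul_sum]
      _ = _ := by
          rw [Finset.mul_sum]
          refine Finset.sum_congr rfl fun x _ => ?_
          rw [h1]
          split_ifs <;> ring
  have h4 := mul_left_cancel₀ (Nat.cast_ne_zero.2 (Nat.card_pos (α := L)).ne') h3
  simp only [char_eq_sgn hp hχ] at h4
  exact_mod_cast h4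

theorem comm_eq_zero_of_singular (hp : p = 2) {L : AddSubgroup V}
    (hL : ∀ l ∈ L, b l l = 0) {x y : V} (hx : x ∈ L) (hy : y ∈ L) : comm b x y = 0 := by
  have h := hL _ (L.add_mem hx hy)
  rwa [quad_add hp, hL x hx, hL y hy, zero_add, zero_add] at h

/-- A totally singular subgroup which is its own orthogonal, if there are more zeros than ones. -/
theorem exists_lagrangian [Fintype V] (hp : p = 2)
    (hS : 0 < ∑ x, sgn (b x x)) :
    ∃ L : AddSubgroup V, (∀ l ∈ L, b l l = 0) ∧ ∀ x, (∀ l ∈ L, comm b l x = 0) → x ∈ L := by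
  classical
  obtain ⟨L, hL⟩ := (Set.toFinite {L : AddSubgroup V | ∀ l ∈ L, b l l = 0}).exists_maximal
    ⟨⊥, by intro l hl; rw [AddSubgroup.mem_bot.1 hl]; simp⟩
  have hsing : ∀ l ∈ L, b l l = 0 := hL.prop
  have hle : L ≤ orth b L := fun x hx => mem_orth.2 fun l hl =>
    comm_eq_zero_of_singular hp hsing hl hx
  have hmax : ∀ x ∈ orth b L, b x x = 0 → x ∈ L := by
    intro x hx hx0
    have h1 : L ⊔ AddSubgroup.zmultiples x ∈ {L : AddSubgroup V | ∀ l ∈ L, b l l = 0} := by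
      intro y hy
      obtain ⟨l, hl, z, hz, rfl⟩ := AddSubgroup.mem_sup.1 hy
      obtain ⟨m, rfl⟩ := AddSubgroup.mem_zmultiples_iff.1 hz
      rw [quad_add hp, hsing l hl, comm_zsmul_right, mem_orth.1 hx l hl, map_zsmul, map_zsmul,
        AddMonoidHom.zsmul_apply, hx0]
      simp
    exact hL.le_of_ge h1 le_sup_left (AddSubgroup.mem_sup_right (AddSubgroup.mem_zmultiples x))
  refine ⟨L, hsing, fun x hx => ?_⟩
  suffices h : Nat.card (orth b L) ≤ Nat.card L by
    have := AddSubgroup.eq_of_le_of_card_ge hle h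
    rw [this]
    exact mem_orth.2 hx
  -- By maximality the singular vectors of `orth b L` are exactly those of `L`. Positivity of the
  -- sum then means that `L` has index less than two in `orth b L`.
  have h1 : ∑ x, sgn (b x x) = 2 * (Nat.card L : ℤ) - Nat.card (orth b L) := by
    rw [sum_sgn_eq_sum_orth hp hsing]
    have h2 : ∀ x, (if x ∈ orth b L then sgn (b x x) else 0) =
        2 * (if x ∈ L then 1 else 0) - if x ∈ orth b L then (1 : ℤ) else 0 := by
      intro x
      by_cases hx : x ∈ orth b L
      · by_cases hxL : x ∈ L
        · rw [if_pos hx, if_pos hxL, if_pos hx, sgn, if_pos (hsing x hxL)]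
          norm_num
        · rw [if_pos hx, if_neg hxL, if_pos hx, sgn, if_neg fun h => hxL (hmax x hx h)]
          norm_num
      · rw [if_neg hx, if_neg hx, if_neg fun h => hx (hle h)]
        norm_num
    rw [Finset.sum_congr rfl fun x _ => h2 x, Finset.sum_sub_distrib, ← Finset.mul_sum,
      Finset.sum_boole, Finset.sum_boole, Nat.card_eq_fintype_card, Nat.card_eq_fintype_card,
      Fintype.card_subtype, Fintype.card_subtype]
  rw [h1] at hS
  obtain ⟨k, hk⟩ := AddSubgroup.card_dvd_of_le hle
  have hk2 : k < 2 := by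
    by_contra! h2
    have h3 : Nat.card L * 2 ≤ Nat.card (orth b L) := hk ▸ Nat.mul_le_mul_left _ h2
    omega
  rw [hk]
  calc Nat.card L * k ≤ Nat.card L * 1 := Nat.mul_le_mul_left _ (by omega)
    _ = _ := mul_one _

/-- Split off hyperbolic pairs of singular vectors, the first taken from the self-orthogonal totally
singular subgroup `L`. The intersection of `L` with the orthogonal of the pair is again
self-orthogonal there, so the induction continues. -/
theorem exists_isDPower [Fintype V] [Nontrivial V] (hp : p = 2) (hb : IsNondeg b)
    (hS : 0 < ∑ x, sgn (b x x)) : ∃ n, IsDPower n (EGroup b) := by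
  obtain ⟨L, hL, hL'⟩ := exists_lagrangian hp hS
  obtain ⟨n, u, v, hs, hR⟩ := exists_isSymplectic (b := b) (fun u v => b u u = 0 ∧ b v v = 0)
    (fun U => IsNondegOn b U ∧ ∃ L ≤ U, (∀ l ∈ L, b l l = 0) ∧
      ∀ x ∈ U, (∀ l ∈ L, comm b l x = 0) → x ∈ L) (by
      rintro U ⟨hU, L, hLU, hL, hL'⟩ hbot
      obtain ⟨u, hu, hu0⟩ : ∃ u ∈ L, u ≠ 0 := by
        by_contra! h
        refine hbot ((AddSubgroup.eq_bot_iff_forall U).2 fun x hx => h x (hL' x hx fun l hl => ?_))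
        rw [h l hl, map_zero]
        rfl
      obtain ⟨v, hv, huv, hv0⟩ : ∃ v ∈ U, comm b u v = 1 ∧ b v v = 0 := by
        obtain ⟨v, hv, huv⟩ := hU.exists_pair (hLU hu) hu0
        by_cases hv0 : b v v = 0
        · exact ⟨v, hv, huv, hv0⟩
        -- If `b v v = 1`, then `u + v` is singular: the values `0`, `1` and `comm b u v = 1` add up
        -- to zero.
        · refine ⟨u + v, U.add_mem (hLU hu) hv, ?_, ?_⟩
          · rw [comm_add_right, comm_self, huv, zero_add]
          · rw [quad_add hp, hL u hu, eq_one_of_ne_zero hp hv0, huv, zero_add,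
              add_self_of_two hp]
      refine ⟨u, hLU hu, v, hv, huv, ⟨hL u hu, hv0⟩, hU.inf_perp (hLU hu) hv huv,
        L ⊓ perp b u v, inf_le_inf_right _ hLU, fun l hl => hL l hl.1, fun x hx h => ⟨?_, hx.2⟩⟩
      refine hL' x hx.1 fun l hl => ?_
      have hlu : comm b l u = 0 := comm_eq_zero_of_singular hp hL hl hu
      -- The coefficient of `v` in the projection is `comm b l u = 0`, so the projection does not
      -- leave `L`.
      have hmem : perpPart b u v l ∈ L ⊓ perp b u v := by
        refine ⟨?_, perpPart_mem_perp huv l⟩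
        rw [perpPart, hlu]
        simpa using L.sub_mem hl (L.zsmul_mem hu _)
      have h1 := h _ hmem
      obtain ⟨h2, h3⟩ := mem_perp.1 hx.2
      rw [comm_swap, comm_perpPart, comm_swap b u x, h2, hlu] at h1
      rw [comm_swap]
      simpa [-comm_apply] using h1) ⟨hb.isNondegOn_top, L, le_top, hL, fun x _ => hL' x⟩
  exact ⟨n, _, hs.isCentralProduct hb, fun i =>
    plane_mulEquiv_dihedral hp hb (hs.left_right_self i) (hR i).1 (hR i).2⟩

/-- Two generating reflections in each dihedral factor give singular vectors that together form a
symplectic basis. The span `L` of the first vectors is totally singular and equal to its orthogonal,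
so by `sum_sgn_eq_sum_orth` the sum just counts `L`. -/
theorem sum_sgn_pos_of_isDPower [Fintype V] (hp : p = 2) (hb : IsNondeg b) {n : ℕ}
    (h : IsDPower n (EGroup b)) : 0 < ∑ x, sgn (b x x) := by
  classical
  obtain ⟨H, hH, he⟩ := h
  let e := fun i => (he i).some
  let s : Fin n → EGroup b := fun i => (e i).symm (DihedralGroup.sr 0)
  let t : Fin n → EGroup b := fun i => (e i).symm (DihedralGroup.sr 1)
  have hsH : ∀ i, s i ∈ H i := fun i => ((e i).symm (DihedralGroup.sr 0)).2
  have htH : ∀ i, t i ∈ H i := fun i => ((e i).symm (DihedralGroup.sr 1)).2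
  have hquad : ∀ r : EGroup b, r * r = 1 → b r.x r.x = 0 := by
    intro r hr
    have h1 := congrArg EGroup.z hr
    rwa [EGroup.mul_z, EGroup.one_z, add_self_of_two hp, zero_add] at h1
  have hs2 : ∀ i, b (s i).x (s i).x = 0 := fun i => hquad _ (by
    rw [← Subgroup.coe_mul, ← map_mul, DihedralGroup.sr_mul_self, map_one]
    rfl)
  have ht2 : ∀ i, b (t i).x (t i).x = 0 := fun i => hquad _ (by
    rw [← Subgroup.coe_mul, ← map_mul, DihedralGroup.sr_mul_self, map_one]
    rfl)
  have hsymp : IsSymplectic b (fun i => (s i).x) (fun i => (t i).x) := by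
    refine ⟨fun i j => ?_, fun i j => ?_, fun i j => ?_, fun x hx => ?_⟩
    · split_ifs with hij
      · subst hij
        refine eq_one_of_ne_zero hp fun h0 => ?_
        have h1 : (e i).symm (DihedralGroup.sr 0) * (e i).symm (DihedralGroup.sr 1) =
          (e i).symm (DihedralGroup.sr 1) * (e i).symm (DihedralGroup.sr 0) :=
            Subtype.ext ((EGroup.commute_iff (s i) (t i)).2 h0)
        rw [← map_mul, ← map_mul] at h1
        exact absurd ((e i).symm.injective h1) (by decide)
      · exact (EGroup.commute_iff _ _).1 (hH.commute i j hij _ (hsH i) _ (htH j))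
    · by_cases hij : i = j
      · rw [hij, comm_self]
      · exact (EGroup.commute_iff _ _).1 (hH.commute i j hij _ (hsH i) _ (hsH j))
    · by_cases hij : i = j
      · rw [hij, comm_self]
      · exact (EGroup.commute_iff _ _).1 (hH.commute i j hij _ (htH i) _ (htH j))
    -- A vector orthogonal to all the chosen ones gives an element `(x, 0)` commuting with
    -- generators of every factor, hence a central element.
    · have hle : ∀ i, H i ≤ Subgroup.centralizer {(⟨x, 0⟩ : EGroup b)} := by
        intro i r hr
        obtain ⟨h1, h2⟩ := mem_perp.1 (hx i)
        have h3 : ∀ g : DihedralGroup 4, ((e i).symm g : EGroup b) ∈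
            Subgroup.centralizer {(⟨x, 0⟩ : EGroup b)} := by
          intro g
          have hg := DihedralGroup.mem_closure_reflections g
          induction hg using Subgroup.closure_induction with
          | mem g hg =>
            rw [Subgroup.mem_centralizer_singleton_iff]
            rcases hg with rfl | hg
            · exact (EGroup.commute_iff _ _).2 h1
            · rw [Set.mem_singleton_iff.1 hg]
              exact (EGroup.commute_iff _ _).2 h2
          | one => rw [map_one]; exact Subgroup.one_mem _
          | mul g g' _ _ h h' => rw [map_mul]; exact Subgroup.mul_mem _ h h'
          | inv g _ h => rw [map_inv]; exact Subgroup.inv_mem _ h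
        have h4 := h3 (e i ⟨r, hr⟩)
        rwa [MulEquiv.symm_apply_apply] at h4
      have htop : Subgroup.centralizer {(⟨x, 0⟩ : EGroup b)} = ⊤ := by
        rw [eq_top_iff, ← hH.generate]
        exact iSup_le hle
      refine hb x fun y => (EGroup.commute_iff (⟨x, 0⟩ : EGroup b) ⟨y, 0⟩).1 ?_
      have : (⟨y, 0⟩ : EGroup b) ∈ Subgroup.centralizer {(⟨x, 0⟩ : EGroup b)} := htop ▸ trivial
      exact (Subgroup.mem_centralizer_singleton_iff.1 this).symm
  set L := AddSubgroup.closure (Set.range fun i => (s i).x) with hLdef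
  have hmem : ∀ i, (s i).x ∈ L := fun i => AddSubgroup.subset_closure ⟨i, rfl⟩
  have hperp : ∀ l ∈ L, ∀ i, comm b (s i).x l = 0 := by
    intro l hl i
    have hle : L ≤ (comm b (s i).x).ker := by
      rw [hLdef, AddSubgroup.closure_le]
      rintro _ ⟨j, rfl⟩
      exact hsymp.left_left i j
    exact hle hl
  have hLL : ∀ l ∈ L, ∀ l' ∈ L, comm b l' l = 0 := by
    intro l hl l' hl'
    have hle : L ≤ (comm b l).ker := by
      rw [hLdef, AddSubgroup.closure_le]
      rintro _ ⟨j, rfl⟩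
      change comm b l (s j).x = 0
      rw [comm_swap, hperp l hl, neg_zero]
    rw [comm_swap, hle hl', neg_zero]
  have hsing : ∀ l ∈ L, b l l = 0 := by
    intro l hl
    induction hl using AddSubgroup.closure_induction with
    | mem l hl =>
      obtain ⟨i, rfl⟩ := hl
      exact hs2 i
    | zero => simp
    | add l l' hl hl' h h' => rw [quad_add hp, h, h', hLL l' hl' l hl, zero_add, zero_add]
    | neg l _ h => simpa using h
  rw [sum_sgn_eq_sum_orth hp hsing]
  have hterm : ∀ x, (if x ∈ orth b L then sgn (b x x) else 0) = if x ∈ orth b L then 1 else 0 := by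
    intro x
    split_ifs with hx
    · have hxL : x ∈ L := by
        rw [← hsymp.vec_coords x]
        refine AddSubgroup.sum_mem _ fun i _ => ?_
        have h1 := mem_orth.1 hx _ (hmem i)
        beta_reduce
        rw [h1]
        simpa using L.zsmul_mem (hmem i) _
      rw [sgn, if_pos (hsing x hxL)]
    · rfl
  rw [Finset.sum_congr rfl fun x _ => hterm x, Finset.sum_boole]
  have : 0 < (Finset.univ.filter fun x => x ∈ orth b L).card :=
    Finset.card_pos.2 ⟨0, by simp⟩
  exact_mod_cast this

end Structure

/-! ### Doubling, and Hermitian forms over the field with four elements -/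

namespace FormSpace

variable {D : FormSpace.{u}}

instance : CharP D.K D.p := charP_of_injective_algebraMap (algebraMap (ZMod D.p) D.K).injective D.p

theorem card_K_eq : ∃ n : ℕ, Nat.card D.K = D.p ^ n :=
  ⟨Module.finrank (ZMod D.p) D.K, by
    rw [Module.natCard_eq_pow_finrank (K := ZMod D.p), Nat.card_zmod]⟩

theorem p_eq_of_card {r k : ℕ} (hr : r.Prime) (hK : Nat.card D.K = r ^ k) : D.p = r := by
  obtain ⟨n, hn⟩ := card_K_eq (D := D)
  have h1 : 1 < Nat.card D.K := Finite.one_lt_card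
  have hn0 : n ≠ 0 := by
    rintro rfl
    rw [hn, pow_zero] at h1
    exact lt_irrefl 1 h1
  have h2 : D.p ∣ r ^ k := by
    rw [← hK, hn]
    exact dvd_pow_self _ hn0
  exact (Nat.prime_dvd_prime_iff_eq D.prime.out hr).1 (D.prime.out.dvd_of_dvd_pow h2)

section CardFour

theorem p_eq_two_of_card_four (hK : Nat.card D.K = 4) : D.p = 2 :=
  p_eq_of_card Nat.prime_two (k := 2) hK

theorem add_self_of_card_four (hK : Nat.card D.K = 4) (a : D.K) : a + a = 0 := by
  have h1 : ((D.p : ℕ) : D.K) = 0 := CharP.cast_eq_zero _ _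
  rw [p_eq_two_of_card_four hK, Nat.cast_ofNat] at h1
  rw [← two_mul, h1, zero_mul]

theorem IsHermitian.elements (h : D.IsHermitian) (hK : Nat.card D.K = 4) (a : D.K) :
    a = 0 ∨ a = 1 ∨ a = D.lam ∨ a = D.η D.lam := by
  classical
  have := Fintype.ofFinite D.K
  have h0 := h.lam_ne_zero
  have h1 : D.lam ≠ 1 := fun h1 => h.2.2.2.2 (by rw [h1, map_one])
  have h2 : D.η D.lam ≠ 0 := fun h2 => h0 ((map_eq_zero D.η).1 h2)
  have h3 : D.η D.lam ≠ 1 := fun h3 => h1 (D.η.injective (by rw [h3, map_one]))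
  have hcard : ({0, 1, D.lam, D.η D.lam} : Finset D.K).card = 4 := by
    rw [Finset.card_insert_of_notMem, Finset.card_insert_of_notMem, Finset.card_insert_of_notMem,
      Finset.card_singleton]
    · simpa using h.2.2.2.2.symm
    · simp [h1.symm, h3.symm]
    · simp [h0.symm, h2.symm]
  have huniv : ({0, 1, D.lam, D.η D.lam} : Finset D.K) = Finset.univ := by
    rw [← Finset.card_eq_iff_eq_univ, hcard, ← Nat.card_eq_fintype_card, hK]
  have := Finset.mem_univ a
  rw [← huniv] at this
  simpa using this

theorem IsHermitian.lam_sub_eta (h : D.IsHermitian) (hK : Nat.card D.K = 4) :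
    D.lam - D.η D.lam = 1 := by
  have h0 := h.lam_ne_zero
  rcases h.elements hK (D.lam - D.η D.lam) with h1 | h1 | h1 | h1
  · exact absurd (sub_eq_zero.1 h1).symm h.2.2.2.2
  · exact h1
  · exact absurd ((map_eq_zero D.η).1 (sub_eq_self.1 h1)) h0
  · rw [sub_eq_iff_eq_add, add_self_of_card_four hK] at h1
    exact absurd h1 h0

theorem IsHermitian.trace_one (h : D.IsHermitian) (hK : Nat.card D.K = 4) :
    Algebra.trace (ZMod D.p) D.K 1 = 0 := by
  rw [← h.lam_sub_eta hK, map_sub, trace_eta h.2.1, sub_self]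

theorem IsHermitian.trace_lam (h : D.IsHermitian) (hK : Nat.card D.K = 4) :
    Algebra.trace (ZMod D.p) D.K D.lam = 1 := by
  refine eq_one_of_ne_zero (p_eq_two_of_card_four hK) fun h0 => ?_
  refine one_ne_zero (eq_zero_of_trace (D := D) (a := 1) fun c => ?_)
  rw [mul_one]
  rcases h.elements hK c with rfl | rfl | rfl | rfl
  · exact map_zero _
  · exact h.trace_one hK
  · exact h0
  · rw [trace_eta h.2.1, h0]

theorem IsHermitian.eq_one_of_eta (h : D.IsHermitian) (hK : Nat.card D.K = 4) {a : D.K}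
    (ha : D.η a = a) (h0 : a ≠ 0) : a = 1 := by
  rcases h.elements hK a with h1 | h1 | h1 | h1
  · exact absurd h1 h0
  · exact h1
  · exact absurd (h1 ▸ ha) h.2.2.2.2
  · rw [h1, h.2.1] at ha
    exact absurd ha.symm h.2.2.2.2

theorem IsHermitian.eq_zero_of_traces (h : D.IsHermitian) (hK : Nat.card D.K = 4) {a : D.K}
    (h1 : Algebra.trace (ZMod D.p) D.K a = 0)
    (h2 : Algebra.trace (ZMod D.p) D.K (D.η D.lam * a) = 0) : a = 0 := by
  have hl := h.trace_lam hK
  rcases h.elements hK a with ha | ha | ha | ha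
  · exact ha
  · rw [ha, mul_one, trace_eta h.2.1, hl] at h2
    exact absurd h2 one_ne_zero
  · rw [ha, hl] at h1
    exact absurd h1 one_ne_zero
  · rw [ha, trace_eta h.2.1, hl] at h1
    exact absurd h1 one_ne_zero

/-- If `f` vanished on the diagonal of `U`, polarization with `c • x` would give `c f(x, y) + η(c
f(x, y)) = 0` for all `c`. The cases `c = 1` and `c = λ` force `f(x, y) = 0`. -/
theorem IsHermitian.exists_ne_zero (h : D.IsHermitian) {U : AddSubgroup D.V}
    (hU : ∀ (c : D.K), ∀ x ∈ U, c • x ∈ U)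
    (hnd : IsNondegOn D.hat U) (hbot : U ≠ ⊥) : ∃ u ∈ U, D.f u u ≠ 0 := by
  by_contra! h0
  obtain ⟨x, hx, hx0⟩ := U.bot_or_exists_ne_zero.resolve_left hbot
  refine hx0 (hnd x hx fun y hy => ?_)
  have key : ∀ c : D.K, c * D.f x y + D.η (c * D.f x y) = 0 := by
    intro c
    have h1 := h0 _ (U.add_mem (hU c x hx) hy)
    have h2 : D.f y (c • x) = D.η (D.f (c • x) y) := h.2.2.1 _ _
    rw [map_add, map_add, LinearMap.add_apply, LinearMap.add_apply, h0 _ (hU c x hx), h0 y hy, h2,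
      map_smul, LinearMap.smul_apply, smul_eq_mul] at h1
    linear_combination h1
  have hz : D.f x y = 0 := by
    have h1 := key 1
    have h2 := key D.lam
    rw [one_mul] at h1
    rw [map_mul] at h2
    have h3 : (D.lam - D.η D.lam) * D.f x y = 0 := by linear_combination h2 - D.η D.lam * h1
    exact (mul_eq_zero.1 h3).resolve_left (sub_ne_zero.2 h.2.2.2.2.symm)
  rw [h.comm_hat, hz, mul_zero, map_zero]

/-- Over the field with four elements a nonzero value `f(u, u)` equals `1`. Then `u`, `λ u` is a
hyperbolic pair for `comm f̂`, with `f̂` equal to `T(λ) = 1` on both, so the line `K u` contributes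
a quaternion group. Its orthogonal is `K`-stable, so one obtains one factor for each dimension over
`K`. -/
theorem IsHermitian.isQPower (h : D.IsHermitian) (hK : Nat.card D.K = 4) :
    IsQPower (Module.finrank D.K D.V) D.E := by
  have hp := p_eq_two_of_card_four hK
  have hb := h.isNondeg
  have hl := h.trace_lam hK
  have hc : ∀ x y, comm D.hat x y = Algebra.trace (ZMod D.p) D.K (D.f x y) := fun x y => by
    rw [h.comm_hat, h.lam_sub_eta hK, one_mul]
  have hsl : ∀ x y, D.f x (D.lam • y) = D.η D.lam * D.f x y := fun x y => by
    rw [LinearMap.map_smulₛₗ, smul_eq_mul]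
  obtain ⟨n, u, v, hs, hR⟩ := exists_isSymplectic (b := D.hat)
    (fun u v => D.hat u u = 1 ∧ D.hat v v = 1)
    (fun U => (∀ (c : D.K), ∀ x ∈ U, c • x ∈ U) ∧ IsNondegOn D.hat U) (by
      rintro U ⟨hU, hnd⟩ hbot
      obtain ⟨u, hu, hu0⟩ := h.exists_ne_zero hU hnd hbot
      have hu1 : D.f u u = 1 := h.eq_one_of_eta hK (h.2.2.1 u u).symm hu0
      have huv : comm D.hat u (D.lam • u) = 1 := by
        rw [hc, hsl, hu1, mul_one, trace_eta h.2.1, hl]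
      refine ⟨u, hu, D.lam • u, hU _ u hu, huv, ⟨?_, ?_⟩, ?_, hnd.inf_perp hu (hU _ u hu) huv⟩
      · rw [hat_apply, hu1, mul_one, hl]
      · have h1 : D.f (D.lam • u) (D.lam • u) = 1 := by
          refine h.eq_one_of_eta hK (h.2.2.1 _ _).symm ?_
          rw [hsl, map_smul, LinearMap.smul_apply, hu1, smul_eq_mul, mul_one]
          exact mul_ne_zero ((map_ne_zero D.η).2 h.lam_ne_zero) h.lam_ne_zero
        rw [hat_apply, h1, mul_one, hl]
      · intro c x hx
        refine ⟨hU c x hx.1, ?_⟩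
        obtain ⟨h1, h2⟩ := mem_perp.1 hx.2
        have hx0 : D.f x u = 0 := by
          refine h.eq_zero_of_traces hK ?_ ?_
          · rw [← hc, comm_swap, h1, neg_zero]
          · rw [← hsl, ← hc, comm_swap, h2, neg_zero]
        have hcx : D.f (c • x) u = 0 := by rw [map_smul, LinearMap.smul_apply, hx0, smul_zero]
        refine mem_perp.2 ?_
        rw [comm_swap D.hat (c • x) u, comm_swap D.hat (c • x), hc, hc, hsl, hcx,
          mul_zero, map_zero, neg_zero]
        exact ⟨rfl, rfl⟩) ⟨fun _ _ _ => trivial, hb.isNondegOn_top⟩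
  have hn : n = Module.finrank D.K D.V := by
    have h1 := hs.card_eq
    have h2 := Module.natCard_eq_pow_finrank (K := D.K) (V := D.V)
    rw [h1, hK, pow_mul, hp] at h2
    exact Nat.pow_right_injective (le_refl 2 |>.trans (by norm_num : 2 ≤ 2 ^ 2)) h2
  subst hn
  exact ⟨_, hs.isCentralProduct hb, fun i =>
    plane_mulEquiv_quaternion hp hb (hs.left_right_self i) (hR i).1 (hR i).2⟩

/-- As for the Gauss sums, the sum of signs of `f̂ x x` is `(-q) ^ dim V`. In odd dimension it is
negative, whereas it is positive for `D^n`. -/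
theorem IsHermitian.not_needsDouble (h : D.IsHermitian) (hK : Nat.card D.K = 4)
    (hodd : Odd (Module.finrank D.K D.V)) (p' : ℕ) :
    ¬ NeedsDouble D p' := by
  have := Fintype.ofFinite D.V
  have hp := p_eq_two_of_card_four hK
  rintro (⟨n, hn⟩ | hn)
  · have hpos := sum_sgn_pos_of_isDPower hp h.isNondeg hn
    obtain ⟨q, r, z, hq, hr, hr2, hrq, hzr, hz1, hzn⟩ := exists_norm_one h hp
    have := Fact.mk hr
    have hmod : ∑ x, sgn (D.hat x x) ≡ 1 [ZMOD r] := by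
      refine sum_sgn_modEq (fun x : D.V => z • x) 0
        (iterate_smul (D := D) (fun x : D.V => x) Function.injective_id _ (fun _ => rfl) hzr)
        (smul_eq_self_iff hz1) (fun x => D.hat x x) (fun x => hat_smul z hzn x x) (by simp)
    have hS := sum_sgn_sq hp h.isNondeg
    have hcard := Module.natCard_eq_pow_finrank (K := D.K) (V := D.V)
    rw [hcard, hq, ← pow_mul] at hS
    push_cast at hS
    have hval := eq_neg_pow_of_modEq hr hr2 hrq hS hmod
    rw [hval, hodd.neg_pow] at hpos
    have : (0 : ℤ) ≤ (q : ℤ) ^ Module.finrank D.K D.V := by positivity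
    omega
  · exact hn.1 hp

end CardFour

theorem not_isDPower (hp : D.p ≠ 2) (n : ℕ) : ¬ IsDPower n D.E := by
  rintro ⟨H, hH, he⟩
  have hp1 : D.p.Prime := D.prime.out
  obtain ⟨k, hk⟩ : ∃ k, Nat.card D.E = D.p ^ k := by
    refine ⟨Module.finrank (ZMod D.p) D.K * Module.finrank D.K D.V + 1, ?_⟩
    rw [EGroup.card_eq_mul, Module.natCard_eq_pow_finrank (K := D.K) (V := D.V),
      Module.natCard_eq_pow_finrank (K := ZMod D.p) (V := D.K), Nat.card_zmod, ← pow_mul, pow_succ]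
  rcases n with _ | n
  · have h1 := hH.generate
    rw [iSup_of_empty] at h1
    obtain ⟨x, hx⟩ := exists_ne (0 : D.V)
    have h2 : (⟨x, 0⟩ : D.E) ∈ (⊥ : Subgroup D.E) := h1 ▸ trivial
    exact hx (congrArg EGroup.x (Subgroup.mem_bot.1 h2))
  · have h1 := Subgroup.card_subgroup_dvd_card (H 0)
    rw [Nat.card_congr (he 0).some.toEquiv, DihedralGroup.nat_card, hk] at h1
    have h2 : 2 ∣ D.p ^ k := (by norm_num : 2 ∣ 2 * 4).trans h1
    have h3 := Nat.prime_two.dvd_of_dvd_pow h2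
    exact hp ((Nat.prime_dvd_prime_iff_eq Nat.prime_two hp1).1 h3).symm

theorem needsDouble_iff_of_odd (hp : D.p ≠ 2) (p' : ℕ) :
    NeedsDouble D p' ↔ Odd (orderOf (p' : ZMod D.p)) :=
  ⟨fun h => (h.resolve_left fun ⟨n, hn⟩ => not_isDPower hp n hn).2, fun h => Or.inr ⟨hp, h⟩⟩

theorem IsAlternating.isEPower (h : D.IsAlternating) {n : ℕ}
    (hn : Nat.card D.V = D.p ^ (2 * n)) : IsEPower D.p n D.E :=
  isEPower_of_isAlt h.isNondeg (fun x => by rw [hat_apply, h.2.2.1 x, mul_zero, map_zero]) hn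

end FormSpace

/-! ### Roots of unity in finite fields -/

section FiniteFields

variable {p p' : ℕ} [Fact p.Prime]

theorem natCast_prime_ne_zero_of_ne [Fact p'.Prime] (h : p' ≠ p) : (p' : ZMod p) ≠ 0 := by
  intro h0
  rw [ZMod.natCast_eq_zero_iff] at h0
  exact h ((Nat.prime_dvd_prime_iff_eq (Fact.out : p.Prime) (Fact.out : p'.Prime)).1 h0).symm

theorem orderOf_natCast_pos [Fact p'.Prime] (h : p' ≠ p) : 0 < orderOf (p' : ZMod p) := by
  have h1 : (p' : ZMod p) = (Units.mk0 _ (natCast_prime_ne_zero_of_ne h) : (ZMod p)ˣ) := rfl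
  rw [h1, orderOf_units]
  exact orderOf_pos _

theorem exists_isPrimitiveRoot_of_card {k : Type*} [Field k] [Finite k]
    (hcard : Nat.card k = p' ^ orderOf (p' : ZMod p)) : ∃ ε : k, IsPrimitiveRoot ε p := by
  have h1 : p ∣ Nat.card kˣ := by
    rw [Nat.card_units, ← ZMod.natCast_eq_zero_iff, Nat.cast_sub Finite.card_pos, hcard,
      Nat.cast_pow, pow_orderOf_eq_one, Nat.cast_one, sub_self]
  obtain ⟨ε, hε⟩ := exists_prime_orderOf_dvd_card' p h1
  refine ⟨ε, ?_⟩
  rw [IsPrimitiveRoot.coe_units_iff, ← hε]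
  exact IsPrimitiveRoot.orderOf ε

theorem exists_char_of_isPrimitiveRoot {k : Type*} [Field k] {ε : k} (hε : IsPrimitiveRoot ε p) :
    ∃ ψ : AddChar (ZMod p) k, ψ ≠ 1 := by
  refine ⟨AddChar.zmodChar p hε.pow_eq_one, ?_⟩
  rw [AddChar.zmod_char_ne_one_iff, show (1 : ZMod p) = ((1 : ℕ) : ZMod p) by simp,
    AddChar.zmodChar_apply', pow_one]
  exact hε.ne_one (Fact.out : p.Prime).one_lt

/-- The automorphism of order two that inverts the `p`-th roots of unity. -/
theorem exists_involution [Fact p'.Prime] {k : Type*} [Field k] [Finite k] [CharP k p'] (hp : p ≠ 2)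
    (heven : Even (orderOf (p' : ZMod p))) (hpos : 0 < orderOf (p' : ZMod p))
    (hcard : Nat.card k = p' ^ orderOf (p' : ZMod p)) :
    ∃ η : k →+* k, η ≠ RingHom.id k ∧ (∀ a, η (η a) = a) ∧ ∀ ε : k, ε ^ p = 1 → η ε = ε⁻¹ := by
  have := Fintype.ofFinite k
  obtain ⟨m, hm⟩ := heven
  have hinv : ∀ ε : k, ε ^ p = 1 → iterateFrobenius k p' m ε = ε⁻¹ := by
    intro ε hε
    -- With `2 m` the order of `p'` modulo `p`, the power `p' ^ m` is `-1` modulo `p`, so the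
    -- `m`-fold Frobenius inverts the `p`-th roots of unity.
    have h1 : ((p' : ZMod p) ^ m) ^ 2 = 1 := by
      rw [← pow_mul, mul_two, ← hm, pow_orderOf_eq_one]
    have h2 : (p' : ZMod p) ^ m ≠ 1 := pow_ne_one_of_lt_orderOf (by omega) (by omega)
    have h3 : (p' : ZMod p) ^ m = -1 := (mul_self_eq_one_iff.1 (by rwa [← sq])).resolve_left h2
    have h4 : p ∣ p' ^ m + 1 := by
      rw [← ZMod.natCast_eq_zero_iff]
      push_cast
      rw [h3, neg_add_cancel]
    obtain ⟨c, hc⟩ := h4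
    refine eq_inv_of_mul_eq_one_left ?_
    rw [iterateFrobenius_def, ← pow_succ, hc, pow_mul, hε, one_pow]
  refine ⟨iterateFrobenius k p' m, fun hid => ?_, fun a => ?_, hinv⟩
  · obtain ⟨ε, hε⟩ := exists_isPrimitiveRoot_of_card hcard
    have h1 := hinv ε hε.pow_eq_one
    rw [hid, RingHom.id_apply] at h1
    have h0 : ε ≠ 0 := hε.ne_zero (Fact.out : p.Prime).ne_zero
    have h2 : ε ^ 2 = 1 := by
      rw [sq]
      nth_rw 1 [h1]
      exact inv_mul_cancel₀ h0
    have h3 := Nat.le_of_dvd two_pos (hε.dvd_of_pow_eq_one 2 h2)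
    have h4 := (Fact.out : p.Prime).two_le
    omega
  · rw [iterateFrobenius_def, iterateFrobenius_def, ← pow_mul, ← pow_add, ← hm, ← hcard,
      Nat.card_eq_fintype_card, FiniteField.pow_card]

end FiniteFields

/-! ### One step -/

namespace FormSpace

variable {D D' : FormSpace.{u}}

/-- A representation that preserves the form, as a homomorphism to `G(f̂)`. -/
def toG (D : FormSpace.{u}) {Γ : Type*} [Group Γ] (τ : Representation D.K Γ D.V)
    (h : Preserves τ D.f) : Γ →* D.G :=
  ((LinearMap.GeneralLinearGroup.generalLinearEquiv D.K D.V).toMonoidHom.comp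
    τ.toHomUnits).codRestrict D.G fun a x y => by
      have h1 := h a x y
      change D.hat (τ a x) (τ a y) = D.hat x y
      rw [hat_apply, hat_apply, h1]

@[simp] theorem toG_apply {Γ : Type*} [Group Γ] (τ : Representation D.K Γ D.V)
    (h : Preserves τ D.f) (a : Γ) (x : D.V) : (D.toG τ h a).1 x = τ a x := rfl

theorem natRep_apply (g : D.G) (x : D.V) : D.natRep g x = g.1 x := rfl

theorem exists_embedding_of_preserves (hD : D.IsAdmissible) (ρ : Representation D'.K D.E D'.V)
    (hρ : IsFaithfulAbsIrr ρ) (hf : Preserves ρ D'.f) :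
    ∃ Φ : D.GE →* D'.G, (∀ s : D.E, D'.natRep (Φ (SemidirectProduct.inl s)) = ρ s) ∧
      Function.Injective Φ := by
  obtain ⟨ψ, hψ⟩ := exists_isWeil hD.isNondeg hρ
  obtain ⟨σ, hσ, hinj, hform⟩ := exists_extension hD hψ
  refine ⟨D'.toG σ (hform _ _ hf), fun s => ?_, fun a a' haa => hinj ?_⟩
  · ext x
    rw [natRep_apply, toG_apply, hσ]
  · ext x
    rw [← toG_apply σ (hform _ _ hf), haa, toG_apply]

theorem exists_embedding_double (hD : D.IsAdmissible) {W : Type u} [AddCommGroup W]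
    [Module D'.K W] (ρ : Representation D'.K D.E W) (e : D'.V ≃ₗ[D'.K] Module.Dual D'.K W × W)
    (hρ : IsFaithfulAbsIrr ρ) (he : D'.IsSplitVia e) :
    ∃ (σ : Representation D'.K D.GE W) (Φ : D.GE →* D'.G),
      (∀ s : D.E, σ (SemidirectProduct.inl s) = ρ s) ∧ IsDoubleOf Φ σ e ∧
      Function.Injective Φ := by
  have : FiniteDimensional D'.K W := Module.Finite.of_surjective
    ((LinearMap.snd D'.K (Module.Dual D'.K W) W).comp e.toLinearMap)
    (Prod.snd_surjective.comp e.surjective)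
  obtain ⟨ψ, hψ⟩ := exists_isWeil hD.isNondeg hρ
  obtain ⟨σ, hσ, hinj, -⟩ := exists_extension hD hψ
  let τ : Representation D'.K D.GE D'.V := (e.symm.conjRingEquiv : _ →* _).comp (σ.dual.prod σ)
  have hτ : ∀ a v, e (τ a v) = (σ.dual a (e v).1, σ a (e v).2) := fun a v =>
    e.apply_symm_apply _
  have hf : Preserves τ D'.f := fun a x y => by
    rw [he.2.1, he.2.1, hτ, hτ]
    change (e y).1 (σ a⁻¹ (σ a (e x).2)) = _
    rw [← Module.End.mul_apply, ← map_mul, inv_mul_cancel, map_one, Module.End.one_apply]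
  have hdouble : IsDoubleOf (D'.toG τ hf) σ e := hτ
  refine ⟨σ, D'.toG τ hf, hσ, hdouble, fun a a' haa => hinj ?_⟩
  ext w
  have h1 := hdouble a (e.symm (0, w))
  rw [haa, hdouble a', LinearEquiv.apply_symm_apply] at h1
  exact (congrArg Prod.snd h1).symm

/-- The space `W* ⊕ W` with its standard form. -/
abbrev split (p : ℕ) [Fact p.Prime] (K : Type u) [Field K] [Finite K] [Algebra (ZMod p) K]
    (W : Type u) [AddCommGroup W] [Module K W] [FiniteDimensional K W] [Nontrivial W] :
    FormSpace.{u} where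
  p := p
  K := K
  V := Module.Dual K W × W
  η := RingHom.id K
  f := LinearMap.mk₂'ₛₗ (RingHom.id K) (RingHom.id K) (fun a b => b.1 a.2) (by simp) (by simp)
    (by simp) (by simp)
  lam := 1

theorem split_isSplitVia (p : ℕ) [Fact p.Prime] (K : Type u) [Field K] [Finite K]
    [Algebra (ZMod p) K] (W : Type u) [AddCommGroup W] [Module K W] [FiniteDimensional K W]
    [Nontrivial W] : (split p K W).IsSplitVia (LinearEquiv.refl K (Module.Dual K W × W)) :=
  ⟨rfl, fun _ _ => rfl, rfl⟩

end FormSpace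

theorem exists_alternating_of_not_needsDouble {D : FormSpace.{u}} (hD : D.IsAdmissible)
    (hp : D.p = 2) {p' : ℕ} (hnd : ¬ NeedsDouble D p') {k : Type v} [Field k] {W : Type w}
    [AddCommGroup W] [Module k W] [FiniteDimensional k W] {ρ : Representation k D.E W}
    {ψ : AddChar (ZMod D.p) k} (h : IsWeil ψ ρ) :
    ∃ B : W →ₗ[k] W →ₗ[k] k, B.IsAlt ∧ B.Nondegenerate ∧ Preserves ρ B := by
  have := Fintype.ofFinite D.V
  exact h.exists_alternating hp hD.isNondeg fun hS =>
    hnd (Or.inl (exists_isDPower hp hD.isNondeg hS))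

/-- Over a finite field of the right size there is a Weil step. -/
theorem exists_isWeilStep_over {D : FormSpace.{u}} (hD : D.IsAdmissible) {p' : ℕ} [Fact p'.Prime]
    (hp : p' ≠ D.p) (k : Type u) [Field k] [Finite k] [Algebra (ZMod p') k]
    (hcard : Nat.card k = p' ^ orderOf (p' : ZMod D.p)) :
    ∃ (D' : FormSpace.{u}) (Φ : D.GE →* D'.G), D'.IsAdmissible ∧ D'.p = p' ∧ IsWeilStep D D' Φ ∧
      Nat.card D'.K = p' ^ orderOf (p' : ZMod D.p) ∧
      (¬ NeedsDouble D p' → Module.finrank D'.K D'.V ^ 2 = Nat.card D.V) := by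
  have hb := hD.isNondeg
  have : CharP k p' := charP_of_injective_algebraMap (algebraMap (ZMod p') k).injective p'
  obtain ⟨ε, hε⟩ := exists_isPrimitiveRoot_of_card hcard
  obtain ⟨ψ, hψ⟩ := exists_char_of_isPrimitiveRoot hε
  obtain ⟨W, _, _, _, ρ, hρ⟩ := exists_representation hb hψ
  have := hρ.nontrivial
  have hirr := hρ.isFaithfulAbsIrr hb
  by_cases hnd : NeedsDouble D p'
  · have he := split_isSplitVia p' k W
    obtain ⟨σ, Φ, hσ, hdouble, hinj⟩ :=
      exists_embedding_double (D' := split p' k W) hD ρ (LinearEquiv.refl k _) hirr he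
    have hcomp : σ.comp (SemidirectProduct.inl : D.E →* D.GE) = ρ := MonoidHom.ext hσ
    exact ⟨split p' k W, Φ, Or.inr (Or.inl ⟨W, _, _, _, he⟩), rfl,
      ⟨hp, hinj, Or.inl ⟨hnd, W, _, _, σ, _, hcomp ▸ hirr, he, hdouble⟩⟩, hcard,
      fun h => absurd hnd h⟩
  · have hfr := hρ.finrank_sq hb
    have hmain : ∀ D' : FormSpace.{u}, ∀ ρ' : Representation D'.K D.E D'.V, D'.p = p' →
        IsFaithfulAbsIrr ρ' → Preserves ρ' D'.f → (D.p = 2 → D'.IsAlternating) →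
        (D.p ≠ 2 → D'.IsHermitian) → ∃ Φ : D.GE →* D'.G, IsWeilStep D D' Φ := by
      intro D' ρ' hp' hirr' hpres h1 h2
      obtain ⟨Φ, hΦ, hinj⟩ := exists_embedding_of_preserves hD ρ' hirr' hpres
      have hcomp : (D'.natRep.comp Φ).comp (SemidirectProduct.inl : D.E →* D.GE) = ρ' :=
        MonoidHom.ext hΦ
      exact ⟨Φ, hp'.trans_ne hp, hinj, Or.inr ⟨hp' ▸ hnd, hcomp ▸ hirr', h1, h2⟩⟩
    by_cases hp2 : D.p = 2
    · obtain ⟨B, hBalt, hBnd, hB⟩ := exists_alternating_of_not_needsDouble hD hp2 hnd hρ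
      let D' : FormSpace.{u} := ⟨p', k, W, RingHom.id k, B, 1⟩
      have hD' : D'.IsAlternating := ⟨rfl, fun h => hp (h.trans hp2.symm), hBalt, hBnd, rfl⟩
      obtain ⟨Φ, hΦ⟩ := hmain D' ρ rfl hirr hB (fun _ => hD') fun h => absurd hp2 h
      exact ⟨D', Φ, Or.inl hD', rfl, hΦ, hcard, fun _ => hfr⟩
    · have heven : Even (orderOf (p' : ZMod D.p)) := by
        rwa [needsDouble_iff_of_odd hp2, Nat.not_odd_iff_even] at hnd
      obtain ⟨η, hη, hη2, hηε⟩ :=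
        exists_involution (k := k) hp2 heven (orderOf_natCast_pos hp) hcard
      obtain ⟨B, hBh, hBnd, hB⟩ := hρ.exists_hermitian hb η hη hη2 hηε
      -- Any element moved by `η` can serve as `λ`.
      obtain ⟨c, hc⟩ : ∃ c, η c ≠ c := by
        by_contra! h
        exact hη (RingHom.ext h)
      let D' : FormSpace.{u} := ⟨p', k, W, η, B, c⟩
      have hD' : D'.IsHermitian := ⟨hη, hη2, hBh, hBnd, hc⟩
      obtain ⟨Φ, hΦ⟩ := hmain D' ρ rfl hirr hB (fun h => absurd h hp2) fun _ => hD'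
      exact ⟨D', Φ, Or.inr (Or.inr hD'), rfl, hΦ, hcard, fun _ => hfr⟩

theorem exists_isWeilStep {D : FormSpace.{u}} (hD : D.IsAdmissible) {p' : ℕ} (hp' : p'.Prime)
    (hp : p' ≠ D.p) :
    ∃ (D' : FormSpace.{u}) (Φ : D.GE →* D'.G), D'.IsAdmissible ∧ D'.p = p' ∧ IsWeilStep D D' Φ ∧
      Nat.card D'.K = p' ^ orderOf (p' : ZMod D.p) ∧
      (¬ NeedsDouble D p' → Module.finrank D'.K D'.V ^ 2 = Nat.card D.V) := by
  have := Fact.mk hp'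
  have hpos := orderOf_natCast_pos hp
  refine exists_isWeilStep_over hD hp (ULift.{u} (GaloisField p' (orderOf (p' : ZMod D.p)))) ?_
  rw [Nat.card_ulift, GaloisField.card _ _ hpos.ne']

/-- Iteration of the step. -/
theorem exists_sequence (P : ℕ → FormSpace.{u} → Prop)
    (step : ∀ i D, P i D → ∃ (D' : FormSpace.{u}) (Φ : D.GE →* D'.G),
      IsWeilStep D D' Φ ∧ P (i + 1) D') {D₁ : FormSpace.{u}} (h₁ : P 0 D₁) :
    ∃ (D : ℕ → FormSpace.{u}) (Φ : ∀ i, (D i).GE →* (D (i + 1)).G),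
      D 0 = D₁ ∧ ∀ i, P i (D i) ∧ IsWeilStep (D i) (D (i + 1)) (Φ i) := by
  choose F Φ hΦ hF using step
  let s : ∀ i, {D // P i D} := fun i => Nat.rec ⟨D₁, h₁⟩ (fun i D => ⟨F i D.1 D.2, hF i D.1 D.2⟩) i
  exact ⟨fun i => (s i).1, fun i => Φ i (s i).1 (s i).2, rfl, fun i =>
    ⟨(s i).2, hΦ i (s i).1 (s i).2⟩⟩

/-! ### Extraspecial series -/

section Series

theorem IsExtraspecial.of_mulEquiv {p : ℕ} {P Q : Type*} [Group P] [Group Q] (e : P ≃* Q)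
    (h : IsExtraspecial p P) : IsExtraspecial p Q := by
  have := h.finite
  have hmap : ∀ {A : Subgroup P} {B : Subgroup Q}, A.map e.toMonoidHom = B →
      Nat.card A = p → Nat.card B = p := by
    rintro A B rfl hA
    rw [← hA]
    exact (Nat.card_congr (e.subgroupMap A).toEquiv).symm
  refine ⟨Finite.of_equiv P e.toEquiv, ?_, ?_, ?_, ?_⟩
  · obtain ⟨k, hk⟩ := h.card_eq
    exact ⟨k, by rw [← hk, Nat.card_congr e.toEquiv]⟩
  · refine hmap ?_ h.card_commutator
    rw [commutator_def, Subgroup.map_commutator, Subgroup.map_top_of_surjective _ e.surjective,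
      commutator_def]
  · rw [← h.card_center]
    exact (Nat.card_congr (Subgroup.centerCongr e).toEquiv).symm
  · exact hmap (OrderIso.map_radical e.mapSubgroup) h.card_frattini

variable {Γ : Type u} [Group Γ] {A B : Subgroup Γ}

theorem exists_quotientEquiv_of_ker {Q : Type v} [Group Q] (φ : A →* Q)
    (hφ : Function.Surjective φ) (hker : φ.ker = B.subgroupOf A) :
    ∃ _ : (B.subgroupOf A).Normal, Nonempty (A ⧸ B.subgroupOf A ≃* Q) := by
  have hn : (B.subgroupOf A).Normal := hker ▸ φ.normal_ker
  exact ⟨hn, ⟨(QuotientGroup.quotientMulEquivOfEq hker.symm).trans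
    (QuotientGroup.quotientKerEquivOfSurjective φ hφ)⟩⟩

/-- A tower is a series inside the group itself, whereas the `N i` are subgroups of the larger group
`Γ`; this passes from one to the other. -/
theorem isExtraspecialSeries_subgroupOf {n : ℕ} {N : ℕ → Subgroup Γ}
    (h : IsExtraspecialSeries n N) :
    IsExtraspecialSeries n fun i => (N i).subgroupOf (N 0) := by
  have hle : ∀ i ≤ n, N i ≤ N 0 := by
    intro i
    induction i with
    | zero => exact fun _ => le_rfl
    | succ i ih => exact fun hi => (h.lt i hi).le.trans (ih (by omega))
  have hmap : ∀ i ≤ n, ((N i).subgroupOf (N 0)).map (N 0).subtype = N i := fun i hi => by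
    rw [Subgroup.subgroupOf_map_subtype, inf_eq_left]
    exact hle i hi
  refine ⟨fun i hi => (h.normal i hi).subgroupOf _, fun i hi => ?_, fun i hi => ?_, fun i hi => ?_⟩
  · refine lt_of_le_of_ne (Subgroup.comap_mono (h.lt i hi).le) fun heq => (h.lt i hi).ne ?_
    rw [← hmap i hi.le, ← hmap (i + 1) hi, heq]
  · obtain ⟨hn, p, hp, hex⟩ := h.extraspecial i hi
    let e := Subgroup.subgroupOfEquivOfLe (hle i hi.le)
    let φ := (QuotientGroup.mk' ((N (i + 1)).subgroupOf (N i))).comp e.toMonoidHom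
    have hφ : Function.Surjective φ := (QuotientGroup.mk'_surjective _).comp e.surjective
    obtain ⟨hn', ⟨e'⟩⟩ := exists_quotientEquiv_of_ker (B := (N (i + 1)).subgroupOf (N 0)) φ hφ (by
      ext x
      rw [MonoidHom.mem_ker]
      exact QuotientGroup.eq_one_iff (e x))
    exact ⟨hn', p, hp, hex.of_mulEquiv e'.symm⟩
  · have h1 := h.le_derived i hi
    rw [← hmap i hi.le, ← hmap (i + 1) hi, ← Subgroup.map_commutator] at h1
    exact (Subgroup.map_le_map_iff_of_injective (N 0).subtype_injective).1 h1

/-- The derived group of the preimage of `A` maps onto `⁅A, A⁆`. Hence, in an induction along the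
tower, only the kernel, which is the newest layer, has to be checked. -/
theorem comap_le_commutator {Γ' : Type v} [Group Γ'] {r : Γ' →* Γ} (hr : Function.Surjective r)
    (h : B ≤ ⁅A, A⁆) (hker : r.ker ≤ ⁅A.comap r, A.comap r⁆) :
    B.comap r ≤ ⁅A.comap r, A.comap r⁆ := by
  have h1 : ⁅A, A⁆ = ⁅A.comap r, A.comap r⁆.map r := by
    rw [Subgroup.map_commutator, Subgroup.map_comap_eq_self_of_surjective hr]
  refine (Subgroup.comap_mono h).trans ?_
  rw [h1, Subgroup.comap_map_eq]
  exact sup_le le_rfl hker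

end Series

/-! ### Commutators in the split extension -/

section SplitExtension

theorem smul_inv_sub_one_sub {k M : Type*} [Field k] [AddCommGroup M] [Module k M] {c : k}
    (hc : c ≠ 1) (x : M) : c • (c - 1)⁻¹ • x - (c - 1)⁻¹ • x = x := by
  rw [smul_smul, ← sub_smul, ← sub_one_mul, mul_inv_cancel₀ (sub_ne_zero.2 hc), one_smul]

variable {D : FormSpace.{u}}

/-- `E(f̂)` consists of commutators in `H ⋉ E(f̂)`, if the vectors `g y - y` with `g ∈ H`
generate `V`. -/
theorem ker_rightHom_le (S : GroupOver D) (hb : IsNondeg D.hat) (H : Subgroup S.Γ)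
    (hH : AddSubgroup.closure {w | ∃ g ∈ H, ∃ y, (S.hom g).1 y - y = w} = ⊤) :
    (SemidirectProduct.rightHom : S.Ext →* S.Γ).ker ≤
      ⁅H.comap (SemidirectProduct.rightHom : S.Ext →* S.Γ),
        H.comap (SemidirectProduct.rightHom : S.Ext →* S.Γ)⁆ := by
  set r := (SemidirectProduct.rightHom : S.Ext →* S.Γ) with hr
  set C := ⁅H.comap r, H.comap r⁆ with hC
  let ι : D.E →* S.Ext := SemidirectProduct.inl
  have hinl : ∀ s : D.E, ι s ∈ H.comap r := fun s => by
    rw [Subgroup.mem_comap, hr, SemidirectProduct.rightHom_inl]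
    exact H.one_mem
  have hbase : EGroup.base D.hat ≤ C.comap ι := by
    rw [← EGroup.commutator_eq hb, commutator_def, Subgroup.commutator_le]
    intro s _ t _
    rw [Subgroup.mem_comap, map_commutatorElement]
    exact Subgroup.commutator_mem_commutator (hinl s) (hinl t)
  let U : AddSubgroup D.V := Subgroup.toAddSubgroup' ((C.comap ι).map (EGroup.proj D.hat))
  have hU : U = ⊤ := by
    rw [eq_top_iff, ← hH, AddSubgroup.closure_le]
    rintro _ ⟨g, hg, y, rfl⟩
    have hinr : (SemidirectProduct.inr g : S.Ext) ∈ H.comap r := by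
      rwa [Subgroup.mem_comap, hr, SemidirectProduct.rightHom_inr]
    -- This element is the commutator of `g` and `(y, 0)`, and its `V`-component is `g y - y`.
    refine ⟨D.act (S.hom g) ⟨y, 0⟩ * ⟨y, 0⟩⁻¹, ?_, ?_⟩
    · have h1 : ι (D.act (S.hom g) ⟨y, 0⟩ * ⟨y, 0⟩⁻¹) =
          ⁅(SemidirectProduct.inr g : S.Ext), ι ⟨y, 0⟩⁆ := by
        have h2 : ι (D.act (S.hom g) ⟨y, 0⟩) = _ :=
          SemidirectProduct.inl_aut (φ := D.act.comp S.hom) g ⟨y, 0⟩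
        rw [map_mul, h2, commutatorElement_def, map_inv, map_inv]
      rw [SetLike.mem_coe, Subgroup.mem_comap, h1]
      exact Subgroup.commutator_mem_commutator hinr (hinl _)
    · exact (sub_eq_add_neg ((S.hom g).1 y) y).symm
  rw [hr, ← SemidirectProduct.range_inl_eq_ker_rightHom]
  rintro _ ⟨s, rfl⟩
  have hs : s.x ∈ U := hU ▸ trivial
  obtain ⟨t, ht, hts⟩ := hs
  have hx : t.x = s.x := hts
  have h1 : t⁻¹ * s ∈ C.comap ι := hbase (by simp [hx])
  have h2 := Subgroup.mul_mem _ ht h1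
  rwa [mul_inv_cancel_left] at h2

/-- In a Weil step, a central element acts without fixed points. -/
theorem IsWeilStep.exists_sub_surjective {D' : FormSpace.{u}} {Φ : D.GE →* D'.G}
    (h : IsWeilStep D D' Φ) (hb : IsNondeg D.hat) :
    ∃ s : D.E, ∀ x : D'.V, ∃ y, (Φ (SemidirectProduct.inl s)).1 y - y = x := by
  have hscalar : ∀ {W : Type u} [AddCommGroup W] [Module D'.K W] [FiniteDimensional D'.K W]
      {ρ : Representation D'.K D.E W}, IsFaithfulAbsIrr ρ → ∃ c : D'.K, c ≠ 1 ∧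
        c ≠ 0 ∧ ∀ w, ρ ⟨0, 1⟩ w = c • w := by
    intro W _ _ _ ρ hρ
    obtain ⟨ψ, hψ⟩ := exists_isWeil hb hρ
    refine ⟨ψ 1, fun h1 => one_ne_zero ((char_eq_one_iff hψ.ne_one).1 h1), char_ne_zero 1,
      fun w => ?_⟩
    rw [hψ.apply_eq, hψ.isTwisted.map_zero]
    rfl
  refine ⟨⟨0, 1⟩, fun x => ?_⟩
  obtain ⟨-, -, ⟨-, W, _, _, σ, e, hσ, he, hdouble⟩ | ⟨-, hρ, -⟩⟩ := h
  · have : FiniteDimensional D'.K W := Module.Finite.of_surjective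
      ((LinearMap.snd D'.K (Module.Dual D'.K W) W).comp e.toLinearMap)
      (Prod.snd_surjective.comp e.surjective)
    obtain ⟨c, hc1, hc0, hc⟩ := hscalar hσ
    have hcinv : ∀ w, σ (SemidirectProduct.inl ⟨0, 1⟩)⁻¹ w = c⁻¹ • w := by
      intro w
      have h1 : σ (SemidirectProduct.inl ⟨0, 1⟩) (c⁻¹ • w) = w := by
        refine (hc _).trans ?_
        rw [smul_smul, mul_inv_cancel₀ hc0, one_smul]
      nth_rw 1 [← h1]
      rw [← Module.End.mul_apply, ← map_mul, inv_mul_cancel, map_one, Module.End.one_apply]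
    -- The central element acts by `c` on `W` and by `c⁻¹` on `W*`; since `c ≠ 1`, both `c - 1` and
    -- `c⁻¹ - 1` can be inverted.
    refine ⟨e.symm ((c⁻¹ - 1)⁻¹ • (e x).1, (c - 1)⁻¹ • (e x).2), e.injective ?_⟩
    rw [map_sub, hdouble, LinearEquiv.apply_symm_apply]
    have hc' : c⁻¹ - 1 ≠ 0 := sub_ne_zero.2 fun h => hc1 (inv_eq_one.1 h)
    refine Prod.ext ?_ ?_
    · ext w
      change ((c⁻¹ - 1)⁻¹ • (e x).1) (σ (SemidirectProduct.inl ⟨0, 1⟩)⁻¹ w) -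
        ((c⁻¹ - 1)⁻¹ • (e x).1) w = (e x).1 w
      rw [hcinv, map_smul, LinearMap.smul_apply, smul_eq_mul, smul_eq_mul, ← sub_one_mul,
        mul_inv_cancel_left₀ hc']
    · change σ (SemidirectProduct.inl ⟨0, 1⟩) _ - _ = _
      exact (congrArg (· - (c - 1)⁻¹ • (e x).2) (hc _)).trans (smul_inv_sub_one_sub hc1 _)
  · obtain ⟨c, hc1, -, hc⟩ := hscalar hρ
    refine ⟨(c - 1)⁻¹ • x, ?_⟩
    exact (congrArg (· - (c - 1)⁻¹ • x) (hc _)).trans (smul_inv_sub_one_sub hc1 _)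

end SplitExtension

/-! ### Generation by vectors `g y - y` -/

namespace FormSpace

variable {D : FormSpace.{u}}

theorem hat_eq_of_f_eq {x y x' y' : D.V} (h : D.f x y = D.f x' y') : D.hat x y = D.hat x' y' := by
  rw [hat_apply, hat_apply, h]

/-- Scalars of norm one preserve the form. -/
def scalarG (z : D.K) (hz : z * D.η z = 1) : D.G :=
  ⟨LinearEquiv.smulOfNeZero D.K D.V z (left_ne_zero_of_mul_eq_one hz), hat_smul z hz⟩

theorem closure_sub_eq_top_of_scalar (z : D.K) (hz : z * D.η z = 1) (hz1 : z ≠ 1) :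
    AddSubgroup.closure {w | ∃ g : D.G, ∃ y, g.1 y - y = w} = ⊤ := by
  refine eq_top_iff.2 fun x _ => AddSubgroup.subset_closure
    ⟨scalarG z hz, (z - 1)⁻¹ • x, ?_⟩
  exact smul_inv_sub_one_sub hz1 x

section SplitForms

variable {W : Type u} [AddCommGroup W] [Module D.K W] {e : D.V ≃ₗ[D.K] Module.Dual D.K W × W}

/-- An automorphism of `W` as an automorphism of `W* ⊕ W`. -/
def splitG (he : D.IsSplitVia e) (h : W ≃ₗ[D.K] W) : D.G :=
  ⟨(e.trans (h.symm.dualMap.prodCongr h)).trans e.symm, fun x y => hat_eq_of_f_eq (by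
    rw [he.2.1, he.2.1]
    simp)⟩

theorem splitG_apply (he : D.IsSplitVia e) (h : W ≃ₗ[D.K] W) (a : Module.Dual D.K W × W) :
    (splitG he h).1 (e.symm a) = e.symm (a.1.comp h.symm.toLinearMap, h a.2) := by
  change e.symm ((h.symm.dualMap.prodCongr h) (e (e.symm a))) = _
  rw [LinearEquiv.apply_symm_apply]
  rfl

/-- A scalar `c ≠ 0, 1` acting on `W`, together with `c⁻¹` on `W*`, fixes no nonzero vector. If `|K|
= 2` there is no such scalar, but outside the excluded case `dim W ≥ 2`, and transvections produce
every vector of `W` and every functional. -/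
theorem closure_sub_eq_top_of_split (he : D.IsSplitVia e)
    (hD : ¬ (Nat.card D.K = 2 ∧ Nat.card D.V = 4)) :
    AddSubgroup.closure {w | ∃ g : D.G, ∃ y, g.1 y - y = w} = ⊤ := by
  have : FiniteDimensional D.K W := Module.Finite.of_surjective
    ((LinearMap.snd D.K (Module.Dual D.K W) W).comp e.toLinearMap)
    (Prod.snd_surjective.comp e.surjective)
  by_cases hK : Nat.card D.K = 2
  · have hfr : 1 < Module.finrank D.K W := by
      have h1 : Module.finrank D.K D.V = 2 * Module.finrank D.K W := by
        rw [e.finrank_eq, Module.finrank_prod, Subspace.dual_finrank_eq, two_mul]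
      have h2 : 0 < Module.finrank D.K D.V := Module.finrank_pos
      by_contra! h3
      have h4 : Module.finrank D.K D.V = 2 := by omega
      apply hD
      rw [Module.natCard_eq_pow_finrank (K := D.K) (V := D.V), h4, hK]
      exact ⟨rfl, rfl⟩
    have h1 : ∀ w : W, ∃ g : D.G, ∃ y, g.1 y - y = e.symm (0, w) := by
      intro w
      -- The transvection defined by `φ` and `w` takes `y` to `y + w`.
      obtain ⟨φ, y, hw, hy⟩ : ∃ (φ : Module.Dual D.K W) (y : W), φ w = 0 ∧ φ y = 1 := by
        have hlt : Submodule.span D.K {w} ≠ ⊤ := by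
          intro htop
          have h2 := finrank_span_le_card (R := D.K) ({w} : Set W)
          rw [htop, finrank_top, Set.toFinset_singleton, Finset.card_singleton] at h2
          omega
        obtain ⟨φ, hφ, hle⟩ := Submodule.exists_le_ker_of_lt_top _ (lt_top_iff_ne_top.2 hlt)
        obtain ⟨y, hy⟩ := LinearMap.surjective hφ 1
        exact ⟨φ, y, hle (Submodule.mem_span_singleton_self w), hy⟩
      refine ⟨splitG he (LinearEquiv.transvection hw), e.symm (0, y), ?_⟩
      rw [splitG_apply, ← map_sub]
      simp [LinearMap.transvection.apply, hy]
    have h2 : ∀ α : Module.Dual D.K W, ∃ g : D.G, ∃ y, g.1 y - y = e.symm (α, 0) := by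
      intro α
      -- Composition with the transvection defined by `α` and `w` takes `β` to `β + β(w) α`, and `β`
      -- is chosen with `β(w) = 1`. The inverse in the witness compensates for the contragredient
      -- action.
      obtain ⟨w, hw0, hw⟩ : ∃ w : W, w ≠ 0 ∧ α w = 0 := by
        have h2 : LinearMap.ker α ≠ ⊥ := fun h2 => by
          have h3 := LinearMap.finrank_le_finrank_of_injective (LinearMap.ker_eq_bot.1 h2)
          rw [Module.finrank_self] at h3
          omega
        obtain ⟨w, hw, hw0⟩ := Submodule.exists_mem_ne_zero_of_ne_bot h2
        exact ⟨w, hw0, hw⟩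
      obtain ⟨β, hβ⟩ := Module.Projective.exists_dual_eq_one D.K hw0
      refine ⟨splitG he (LinearEquiv.transvection hw).symm, e.symm (β, 0), ?_⟩
      rw [splitG_apply, ← map_sub]
      congr 1
      refine Prod.ext ?_ (by simp)
      ext x
      simp [LinearMap.transvection.apply, hβ]
    refine eq_top_iff.2 fun x _ => ?_
    have h3 : x = e.symm ((e x).1, 0) + e.symm (0, (e x).2) := by
      rw [← map_add, Prod.mk_add_mk, add_zero, zero_add]
      simp
    rw [h3]
    exact AddSubgroup.add_mem _ (AddSubgroup.subset_closure (h2 _))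
      (AddSubgroup.subset_closure (h1 _))
  · obtain ⟨c, hc0, hc1⟩ : ∃ c : D.K, c ≠ 0 ∧ c ≠ 1 := by
      classical
      have := Fintype.ofFinite D.K
      by_contra! h
      apply hK
      have huniv : (Finset.univ : Finset D.K) = {0, 1} := by
        ext c
        by_cases hc : c = 0 <;> simp [hc, h c]
      rw [Nat.card_eq_fintype_card, ← Finset.card_univ, huniv, Finset.card_pair zero_ne_one]
    refine eq_top_iff.2 fun x _ => AddSubgroup.subset_closure
      ⟨splitG he (LinearEquiv.smulOfNeZero D.K W c hc0),
        e.symm ((c⁻¹ - 1)⁻¹ • (e x).1, (c - 1)⁻¹ • (e x).2), ?_⟩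
    have hc' : c⁻¹ - 1 ≠ 0 := sub_ne_zero.2 fun h => hc1 (inv_eq_one.1 h)
    rw [splitG_apply, ← map_sub, LinearEquiv.symm_apply_eq]
    refine Prod.ext ?_ ?_
    · ext w
      have h1 : (LinearEquiv.smulOfNeZero D.K W c hc0).symm w = c⁻¹ • w := by
        rw [LinearEquiv.symm_apply_eq]
        change w = c • c⁻¹ • w
        rw [smul_smul, mul_inv_cancel₀ hc0, one_smul]
      change ((c⁻¹ - 1)⁻¹ • (e x).1) ((LinearEquiv.smulOfNeZero D.K W c hc0).symm w) -
        ((c⁻¹ - 1)⁻¹ • (e x).1) w = (e x).1 w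
      rw [h1, map_smul, LinearMap.smul_apply, smul_eq_mul, smul_eq_mul, ← sub_one_mul,
        mul_inv_cancel_left₀ hc']
    · exact smul_inv_sub_one_sub hc1 (e x).2

end SplitForms

/-- For the other two types a scalar of norm one different from `1` suffices: `-1` in the
alternating case and `λ / η(λ)` in the Hermitian case. -/
theorem closure_sub_eq_top (h : D.IsAdmissible) (hD : ¬ (Nat.card D.K = 2 ∧ Nat.card D.V = 4)) :
    AddSubgroup.closure {w | ∃ g : D.G, ∃ y, g.1 y - y = w} = ⊤ := by
  rcases h with h | ⟨W, _, _, e, h⟩ | h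
  · refine closure_sub_eq_top_of_scalar (-1) (by rw [map_neg, map_one]; norm_num) fun h1 => ?_
    have h2 : (2 : D.K) ≠ 0 := by
      intro h2
      have h3 : D.p ∣ 2 := (CharP.cast_eq_zero_iff D.K D.p 2).1 (by exact_mod_cast h2)
      exact h.2.1 ((Nat.prime_dvd_prime_iff_eq D.prime.out Nat.prime_two).1 h3)
    exact h2 (by linear_combination -h1)
  · exact closure_sub_eq_top_of_split h hD
  · have h0 := h.lam_ne_zero
    have h1 : D.η D.lam ≠ 0 := (map_ne_zero D.η).2 h0
    refine closure_sub_eq_top_of_scalar (D.lam / D.η D.lam) ?_ fun h2 => ?_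
    · rw [map_div₀, h.2.1]
      field_simp
    · exact h.2.2.2.2 ((div_eq_one_iff_eq h1).1 h2).symm

end FormSpace

/-! ### The iterated split extension -/

section Tower

variable (D : ℕ → FormSpace.{u}) (Φ : ∀ i, (D i).GE →* (D (i + 1)).G)

/-- The projection `Γ_{n+1} → Γ_n`. -/
def down (n : ℕ) : (iter D Φ (n + 1)).Γ →* (iter D Φ n).Γ :=
  (SemidirectProduct.rightHom : (iter D Φ n).Ext →* (iter D Φ n).Γ)

/-- The embedding `E(f̂_n) → Γ_{n+1}`. -/
def emb (n : ℕ) : (D n).E →* (iter D Φ (n + 1)).Γ :=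
  (SemidirectProduct.inl : (D n).E →* (iter D Φ n).Ext)

theorem down_surjective (n : ℕ) : Function.Surjective (down D Φ n) :=
  SemidirectProduct.rightHom_surjective

theorem emb_injective (n : ℕ) : Function.Injective (emb D Φ n) :=
  SemidirectProduct.inl_injective

theorem range_emb (n : ℕ) : (emb D Φ n).range = (down D Φ n).ker :=
  SemidirectProduct.range_inl_eq_ker_rightHom

theorem series_succ_of_le {n i : ℕ} (h : i ≤ n) :
    series D Φ (n + 1) i = (series D Φ n i).comap (down D Φ n) := if_pos h

theorem series_self (n : ℕ) : series D Φ n n = ⊥ := by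
  cases n with
  | zero => rfl
  | succ n => exact if_neg (by omega)

theorem series_succ_self (n : ℕ) : series D Φ (n + 1) n = (down D Φ n).ker := by
  rw [series_succ_of_le D Φ le_rfl, series_self]
  rfl

theorem toBase_surjective (n : ℕ) : Function.Surjective (toBase D Φ n) := by
  induction n with
  | zero => exact Function.surjective_id
  | succ n ih => exact ih.comp (down_surjective D Φ n)

theorem series_zero (n : ℕ) : series D Φ n 0 = (toBase D Φ n).ker := by
  induction n with
  | zero => exact ((MonoidHom.ker_eq_bot_iff _).2 Function.injective_id).symm
  | succ n ih =>
    rw [series_succ_of_le D Φ (Nat.zero_le n), ih]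
    rfl

theorem series_normal (n i : ℕ) : (series D Φ n i).Normal := by
  induction n with
  | zero => exact Subgroup.normal_bot
  | succ n ih =>
    by_cases h : i ≤ n
    · rw [series_succ_of_le D Φ h]
      exact ih.comap _
    · rw [series, if_neg h]
      exact Subgroup.normal_bot

theorem series_lt {n i : ℕ} (h : i < n) : series D Φ n (i + 1) < series D Φ n i := by
  induction n with
  | zero => omega
  | succ n ih =>
    rcases (Nat.lt_succ_iff.1 h).lt_or_eq with hi | rfl
    · rw [series_succ_of_le D Φ hi, series_succ_of_le D Φ hi.le]
      exact (Subgroup.comap_lt_comap_of_surjective (down_surjective D Φ n)).2 (ih hi)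
    · rw [series_self, series_succ_self, bot_lt_iff_ne_bot, ← range_emb]
      intro h0
      obtain ⟨x, hx⟩ := exists_ne (0 : (D i).V)
      have h1 : emb D Φ i ⟨x, 0⟩ ∈ (emb D Φ i).range := ⟨_, rfl⟩
      rw [h0, Subgroup.mem_bot, map_eq_one_iff _ (emb_injective D Φ i)] at h1
      exact hx (congrArg EGroup.x h1)

theorem series_antitone {n i j : ℕ} (hij : i ≤ j) (hj : j ≤ n) :
    series D Φ n j ≤ series D Φ n i := by
  induction j, hij using Nat.le_induction with
  | base => exact le_rfl
  | succ j _ ih => exact (series_lt D Φ hj).le.trans (ih (by omega))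

theorem exists_series_hom {n i : ℕ} (h : i < n) : ∃ φ : series D Φ n i →* (D i).E,
    Function.Surjective φ ∧ φ.ker = (series D Φ n (i + 1)).subgroupOf (series D Φ n i) := by
  induction n with
  | zero => omega
  | succ n ih =>
    rcases (Nat.lt_succ_iff.1 h).lt_or_eq with hi | rfl
    · obtain ⟨φ, hφ, hker⟩ := ih hi
      rw [series_succ_of_le D Φ hi, series_succ_of_le D Φ hi.le]
      let r := (down D Φ n).subgroupComap (series D Φ n i)
      have hr : Function.Surjective r :=
        MonoidHom.subgroupComap_surjective_of_surjective _ _ (down_surjective D Φ n)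
      refine ⟨φ.comp r, hφ.comp hr, ?_⟩
      rw [← MonoidHom.comap_ker, hker]
      rfl
    · rw [series_self, series_succ_self, ← range_emb]
      let e := MonoidHom.ofInjective (emb_injective D Φ i)
      refine ⟨e.symm.toMonoidHom, e.symm.surjective, ?_⟩
      rw [(MonoidHom.ker_eq_bot_iff _).2 e.symm.injective, Subgroup.bot_subgroupOf]

theorem exists_series_quotient {n i : ℕ} (h : i < n) :
    ∃ _ : ((series D Φ n (i + 1)).subgroupOf (series D Φ n i)).Normal,
      Nonempty ((series D Φ n i ⧸ (series D Φ n (i + 1)).subgroupOf (series D Φ n i)) ≃*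
        (D i).E) := by
  obtain ⟨φ, hφ, hker⟩ := exists_series_hom D Φ h
  exact exists_quotientEquiv_of_ker φ hφ hker

variable {D Φ}

theorem ker_down_le {n : ℕ} (hb : IsNondeg (D n).hat) (H : Subgroup (iter D Φ n).Γ)
    (hH : AddSubgroup.closure {w | ∃ g ∈ H, ∃ y, ((iter D Φ n).hom g).1 y - y = w} = ⊤) :
    (down D Φ n).ker ≤ ⁅H.comap (down D Φ n), H.comap (down D Φ n)⁆ :=
  ker_rightHom_le (iter D Φ n) hb H hH

theorem hom_emb (n : ℕ) (s : (D n).E) :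
    (iter D Φ (n + 1)).hom (emb D Φ n s) = Φ n (SemidirectProduct.inl s) := by
  change Φ n ((iter D Φ n).extHom (SemidirectProduct.inl s)) = _
  congr 1
  exact SemidirectProduct.map_inl _ _ _ _

/-- The layer `E(f_n)` lies in every earlier term of the series, and its central element `(0, 1)`
acts on the next space with `g - 1` surjective. So commutators with it already fill the new layer.
-/
theorem ker_down_le_series {n i : ℕ} (hb : IsNondeg (D n).hat) (hb' : IsNondeg (D (n + 1)).hat)
    (hΦ : IsWeilStep (D n) (D (n + 1)) (Φ n)) (hi : i ≤ n) :
    (down D Φ (n + 1)).ker ≤ ⁅(series D Φ (n + 1) i).comap (down D Φ (n + 1)),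
      (series D Φ (n + 1) i).comap (down D Φ (n + 1))⁆ := by
  refine ker_down_le hb' _ (eq_top_iff.2 fun x _ => AddSubgroup.subset_closure ?_)
  obtain ⟨s, hs⟩ := hΦ.exists_sub_surjective hb
  obtain ⟨y, hy⟩ := hs x
  refine ⟨emb D Φ n s, series_antitone D Φ hi (Nat.le_succ n) ?_, y, ?_⟩
  · rw [series_succ_self, ← range_emb]
    exact ⟨s, rfl⟩
  · rw [hom_emb, hy]

theorem series_le_derived {n i : ℕ} (hD : ∀ i < n, (D i).IsAdmissible)
    (hΦ : ∀ i, i + 1 < n → IsWeilStep (D i) (D (i + 1)) (Φ i)) (h : i < n) :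
    series D Φ n (i + 1) ≤ ⁅series D Φ n i, series D Φ n i⁆ := by
  induction n with
  | zero => omega
  | succ n ih =>
    rcases (Nat.lt_succ_iff.1 h).lt_or_eq with hi | rfl
    · have h1 := ih (fun i hi => hD i (by omega)) (fun i hi => hΦ i (by omega)) hi
      rw [series_succ_of_le D Φ hi, series_succ_of_le D Φ hi.le]
      refine comap_le_commutator (down_surjective D Φ n) h1 ?_
      obtain ⟨m, rfl⟩ : ∃ m, n = m + 1 := ⟨n - 1, by omega⟩
      exact ker_down_le_series (hD m (by omega)).isNondeg (hD (m + 1) (by omega)).isNondeg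
        (hΦ m (by omega)) (by omega)
    · rw [series_self]
      exact bot_le

theorem series_isExtraspecialSeries {n : ℕ} (hD : ∀ i < n, (D i).IsAdmissible)
    (hΦ : ∀ i, i + 1 < n → IsWeilStep (D i) (D (i + 1)) (Φ i)) :
    IsExtraspecialSeries n (series D Φ n) where
  normal i _ := series_normal D Φ n i
  lt _ hi := series_lt D Φ hi
  extraspecial i hi := by
    obtain ⟨hn, ⟨e⟩⟩ := exists_series_quotient D Φ hi
    exact ⟨hn, (D i).p, (D i).prime.out,
      (EGroup.isExtraspecial (hD i hi).isNondeg).of_mulEquiv e.symm⟩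
  le_derived _ hi := series_le_derived hD hΦ hi

theorem series_isExtraspecialTower {n : ℕ} (hD : ∀ i < n, (D i).IsAdmissible)
    (hΦ : ∀ i, i + 1 < n → IsWeilStep (D i) (D (i + 1)) (Φ i)) :
    IsExtraspecialTower n (series D Φ n 0) := by
  refine ⟨fun i => (series D Φ n i).subgroupOf (series D Φ n 0), Subgroup.subgroupOf_self _, ?_,
    isExtraspecialSeries_subgroupOf (series_isExtraspecialSeries hD hΦ)⟩
  beta_reduce
  rw [series_self, Subgroup.bot_subgroupOf]

theorem series_le_commutator {n : ℕ} (hD : ∀ i < n, (D i).IsAdmissible)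
    (hΦ : ∀ i, i + 1 < n → IsWeilStep (D i) (D (i + 1)) (Φ i))
    (h0 : ¬ (Nat.card (D 0).K = 2 ∧ Nat.card (D 0).V = 4)) :
    series D Φ n 0 ≤ commutator (iter D Φ n).Γ := by
  induction n with
  | zero => exact bot_le
  | succ n ih =>
    have h1 := ih (fun i hi => hD i (by omega)) (fun i hi => hΦ i (by omega))
    rw [series_succ_of_le D Φ (Nat.zero_le n), commutator_def,
      ← Subgroup.comap_top (down D Φ n)]
    refine comap_le_commutator (down_surjective D Φ n) h1 ?_
    -- Only for the lowest layer must `G(f_1)` itself supply the commutators; hence the exceptional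
    -- case.
    rcases n with _ | m
    · refine ker_down_le (hD 0 (by omega)).isNondeg _ ?_
      rw [← closure_sub_eq_top (hD 0 (by omega)) h0]
      congr 1
      ext w
      exact ⟨fun ⟨g, _, y, hy⟩ => ⟨g, y, hy⟩, fun ⟨g, y, hy⟩ => ⟨g, trivial, y, hy⟩⟩
    · refine (ker_down_le_series (hD m (by omega)).isNondeg (hD (m + 1) (by omega)).isNondeg
        (hΦ m (by omega)) le_rfl).trans ?_
      exact Subgroup.commutator_mono (Subgroup.comap_mono le_top) (Subgroup.comap_mono le_top)

theorem iter_hom_injective {n : ℕ} (hΦ : ∀ i < n, IsWeilStep (D i) (D (i + 1)) (Φ i)) :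
    Function.Injective (iter D Φ n).hom := by
  induction n with
  | zero => exact Function.injective_id
  | succ n ih =>
    have h1 := ih fun i hi => hΦ i (by omega)
    refine (hΦ n (by omega)).2.1.comp fun a a' haa => ?_
    refine SemidirectProduct.ext ?_ (h1 ?_)
    · exact congrArg (fun t : (D n).GE => t.left) haa
    · exact congrArg (fun t : (D n).GE => t.right) haa

end Tower

/-! ### The example -/

section Example

theorem mem_symplecticGroup_fin_one_iff {R : Type*} [CommRing R]
    (A : Matrix (Fin 1 ⊕ Fin 1) (Fin 1 ⊕ Fin 1) R) :
    A ∈ Matrix.symplecticGroup (Fin 1) R ↔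
      A (.inl 0) (.inl 0) * A (.inr 0) (.inr 0) -
        A (.inl 0) (.inr 0) * A (.inr 0) (.inl 0) = 1 := by
  rw [SymplecticGroup.mem_iff]
  constructor
  · intro h
    have h1 := congrFun (congrFun h (.inr 0)) (.inl 0)
    simp [Matrix.mul_apply, Matrix.J, Fintype.sum_sum_type, Matrix.fromBlocks] at h1
    linear_combination h1
  · intro h
    ext (i | i) (j | j)
    all_goals
      rw [Subsingleton.elim i 0, Subsingleton.elim j 0]
      simp [Matrix.mul_apply, Matrix.J, Fintype.sum_sum_type, Matrix.fromBlocks]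
    · ring
    · linear_combination -h
    · linear_combination h
    · ring

variable {D : FormSpace.{u}}

theorem FormSpace.IsAlternating.nonempty_mulEquiv_symplectic (h : D.IsAlternating)
    (hK : Nat.card D.K = 3) (hfr : Module.finrank D.K D.V = 2) :
    Nonempty (D.G ≃* Matrix.symplecticGroup (Fin 1) (ZMod 3)) := by
  have := Fintype.ofFinite D.K
  obtain ⟨hη, hp, halt, hnd, hlam⟩ := h
  have hηc : ∀ c, D.η c = c := RingHom.congr_fun hη
  have hadm : D.IsAdmissible := Or.inl ⟨hη, hp, halt, hnd, hlam⟩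
  let κ : D.K ≃+* ZMod 3 := (ZMod.ringEquivOfPrime D.K Nat.prime_three (by
    rw [← Nat.card_eq_fintype_card, hK])).symm
  let B : Module.Basis (Fin 1 ⊕ Fin 1) D.K D.V :=
    (Module.finBasisOfFinrankEq D.K D.V hfr).reindex (finSumFinEquiv (m := 1) (n := 1)).symm
  set x := B (.inl 0) with hx
  set y := B (.inr 0) with hy
  have hyx : D.f y x = -D.f x y := by
    have h1 := halt (x + y)
    rw [map_add, map_add, LinearMap.add_apply, LinearMap.add_apply, halt x, halt y] at h1
    linear_combination h1
  have hrepr : ∀ u, u = B.repr u (.inl 0) • x + B.repr u (.inr 0) • y := fun u => by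
    conv_lhs => rw [← B.sum_repr u]
    rw [Fintype.sum_sum_type]
    simp [hx, hy]
  -- In a basis an alternating form on a plane is a nonzero multiple of the determinant, so its
  -- isometries are the matrices of determinant one, which make up `Sp₂`.
  have hf' : ∀ a b c d : D.K, D.f (a • x + b • y) (c • x + d • y) = (a * d - b * c) * D.f x y := by
    intro a b c d
    simp only [map_add, map_smul, LinearMap.add_apply, LinearMap.smul_apply,
      LinearMap.map_smulₛₗ, hηc, smul_eq_mul, halt x, halt y, hyx]
    ring
  have hxy : D.f x y ≠ 0 := by
    intro h0
    refine B.ne_zero (.inl 0) (hnd.1 _ fun u => ?_)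
    have h1 := hf' 1 0 (B.repr u (.inl 0)) (B.repr u (.inr 0))
    rw [h0, mul_zero, ← hrepr u, one_smul, zero_smul, add_zero] at h1
    exact h1
  let Θ : Module.End D.K D.V ≃+* Matrix (Fin 1 ⊕ Fin 1) (Fin 1 ⊕ Fin 1) (ZMod 3) :=
    (LinearMap.toMatrixAlgEquiv B).toRingEquiv.trans κ.mapMatrix
  have hΘ : ∀ T i j, Θ T i j = κ (B.repr (T (B j)) i) := fun T i j =>
    congrArg κ (LinearMap.toMatrixAlgEquiv_apply B T i j)
  have hmem : ∀ T : Module.End D.K D.V, Θ T ∈ Matrix.symplecticGroup (Fin 1) (ZMod 3) ↔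
      ∀ u v, D.f (T u) (T v) = D.f u v := by
    intro T
    rw [mem_symplecticGroup_fin_one_iff]
    simp only [hΘ, ← map_mul, ← map_sub, ← hx, ← hy]
    rw [map_eq_one_iff κ κ.injective]
    set a := B.repr (T x) (.inl 0)
    set b := B.repr (T x) (.inr 0)
    set c := B.repr (T y) (.inl 0)
    set d := B.repr (T y) (.inr 0)
    have hTx : T x = a • x + b • y := hrepr _
    have hTy : T y = c • x + d • y := hrepr _
    constructor
    · intro h1 u v
      rw [hrepr u, hrepr v]
      generalize B.repr u (.inl 0) = α
      generalize B.repr u (.inr 0) = β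
      generalize B.repr v (.inl 0) = γ
      generalize B.repr v (.inr 0) = δ
      have e1 : ∀ α β : D.K, T (α • x + β • y) =
          (α * a + β * c) • x + (α * b + β * d) • y := fun α β => by
        rw [map_add, map_smul, map_smul, hTx, hTy]
        module
      rw [e1, e1, hf', hf']
      linear_combination (α * δ - β * γ) * D.f x y * h1
    · intro h1
      have h2 := h1 x y
      rw [hTx, hTy, hf'] at h2
      apply mul_right_cancel₀ hxy
      linear_combination h2
  let φ : D.G →* Matrix.symplecticGroup (Fin 1) (ZMod 3) :=
    { toFun := fun g => ⟨Θ g.1.toLinearMap, (hmem _).2 ((hadm.mem_G_iff g.1).1 g.2)⟩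
      map_one' := Subtype.ext (map_one Θ)
      map_mul' := fun g g' => Subtype.ext (map_mul Θ g.1.toLinearMap g'.1.toLinearMap) }
  refine ⟨MulEquiv.ofBijective φ ⟨fun g g' hgg => ?_, fun A => ?_⟩⟩
  · have h1 : Θ g.1.toLinearMap = Θ g'.1.toLinearMap := congrArg Subtype.val hgg
    exact Subtype.ext (LinearEquiv.toLinearMap_injective (Θ.injective h1))
  · obtain ⟨T, hT⟩ := Θ.surjective A.1
    have hTf := (hmem T).1 (hT ▸ A.2)
    have hinj : Function.Injective T := by
      rw [injective_iff_map_eq_zero]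
      intro u hu
      refine hnd.1 u fun v => ?_
      rw [← hTf, hu, map_zero]
      rfl
    exact ⟨⟨LinearEquiv.ofInjectiveEndo T hinj, (hadm.mem_G_iff _).2 hTf⟩, Subtype.ext hT⟩

theorem orderOf_two_of_eq_three {p : ℕ} (hp : p = 3) : orderOf ((2 : ℕ) : ZMod p) = 2 := by
  subst hp
  exact orderOf_eq_prime (by decide) (by decide)

theorem orderOf_three_of_eq_two {p : ℕ} (hp : p = 2) : orderOf ((3 : ℕ) : ZMod p) = 1 := by
  subst hp
  exact orderOf_eq_one_iff.2 (by decide)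

theorem exponents_succ_of_even {i : ℕ} (h : Even i) : exponents (i + 1) = 3 ^ exponents i := by
  rw [exponents, if_pos h]

theorem exponents_succ_of_odd {i : ℕ} (h : Odd i) : exponents (i + 1) = 2 ^ (exponents i - 1) := by
  rw [exponents, if_neg (Nat.not_even_iff_odd.2 h)]

/-- This parity keeps the dimensions of the Hermitian spaces odd, so that no doubling occurs there.
-/
theorem odd_exponents {i : ℕ} (h : Odd i) : Odd (exponents i) := by
  obtain ⟨m, rfl⟩ := h
  rw [exponents_succ_of_even (even_two_mul m)]
  exact Odd.pow (by decide)

/-- The order of `2` modulo `3` is `2`, which is even. So there is no doubling, the new field has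
`4` elements, and the square of the new dimension is `3^(2n)`. -/
theorem FormSpace.IsAlternating.exists_step_hermitian (h : D.IsAlternating)
    (hK : Nat.card D.K = 3) {n : ℕ} (hfr : Module.finrank D.K D.V = 2 * n) :
    ∃ (D' : FormSpace.{u}) (Φ : D.GE →* D'.G), IsWeilStep D D' Φ ∧ D'.IsHermitian ∧
      Nat.card D'.K = 4 ∧ Module.finrank D'.K D'.V = 3 ^ n := by
  have hp : D.p = 3 := p_eq_of_card Nat.prime_three (k := 1) hK
  have hp2 : D.p ≠ 2 := h.2.1
  have hord := orderOf_two_of_eq_three hp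
  obtain ⟨D', Φ, -, hp', hΦ, hcard, hdim⟩ := exists_isWeilStep (Or.inl h) Nat.prime_two hp2.symm
  have hnd : ¬ NeedsDouble D 2 := by
    rw [needsDouble_iff_of_odd hp2, hord]
    decide
  refine ⟨D', Φ, hΦ, ?_, by rw [hcard, hord]; norm_num, ?_⟩
  · obtain ⟨-, -, h1 | h1⟩ := hΦ
    · exact absurd (hp' ▸ h1.1) hnd
    · exact h1.2.2.2 hp2
  · have h1 := hdim hnd
    rw [Module.natCard_eq_pow_finrank (K := D.K) (V := D.V), hK, hfr, mul_comm, pow_mul] at h1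
    exact Nat.pow_left_injective two_ne_zero h1

/-- The order of `3` modulo `2` is `1`, so the new field has `3` elements; the square of the new
dimension is `4^n`. -/
theorem FormSpace.IsHermitian.exists_step_alternating (h : D.IsHermitian) (hK : Nat.card D.K = 4)
    {n : ℕ} (hfr : Module.finrank D.K D.V = n) (hn : Odd n) :
    ∃ (D' : FormSpace.{u}) (Φ : D.GE →* D'.G), IsWeilStep D D' Φ ∧ D'.IsAlternating ∧
      Nat.card D'.K = 3 ∧ Module.finrank D'.K D'.V = 2 * 2 ^ (n - 1) := by
  have hp : D.p = 2 := p_eq_two_of_card_four hK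
  have hord := orderOf_three_of_eq_two hp
  obtain ⟨D', Φ, -, hp', hΦ, hcard, hdim⟩ := exists_isWeilStep (Or.inr (Or.inr h))
    Nat.prime_three (by rw [hp]; norm_num)
  have hnd := h.not_needsDouble hK (hfr ▸ hn)
  refine ⟨D', Φ, hΦ, ?_, by rw [hcard, hord, pow_one], ?_⟩
  · obtain ⟨-, -, h1 | h1⟩ := hΦ
    · exact absurd h1.1 (hnd _)
    · exact h1.2.2.1 hp
  · have h1 := hdim (hnd 3)
    rw [Module.natCard_eq_pow_finrank (K := D.K) (V := D.V), hK, hfr, show 4 = 2 ^ 2 by norm_num,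
      ← pow_mul, mul_comm, pow_mul] at h1
    rw [Nat.pow_left_injective two_ne_zero h1, ← pow_succ', Nat.sub_add_cancel hn.pos]

theorem exists_example (h : D.IsAlternating) (hK : Nat.card D.K = 3)
    (hfr : Module.finrank D.K D.V = 2) :
    ∃ (D' : ℕ → FormSpace.{u}) (Φ : ∀ i, (D' i).GE →* (D' (i + 1)).G),
      D' 0 = D ∧
      (∀ i, IsWeilStep (D' i) (D' (i + 1)) (Φ i)) ∧
      (∀ i, Even i → (D' i).IsAlternating ∧ Nat.card (D' i).K = 3 ∧
        Module.finrank (D' i).K (D' i).V = 2 * exponents i ∧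
        IsEPower 3 (exponents i) (D' i).E) ∧
      (∀ i, Odd i → (D' i).IsHermitian ∧ Nat.card (D' i).K = 4 ∧
        Module.finrank (D' i).K (D' i).V = exponents i ∧
        IsQPower (exponents i) (D' i).E) := by
  obtain ⟨D', Φ, h0, hstep⟩ := exists_sequence
    (fun i D => (Even i → D.IsAlternating ∧ Nat.card D.K = 3 ∧
      Module.finrank D.K D.V = 2 * exponents i) ∧ (Odd i → D.IsHermitian ∧ Nat.card D.K = 4 ∧
      Module.finrank D.K D.V = exponents i)) (fun i D hD => by
      rcases Nat.even_or_odd i with hi | hi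
      · obtain ⟨h1, h2, h3⟩ := hD.1 hi
        obtain ⟨D', Φ, h4, h5⟩ := h1.exists_step_hermitian h2 h3
        refine ⟨D', Φ, h4, fun hi' => absurd hi' (Nat.not_even_iff_odd.2 hi.add_one), fun _ => ?_⟩
        rwa [exponents_succ_of_even hi]
      · obtain ⟨h1, h2, h3⟩ := hD.2 hi
        obtain ⟨D', Φ, h4, h5⟩ := h1.exists_step_alternating h2 h3 (odd_exponents hi)
        refine ⟨D', Φ, h4, fun _ => ?_, fun hi' => absurd hi.add_one (Nat.not_even_iff_odd.2 hi')⟩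
        rwa [exponents_succ_of_odd hi]) (D₁ := D)
      ⟨fun _ => ⟨h, hK, hfr⟩, fun h1 => absurd h1 (by decide)⟩
  refine ⟨D', Φ, h0, fun i => (hstep i).2, fun i hi => ?_, fun i hi => ?_⟩
  · obtain ⟨h1, h2, h3⟩ := (hstep i).1.1 hi
    refine ⟨h1, h2, h3, ?_⟩
    have hp : (D' i).p = 3 := p_eq_of_card Nat.prime_three (k := 1) h2
    rw [← hp]
    refine h1.isEPower ?_
    rw [Module.natCard_eq_pow_finrank (K := (D' i).K) (V := (D' i).V), h2, h3, hp]
  · obtain ⟨h1, h2, h3⟩ := (hstep i).1.2 hi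
    exact ⟨h1, h2, h3, h3 ▸ h1.isQPower h2⟩

end Example

end WeilTower

end

/-! ### Assembly of the theorem. -/

open WeilTower in
theorem mainTheorem5 :
    -- The groups `E(f̂)` and `G(f̂)`.
    (∀ D : FormSpace.{u}, D.IsAdmissible →
      (∀ x : D.V, (∀ y : D.V, D.hat x y - D.hat y x = 0) → x = 0) ∧
      (∃ n : ℕ, Nat.card D.V = D.p ^ (2 * n) ∧ Nat.card D.E = D.p ^ (2 * n + 1)) ∧
      IsExtraspecial D.p D.E ∧
      (∀ g : D.V ≃ₗ[D.K] D.V, g ∈ D.G ↔ ∀ x y, D.f (g x) (g y) = D.f x y)) ∧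
    -- Existence of faithful absolutely irreducible representations of `E(f̂)`.
    (∀ D : FormSpace.{u}, D.IsAdmissible → ∀ (K' : Type u) [Field K'] [Finite K'],
      (∃ ε : K', IsPrimitiveRoot ε D.p) →
      ∃ (W : Type u) (_ : AddCommGroup W) (_ : Module K' W) (ρ : Representation K' D.E W),
        FiniteDimensional K' W ∧ IsFaithfulAbsIrr ρ) ∧
    -- Such a representation extends to `G(f̂) ⋉ E(f̂)`, with all the forms it preserves.
    (∀ D : FormSpace.{u}, D.IsAdmissible → ∀ (p' : ℕ), p' ≠ D.p →
      ∀ (K' : Type u) [Field K'] [CharP K' p']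
        (W : Type u) [AddCommGroup W] [Module K' W] [FiniteDimensional K' W]
        (ρ : Representation K' D.E W), IsFaithfulAbsIrr ρ →
      ∃ σ : Representation K' D.GE W,
        (∀ s : D.E, σ (SemidirectProduct.inl s) = ρ s) ∧ Function.Injective σ ∧
        ∀ (θ : K' →+* K') (B : W →ₗ[K'] W →ₛₗ[θ] K'), Preserves ρ B → Preserves σ B) ∧
    -- The forms `f'` preserved by the irreducible representation, when there is no doubling.
    (∀ D : FormSpace.{u}, D.IsAdmissible → ∀ (p' : ℕ) [Fact p'.Prime], p' ≠ D.p →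
      ∀ (K' : Type u) [Field K'] [Finite K'] [CharP K' p']
        (W : Type u) [AddCommGroup W] [Module K' W] [FiniteDimensional K' W]
        (ρ : Representation K' D.E W), IsFaithfulAbsIrr ρ →
      (D.p = 2 → ¬ NeedsDouble D p' →
        ∃ B : W →ₗ[K'] W →ₗ[K'] K', B.IsAlt ∧ B.Nondegenerate ∧ Preserves ρ B) ∧
      (D.p ≠ 2 → ∀ η' : K' →+* K', η' ≠ RingHom.id K' → (∀ a, η' (η' a) = a) →
        (∀ ε : K', ε ^ D.p = 1 → η' ε = ε⁻¹) →
        ∃ B : W →ₗ[K'] W →ₛₗ[η'] K', (∀ x y, B y x = η' (B x y)) ∧ B.Nondegenerate ∧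
          Preserves ρ B) ∧
      (D.p ≠ 2 → ¬ NeedsDouble D p' → Nat.card K' = p' ^ orderOf (p' : ZMod D.p) →
        ∃ η' : K' →+* K', η' ≠ RingHom.id K' ∧ (∀ a, η' (η' a) = a) ∧
          ∀ ε : K', ε ^ D.p = 1 → η' ε = ε⁻¹)) ∧
    -- The embedding `G(f̂) ⋉ E(f̂) → G(f̂')`, on `V' = W* ⊕ W` and on `V' = W`.
    (∀ D D' : FormSpace.{u}, D.IsAdmissible → D'.IsAdmissible → D'.p ≠ D.p →
      (∀ (W : Type u) [AddCommGroup W] [Module D'.K W] (ρ : Representation D'.K D.E W)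
        (e : D'.V ≃ₗ[D'.K] Module.Dual D'.K W × W), IsFaithfulAbsIrr ρ → D'.IsSplitVia e →
        ∃ (σ : Representation D'.K D.GE W) (Φ : D.GE →* D'.G),
          (∀ s : D.E, σ (SemidirectProduct.inl s) = ρ s) ∧ IsDoubleOf Φ σ e ∧
          Function.Injective Φ) ∧
      (∀ ρ : Representation D'.K D.E D'.V, IsFaithfulAbsIrr ρ → Preserves ρ D'.f →
        ∃ Φ : D.GE →* D'.G,
          (∀ s : D.E, D'.natRep (Φ (SemidirectProduct.inl s)) = ρ s) ∧
          Function.Injective Φ)) ∧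
    -- The process can be continued indefinitely, with any sequence of characteristics.
    (∀ D₁ : FormSpace.{u}, D₁.IsAdmissible → ∀ q : ℕ → ℕ, (∀ i, (q i).Prime) → q 0 = D₁.p →
      (∀ i, q (i + 1) ≠ q i) →
      ∃ (D : ℕ → FormSpace.{u}) (Φ : ∀ i, (D i).GE →* (D (i + 1)).G),
        D 0 = D₁ ∧ ∀ i, (D i).IsAdmissible ∧ (D i).p = q i ∧
          IsWeilStep (D i) (D (i + 1)) (Φ i)) ∧
    -- The iterated split extensions are extraspecial towers on top of which sits `G(f̂_0)`.
    (∀ (D : ℕ → FormSpace.{u}) (Φ : ∀ i, (D i).GE →* (D (i + 1)).G) (n : ℕ),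
      (∀ i < n, (D i).IsAdmissible) →
      (∀ i, i + 1 < n → IsWeilStep (D i) (D (i + 1)) (Φ i)) →
      Function.Surjective (toBase D Φ n) ∧
      series D Φ n 0 = (toBase D Φ n).ker ∧
      series D Φ n n = ⊥ ∧
      IsExtraspecialSeries n (series D Φ n) ∧
      (∀ i < n, ∃ _ : ((series D Φ n (i + 1)).subgroupOf (series D Φ n i)).Normal,
        Nonempty ((series D Φ n i ⧸ (series D Φ n (i + 1)).subgroupOf (series D Φ n i)) ≃*
          (D i).E)) ∧
      IsExtraspecialTower n (series D Φ n 0) ∧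
      (¬ (Nat.card (D 0).K = 2 ∧ Nat.card (D 0).V = 4) →
        series D Φ n 0 ≤ commutator (iter D Φ n).Γ) ∧
      ((∀ i < n, IsWeilStep (D i) (D (i + 1)) (Φ i)) →
        Function.Injective (iter D Φ n).hom)) ∧
    -- The example `Sp₂(𝔽₃) ⋉ E ⋉ Q³ ⋉ E⁴ ⋉ Q⁸¹ ⋉ E^(2^80) ⋉ ⋯`.
    (∀ D₁ : FormSpace.{u}, D₁.IsAlternating → Nat.card D₁.K = 3 → Module.finrank D₁.K D₁.V = 2 →
      Nonempty (D₁.G ≃* Matrix.symplecticGroup (Fin 1) (ZMod 3)) ∧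
      ∃ (D : ℕ → FormSpace.{u}) (Φ : ∀ i, (D i).GE →* (D (i + 1)).G),
        D 0 = D₁ ∧
        (∀ i, IsWeilStep (D i) (D (i + 1)) (Φ i)) ∧
        (∀ i, Even i → (D i).IsAlternating ∧ Nat.card (D i).K = 3 ∧
          Module.finrank (D i).K (D i).V = 2 * exponents i ∧
          IsEPower 3 (exponents i) (D i).E) ∧
        (∀ i, Odd i → (D i).IsHermitian ∧ Nat.card (D i).K = 4 ∧
          Module.finrank (D i).K (D i).V = exponents i ∧
          IsQPower (exponents i) (D i).E)) ∧
    (exponents 0 = 1 ∧ exponents 1 = 3 ∧ exponents 2 = 4 ∧ exponents 3 = 81 ∧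
      exponents 4 = 2 ^ 80) := by
  refine ⟨fun D hD => ?_, fun D hD K' _ _ => ?_, fun D hD p' hp K' _ _ W _ _ _ ρ hρ => ?_,
    fun D hD p' _ hp K' _ _ _ W _ _ _ ρ hρ => ?_, fun D D' hD _ hp => ?_,
    fun D₁ hD₁ q hq hq0 hqq => ?_, fun D Φ n hD hΦ => ?_, fun D₁ hD₁ hK hfr => ?_, ?_⟩
  · have hb := hD.isNondeg
    obtain ⟨n, u, v, hs⟩ := hb.exists_isSymplectic
    exact ⟨hb, ⟨n, hs.card_eq, by rw [EGroup.card_eq_mul, hs.card_eq, pow_succ]⟩,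
      EGroup.isExtraspecial hb, hD.mem_G_iff⟩
  · rintro ⟨ε, hε⟩
    obtain ⟨ψ, hψ⟩ := exists_char_of_isPrimitiveRoot hε
    obtain ⟨W, _, _, _, ρ, hρ⟩ := exists_representation hD.isNondeg hψ
    exact ⟨W, _, _, ρ, inferInstance, hρ.isFaithfulAbsIrr hD.isNondeg⟩
  · obtain ⟨ψ, hψ⟩ := exists_isWeil hD.isNondeg hρ
    exact exists_extension hD hψ
  · obtain ⟨ψ, hψ⟩ := exists_isWeil hD.isNondeg hρ
    refine ⟨fun hp2 hnd => exists_alternating_of_not_needsDouble hD hp2 hnd hψ,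
      fun _ η' hη hη2 hε => hψ.exists_hermitian hD.isNondeg η' hη hη2 hε, fun hp2 hnd hcard => ?_⟩
    rw [FormSpace.needsDouble_iff_of_odd hp2, Nat.not_odd_iff_even] at hnd
    exact exists_involution hp2 hnd (orderOf_natCast_pos hp) hcard
  · exact ⟨fun W _ _ ρ e hρ he => FormSpace.exists_embedding_double hD ρ e hρ he,
      fun ρ hρ hf => FormSpace.exists_embedding_of_preserves hD ρ hρ hf⟩
  · obtain ⟨D, Φ, h0, h⟩ := exists_sequence (fun i D => D.IsAdmissible ∧ D.p = q i)
      (fun i D hD => by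
        obtain ⟨D', Φ, h1, h2, h3, -⟩ := exists_isWeilStep hD.1 (hq (i + 1)) (hD.2 ▸ hqq i)
        exact ⟨D', Φ, h3, h1, h2⟩) (D₁ := D₁) ⟨hD₁, hq0.symm⟩
    exact ⟨D, Φ, h0, fun i => ⟨(h i).1.1, (h i).1.2, (h i).2⟩⟩
  · exact ⟨toBase_surjective D Φ n, series_zero D Φ n, series_self D Φ n,
      series_isExtraspecialSeries hD hΦ, fun i hi => exists_series_quotient D Φ hi,
      series_isExtraspecialTower hD hΦ, series_le_commutator hD hΦ, iter_hom_injective⟩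
  · exact ⟨hD₁.nonempty_mulEquiv_symplectic hK hfr, exists_example hD₁ hK hfr⟩
  · exact ⟨rfl, by norm_num [exponents], by norm_num [exponents], by norm_num [exponents],
      by norm_num [exponents]⟩
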